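/- Let $N\ge 1$ be an integer, $k\ge 2$ an even integer, $\chi$ a Dirichlet character modulo $N$, and let $f\in S_k(N,\chi)$ be a holomorphic cusp form of weight $k$ and character $\chi$ on $\Gamma_0(N)$, with Fourier expansion $f(z)=\sum_{n\ge 1}c(n)e^{2\pi i n z}$. Let $d(n)$ be the Fourier coefficients of $$(f|_kw_N)(z)=N^{k/2}(Nz)^{-k}f(-1/(Nz)).$$ For a function $\varphi:(0,\infty)\to\mathbb C$ put $(\mathcal L\varphi)(s)=\int_0^\infty\varphi(x)e^{-sx}\,dx$ and $L_f(\varphi)=\sum_{n\ge1}c(n)(\mathcal L\varphi)(2\pi n)$, where $\varphi$ is called admissible if the Laplace integral converges absolutely for $\operatorname{Re}(s)\ge 0$ and $\sum_{n\ge 1}|c(n)|(\mathcal L|\varphi|)(2\pi n)<\infty$. For $s\in\mathbb C$ let $$\psi_s(t)=\mathbf 1_{(0,1)}(t)\,\frac{(1-t)^{s-1}t^{k-s-1}}{\Gamma(s)} .$$ Then $\psi_s$ is admissible for $0<\operatorname{Re}(s)<\frac{k-1}2$, and $s\mapsto L_f(\psi_s)$ extends from this strip to an entire function; $L_f\big(\psi_{\frac{k-1}{2}}\big)$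 denotes the value of this continuation at $s=\frac{k-1}2$. Let $M(a,b,z)=\sum_{m\ge0}\frac{(a)_m}{(b)_m}\frac{z^m}{m!}$ be Kummer's confluent hypergeometric function, and let $\int_{(-\varepsilon)}$ denote the integral along the line $\operatorname{Re}(s)=-\varepsilon$, oriented upwards. Then for all real $\rho>1$, $X>0$ and $0<\varepsilon<1$, $$\sum_{1\le n<NX/(2\pi)}\frac{d(n)e^{-2\pi n/N}}{(2\pi n/N)^{\frac{k-1}{2}}}\Big(1-\frac{2\pi n}{NX}\Big)^{\rho}= i^{-k}N^{\frac k2}L_f\big(\psi_{\frac{k-1}{2}}\big) +\frac{\Gamma(\rho+1)N^{\frac k2}}{2\pi i^{k+1}\Gamma(k)}\sum_{n\ge1}\frac{c(n)}{e^{2\pi n}}\int_{(-\varepsilon)}X^{s}\,\frac{\Gamma\big(\frac{k+1}{2}-s\big)\Gamma(s)}{\Gamma(s+\rho+1)}\,M\Big(\frac{k-1}{2}+s,k,2\pi n\Big)ds,$$ where each integral and the series on the right converge absolutely. In particular, for $N=1$, $$\sum_{1\le n<X/(2\pi)}\frac{d(n)e^{-2\pi n}}{(2\pi n)^{\frac{k-1}{2}}}\Big(1-\frac{2\pi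 n}{X}\Big)^{\rho}= i^{-k}L_f\big(\psi_{\frac{k-1}{2}}\big) +\frac{\Gamma(\rho+1)}{2\pi i^{k+1}\Gamma(k)}\sum_{n\ge1}\frac{c(n)}{e^{2\pi n}}\int_{(-\varepsilon)}X^{s}\,\frac{\Gamma\big(\frac{k+1}{2}-s\big)\Gamma(s)}{\Gamma(s+\rho+1)}\,M\Big(\frac{k-1}{2}+s,k,2\pi n\Big)ds.$$ -/

import Mathlib

open Complex MeasureTheory Set UpperHalfPlane
open scoped ModularForm MatrixGroups CongruenceSubgroup

noncomputable section

namespace RieszSum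

/-- `f ∈ S_k(N, χ)`: a holomorphic cusp form `f` of weight `k` on `Γ₁(N)` such that
`f ∣[k] γ = χ(d) f` for every `γ = (a b; c d)` in `Γ₀(N)`. -/
def HasNebentypus {N : ℕ} {k : ℤ} (χ : DirichletCharacter ℂ N)
    (f : CuspForm ((CongruenceSubgroup.Gamma1 N : Subgroup SL(2, ℤ)) : Subgroup (GL (Fin 2) ℝ)) k) :
    Prop :=
  ∀ γ ∈ CongruenceSubgroup.Gamma0 N, (f : ℍ → ℂ) ∣[k] γ = χ ((γ 1 1 : ℤ) : ZMod N) • (f : ℍ → ℂ)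

theorem fricke_im_pos (N : ℕ) [NeZero N] (z : ℍ) : 0 < (-1 / ((N : ℂ) * (z : ℂ))).im := by
  have hN : (0 : ℝ) < N := by exact_mod_cast Nat.pos_of_ne_zero (NeZero.ne N)
  have hz : 0 < (z : ℂ).im := z.im_pos
  have hne : (N : ℂ) * (z : ℂ) ≠ 0 := by
    intro h
    have h2 : ((N : ℂ) * (z : ℂ)).im = N * (z : ℂ).im := by simp
    rw [h] at h2
    have : 0 < (N : ℝ) * (z : ℂ).im := mul_pos hN hz
    simp at h2
    rcases h2 with h2 | h2
    · exact NeZero.ne N h2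
    · exact hz.ne' h2
  have hpos : 0 < Complex.normSq ((N : ℂ) * (z : ℂ)) := Complex.normSq_pos.mpr hne
  rw [Complex.div_im]
  have h1 : ((N : ℂ) * (z : ℂ)).im = N * (z : ℂ).im := by simp
  rw [h1]
  simp only [neg_im, one_im, neg_zero, zero_mul, zero_div, neg_re, one_re, zero_sub]
  rw [neg_one_mul, neg_div, neg_neg]
  exact div_pos (mul_pos hN hz) hpos

/-- The point `-1/(Nz)` of the upper half-plane. -/
def frickePoint (N : ℕ) [NeZero N] (z : ℍ) : ℍ := ⟨-1 / ((N : ℂ) * (z : ℂ)), fricke_im_pos N z⟩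

/-- `(f |_k w_N)(z) = N^{k/2} (Nz)^{-k} f(-1/(Nz))`. -/
def frickeSlash (N : ℕ) [NeZero N] (k : ℤ) (f : ℍ → ℂ) (z : ℍ) : ℂ :=
  (((N : ℝ) ^ ((k : ℝ) / 2) : ℝ) : ℂ) * ((N : ℂ) * (z : ℂ)) ^ (-k) * f (frickePoint N z)

/-- The `n`-th Fourier coefficient at `∞` of a function on the upper half-plane of period `1`. -/
def fourierCoefficient (f : ℍ → ℂ) (n : ℕ) : ℂ := (UpperHalfPlane.qExpansion 1 f).coeff n

/-- The Laplace transform `(𝓛φ)(s) = ∫₀^∞ φ(x) e^{-sx} dx`. -/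
def laplace (φ : ℝ → ℂ) (s : ℂ) : ℂ := ∫ x in Ioi (0 : ℝ), φ x * Complex.exp (-(s * (x : ℂ)))

/-- Admissibility of the test function `φ` for the `L`-series with coefficients `c(n)`, `n ≥ 0`:
the Laplace integrals converge absolutely for `Re s ≥ 0` and
`∑ |c(n)| (𝓛|φ|)(2πn)` converges. -/
structure IsTestFunction (c : ℕ → ℂ) (φ : ℝ → ℂ) : Prop where
  integrable : ∀ s : ℂ, 0 ≤ s.re →
    IntegrableOn (fun x : ℝ => φ x * Complex.exp (-(s * (x : ℂ)))) (Ioi (0 : ℝ))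
  summable : Summable fun n : ℕ =>
    ‖c n‖ * ∫ x in Ioi (0 : ℝ), ‖φ x‖ * Real.exp (-(2 * Real.pi * n * x))

/-- `L_f(φ) = ∑ c(n) (𝓛φ)(2πn)`, for `f` with Fourier coefficients `c(n)`. -/
def LSer (c : ℕ → ℂ) (φ : ℝ → ℂ) : ℂ := ∑' n : ℕ, c n * laplace φ (2 * Real.pi * n)

/-- `ψ_s(t) = 1_{(0,1)}(t) (1-t)^{s-1} t^{k-s-1} / Γ(s)`. -/
def psi (k : ℕ) (s : ℂ) : ℝ → ℂ :=
  (Ioo (0 : ℝ) 1).indicator fun t =>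
    (1 - (t : ℂ)) ^ (s - 1) * (t : ℂ) ^ ((k : ℂ) - s - 1) / Complex.Gamma s

/-- `Λ` is the analytic continuation to `ℂ` of `s ↦ L_f(ψ_s)`, which is given by its absolutely
convergent series for `0 < Re s < (k-1)/2`. (For `k ≥ 2` this strip is nonempty, so there is at
most one such `Λ`.) -/
structure IsContinuation (k : ℕ) (c : ℕ → ℂ) (Λ : ℂ → ℂ) : Prop where
  entire : Differentiable ℂ Λ
  admissible : ∀ s : ℂ, 0 < s.re → s.re < ((k : ℝ) - 1) / 2 → IsTestFunction c (psi k s)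
  eq_LSer : ∀ s : ℂ, 0 < s.re → s.re < ((k : ℝ) - 1) / 2 → Λ s = LSer c (psi k s)

/-- Kummer's confluent hypergeometric function
`M(a, b, z) = ∑ (a)_n / (b)_n * z^n / n!` (for `b ≠ 0, -1, -2, …`). -/
def kummerM (a b z : ℂ) : ℂ := Complex.Gamma b * Complex.regularizedHGFun {a} {b} z

theorem kummerM_eq_tsum (a b z : ℂ) (hb : ∀ m : ℕ, b ≠ -m) :
    kummerM a b z = ∑' n : ℕ, (ascPochhammer ℂ n).eval a / (ascPochhammer ℂ n).eval b *
      (z ^ n / (n.factorial : ℂ)) := by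
  have hG : ∀ n : ℕ, Complex.Gamma (b + n) = (ascPochhammer ℂ n).eval b * Complex.Gamma b := by
    intro n
    induction n with
    | zero => simp
    | succ n ih =>
      have hne : b + n ≠ 0 := fun h => hb n (eq_neg_of_add_eq_zero_left h)
      rw [Nat.cast_succ, ← add_assoc, Complex.Gamma_add_one _ hne, ih, ascPochhammer_succ_eval]
      ring
  have hb0 : Complex.Gamma b ≠ 0 := Complex.Gamma_ne_zero hb
  unfold kummerM Complex.regularizedHGFun FormalMultilinearSeries.sum
  rw [← tsum_mul_left]
  refine tsum_congr fun n => ?_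
  have : (Complex.regularizedHGFunSeries {a} {b}) n (fun _ => z) =
      z ^ n * Complex.regularizedHGFunCoeff {a} {b} n := by
    rw [FormalMultilinearSeries.apply_eq_pow_smul_coeff, Complex.regularizedHGFunSeries_coeff,
      smul_eq_mul]
  rw [this]
  simp only [Complex.regularizedHGFunCoeff, Multiset.map_singleton, Multiset.prod_singleton, hG]
  have hp : (ascPochhammer ℂ n).eval b ≠ 0 := by
    intro h
    have h1 := hG n
    rw [h, zero_mul] at h1
    refine Complex.Gamma_ne_zero (s := b + n) (fun m hm => hb (m + n) ?_) h1
    push_cast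
    linear_combination hm
  field_simp

/-- The integrand `X^s Γ((k+1)/2 - s) Γ(s) / Γ(s+ρ+1) · M((k-1)/2 + s, k, 2πn)`. -/
def kernel (k : ℕ) (ρ X : ℝ) (n : ℕ) (s : ℂ) : ℂ :=
  (X : ℂ) ^ s *
    (Complex.Gamma (((k : ℂ) + 1) / 2 - s) * Complex.Gamma s / Complex.Gamma (s + ρ + 1)) *
    kummerM (((k : ℂ) - 1) / 2 + s) k (2 * Real.pi * n)

/-- The integral `∫_{(σ)} F(s) ds` along the vertical line `Re s = σ`, oriented upwards. -/
def lineIntegral (σ : ℝ) (F : ℂ → ℂ) : ℂ := Complex.I * ∫ t : ℝ, F (σ + t * Complex.I)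

/-- `∑_{1 ≤ n < NX/(2π)} d(n) e^{-2πn/N} (2πn/N)^{-(k-1)/2} (1 - 2πn/(NX))^ρ`. -/
def rieszSum (N k : ℕ) (d : ℕ → ℂ) (ρ X : ℝ) : ℂ :=
  ∑ n ∈ Finset.Ico 1 ⌈N * X / (2 * Real.pi)⌉₊,
    d n * ((Real.exp (-(2 * Real.pi * n / N)) / (2 * Real.pi * n / N) ^ (((k : ℝ) - 1) / 2) *
      (1 - 2 * Real.pi * n / (N * X)) ^ ρ : ℝ) : ℂ)

end RieszSum

end

open Complex MeasureTheory Set UpperHalfPlane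
open scoped ModularForm MatrixGroups CongruenceSubgroup

noncomputable section

namespace RieszSum

open Filter Topology

/-! Write `ν = k - 1`, `L = 2π/N`, `C = i^{-k} N^{k/2}`, and split `(1 - x/X)_+^ρ = 1 + cutoff`. The
Riesz sum becomes `∑ d(n) e^{-Ln} (Ln)^{-ν/2} + ∑ d(n) w(Ln)` with `w(x) = e^{-x} x^{-ν/2} ((1 -
x/X)_+^ρ - 1)`.

The only modular input is `∑ d(n) e^{-Lnp} = C p^{-k} ∑ c(n) e^{-2πn/p}` for `Re p > 0`, which is
the definition of `f|w_N` on the ray `z = ip/N`. Substituting `t = 1/(1+u)` in `ψ_s` and using this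
at `p = 1 + u` gives `C L_f(ψ_s) = ∑ d(n) e^{-Ln} (Ln)^{-s}` (`FrickePair.LSer_psi`). The right side
is entire in `s`, and at `s = (k-1)/2` it is the first of the two sums.

The second sum is transformed by Voronoi summation. The Bessel–Clifford function `B_ν(x) = x^{ν/2}
J_ν(2√x)` has Laplace transform `∫ B_ν(ax) e^{-px} dx = a^ν p^{-ν-1} e^{-a/p}`, so the modular
relation is the Laplace transform of a Voronoi formula. That formula is proved for the test
functions `(x - ·)_+`, by uniqueness of Fourier transforms (`FrickePair.tsum_max_sub`). The weight
is a superposition `w(y) = ∫ (x - y)_+ w''(x) dx`, and integrating against `w''` gives `∑ d(n) w(Ln)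
= C ∑ c(n) ŵ(n)`, where `ŵ` is the Bessel transform of `w` (`FrickePair.tsum_rieszWeight`).

Finally `ŵ(n)` is the contour integral of the theorem (`lineIntegral_kernel`): Mellin inversion
writes the cutoff as an integral of `Γ(s)/Γ(s+ρ+1)` over `Re s = -ε`, where the `-1` records the
pole at `0` to the right of the line, and `∫ B_ν(ax) e^{-x} x^{-w} dx` is a multiple of `M(w, k, a)`
by Kummer's transformation.

Convergence on the `c` side rests on two estimates. Parseval and the bound `|f| ≤ C y^{-k/2}` give
`∑ |c(n)| n^{-τ} < ∞` for `τ > (k+1)/2`, and an energy argument for Bessel's equation gives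
`B_{ν+2}(x) = O(x^{(ν+2)/2 - 1/8})`. Any saving below `(ν+2)/2` would suffice. -/

/-! ### Bessel–Clifford functions: differential equation and growth. -/

/-- The entire function `∑ (-1)^m x^{m+ν} / (m! (m+ν)!)`, equal to `x^{ν/2} J_ν(2√x)`. -/
def besselB (ν : ℕ) (x : ℝ) : ℝ :=
  ∑' m : ℕ, (-1 : ℝ) ^ m * x ^ (m + ν) / (m.factorial * (m + ν).factorial)

theorem norm_besselB_term_le (ν m : ℕ) (x : ℝ) :
    ‖(-1 : ℝ) ^ m * x ^ (m + ν) / (m.factorial * (m + ν).factorial)‖ ≤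
      |x| ^ ν * (|x| ^ m / m.factorial) := by
  have h1 : (1 : ℝ) ≤ (m + ν).factorial := by exact_mod_cast Nat.one_le_iff_ne_zero.2 (Nat.factorial_ne_zero _)
  have h2 : (0 : ℝ) < m.factorial := by positivity
  simp only [norm_div, norm_mul, norm_pow, norm_neg, norm_one, one_pow, one_mul, Real.norm_eq_abs,
    Nat.abs_cast]
  rw [pow_add, mul_comm (|x| ^ m), ← mul_div_assoc]
  gcongr
  nlinarith

theorem summable_besselB_bound (ν : ℕ) (x : ℝ) :
    Summable fun m : ℕ => |x| ^ ν * (|x| ^ m / m.factorial) :=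
  (Real.summable_pow_div_factorial _).mul_left _

theorem summable_besselB (ν : ℕ) (x : ℝ) :
    Summable fun m : ℕ => (-1 : ℝ) ^ m * x ^ (m + ν) / (m.factorial * (m + ν).factorial) :=
  .of_norm_bounded (summable_besselB_bound ν x) fun m => norm_besselB_term_le ν m x

theorem abs_besselB_le (ν : ℕ) (x : ℝ) : |besselB ν x| ≤ |x| ^ ν * Real.exp |x| := by
  have h := tsum_of_norm_bounded (summable_besselB_bound ν x).hasSum
    fun m => norm_besselB_term_le ν m x
  rwa [tsum_mul_left, (NormedSpace.expSeries_div_hasSum_exp |x|).tsum_eq,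
    ← congrFun Real.exp_eq_exp_ℝ _] at h

theorem hasDerivAt_besselB_term (ν m : ℕ) (x : ℝ) :
    HasDerivAt (fun x : ℝ => (-1 : ℝ) ^ m * x ^ (m + (ν + 1)) /
      (m.factorial * (m + (ν + 1)).factorial))
      ((-1 : ℝ) ^ m * x ^ (m + ν) / (m.factorial * (m + ν).factorial)) x := by
  have h := ((hasDerivAt_pow (m + ν + 1) x).const_mul ((-1 : ℝ) ^ m)).div_const
    ((m.factorial : ℝ) * ((m + ν + 1).factorial : ℝ))
  refine h.congr_deriv ?_
  rw [Nat.factorial_succ, Nat.add_sub_cancel]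
  have : ((m + ν + 1 : ℕ) : ℝ) ≠ 0 := by positivity
  rw [Nat.cast_mul]
  field_simp

theorem hasDerivAt_besselB (ν : ℕ) (x : ℝ) : HasDerivAt (besselB (ν + 1)) (besselB ν x) x := by
  have hx : x ∈ Ioo (-(|x| + 1)) (|x| + 1) := by
    rw [mem_Ioo, ← abs_lt]; linarith
  have key := hasDerivAt_tsum_of_isPreconnected (𝕜 := ℝ) (y := x)
    (g := fun (m : ℕ) (x : ℝ) => (-1 : ℝ) ^ m * x ^ (m + (ν + 1)) /
      (m.factorial * (m + (ν + 1)).factorial))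
    (g' := fun (m : ℕ) (x : ℝ) => (-1 : ℝ) ^ m * x ^ (m + ν) / (m.factorial * (m + ν).factorial))
    (summable_besselB_bound ν (|x| + 1)) isOpen_Ioo
    isPreconnected_Ioo (fun m y _ => hasDerivAt_besselB_term ν m y) (fun m y hy => ?_) hx
    (summable_besselB (ν + 1) x) hx
  · exact key
  · refine (norm_besselB_term_le ν m y).trans ?_
    have : |y| ≤ |(|x| + 1)| := (abs_lt.2 hy).le.trans (le_abs_self _)
    gcongr

theorem continuous_besselB (ν : ℕ) : Continuous (besselB ν) := by
  refine continuous_iff_continuousAt.2 fun x => ?_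
  have hx : x ∈ Ioo (-(|x| + 1)) (|x| + 1) := by
    rw [mem_Ioo, ← abs_lt]; linarith
  refine ContinuousOn.continuousAt (s := Ioo (-(|x| + 1)) (|x| + 1)) ?_ (isOpen_Ioo.mem_nhds hx)
  refine continuousOn_tsum (fun m => by fun_prop) (summable_besselB_bound ν (|x| + 1))
    fun m y hy => (norm_besselB_term_le ν m y).trans ?_
  have : |y| ≤ |(|x| + 1)| := (abs_lt.2 hy).le.trans (le_abs_self _)
  gcongr

/-- With `B_{ν+1}' = B_ν` this is Bessel's equation `x b'' = (ν+1) b' - b` for `b = B_{ν+2}`. It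
follows by comparing coefficients. -/
theorem mul_besselB (ν : ℕ) (x : ℝ) :
    x * besselB ν x = (ν + 1) * besselB (ν + 1) x - besselB (ν + 2) x := by
  have h0 := (summable_besselB ν x).hasSum.mul_left x
  have h1 := (summable_besselB (ν + 1) x).hasSum.mul_left ((ν : ℝ) + 1)
  have h2 := (summable_besselB (ν + 2) x).hasSum
  have h3 := h1.sub h0
  have h4 : HasSum (fun m : ℕ => (ν + 1 : ℝ) *
      ((-1 : ℝ) ^ m * x ^ (m + (ν + 1)) / (m.factorial * (m + (ν + 1)).factorial)) -
      x * ((-1 : ℝ) ^ m * x ^ (m + ν) / (m.factorial * (m + ν).factorial)))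
      (besselB (ν + 2) x) := by
    -- The terms with `m = 0` cancel, and the term of index `m + 1` on the left is the term of index
    -- `m` of `B_{ν+2}`.
    rw [← hasSum_nat_add_iff' 1]
    convert! h2 using 1
    · ext m
      rw [show m + 1 + (ν + 1) = m + ν + 1 + 1 by ring, show m + 1 + ν = m + ν + 1 by ring,
        show m + (ν + 2) = m + ν + 1 + 1 by ring, Nat.factorial_succ (m + ν + 1),
        Nat.factorial_succ m]
      have : ((m + ν + 1 + 1 : ℕ) : ℝ) ≠ 0 := by positivity
      have : ((m + 1 : ℕ) : ℝ) ≠ 0 := by positivity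
      push_cast at *
      field_simp
      ring
    · simp only [Finset.range_one, Finset.sum_singleton, pow_zero, zero_add, Nat.factorial_zero,
        Nat.cast_one, one_mul, Nat.factorial_succ ν]
      have : ((ν + 1 : ℕ) : ℝ) ≠ 0 := by positivity
      push_cast at *
      field_simp
      unfold besselB
      ring
  have := h3.unique h4
  unfold besselB at *
  linarith

/-- The energy `x^{-p} (b² + x b'² - κ b b')` is decreasing for large `x` by Bessel's equation, and
it controls `x^{-p} b²`. The true order is `x^{(ν+2)/2 - 1/4}`; giving up `1/8` in the exponent
makes the derivative of the energy strictly negative, so that no asymptotic expansion is needed. -/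
theorem exists_abs_besselB_le (ν : ℕ) :
    ∃ K : ℝ, 0 ≤ K ∧ ∀ x : ℝ, 0 < x →
      |besselB (ν + 2) x| ≤ K * x ^ (((ν : ℝ) + 2) / 2 - 1 / 8) := by
  set M : ℝ := ν + 2 with hM
  have hM2 : 2 ≤ M := by rw [hM]; linarith [(Nat.cast_nonneg ν : (0 : ℝ) ≤ ν)]
  set x₀ : ℝ := 9 * M ^ 2 with hx₀
  have hx₀1 : 1 ≤ x₀ := by nlinarith
  -- The sharp exponent would be `M - 1/2`. The value of `κ` makes the coefficients of `b²` and `x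
  -- b'²` in the derivative equal, both being `-1/4`.
  set p : ℝ := M - 1 / 4 with hp
  set κ : ℝ := M - 1 / 2 with hκ
  set b := besselB (ν + 2)
  set b' := besselB (ν + 1)
  set b'' := besselB ν
  have hrec : ∀ x, x * b'' x = (M - 1) * b' x - b x := fun x => by
    rw [hM]; linarith [mul_besselB ν x]
  set E : ℝ → ℝ := fun x => x ^ (-p) * (b x ^ 2 + x * b' x ^ 2 - κ * (b x * b' x)) with hE
  have hder : ∀ x, 0 < x → HasDerivAt E
      (x ^ (-p - 1) * (-(1 / 4) * (x * b' x ^ 2) - 1 / 4 * b x ^ 2 + κ * (3 / 4) * (b x * b' x)))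
      x := by
    intro x hx
    have hb : HasDerivAt b (b' x) x := hasDerivAt_besselB (ν + 1) x
    have hb' : HasDerivAt b' (b'' x) x := hasDerivAt_besselB ν x
    have h := (Real.hasDerivAt_rpow_const (p := -p) (Or.inl hx.ne')).mul
      (((hb.pow 2).add ((hasDerivAt_id x).mul (hb'.pow 2))).sub ((hb.mul hb').const_mul κ))
    convert! h using 1
    have e1 : x ^ (-p) = x ^ (-p - 1) * x := by
      rw [Real.rpow_sub_one hx.ne']; field_simp
    simp only [Pi.add_apply, Pi.sub_apply, Pi.mul_apply, Pi.pow_apply, id]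
    rw [e1]
    have := hrec x
    push_cast
    simp only [hp, hκ]
    linear_combination (-(x ^ (-p - 1)) * (2 * x * b' x - (M - 1 / 2) * b x)) * this
  -- From `(|b| - 3M|b'|)² ≥ 0` and `9M² ≤ x`; this is the reason for the value of `x₀`.
  have key : ∀ x, x₀ ≤ x → 3 * M * |b x * b' x| ≤ (b x ^ 2 + x * b' x ^ 2) / 2 := by
    intro x hx
    rw [abs_mul, ← sq_abs (b x), ← sq_abs (b' x)]
    nlinarith [sq_nonneg (|b x| - 3 * M * |b' x|), sq_nonneg (|b' x|),
      mul_le_mul_of_nonneg_right hx (sq_nonneg (|b' x|))]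
  have hanti : AntitoneOn E (Ici x₀) := by
    refine antitoneOn_of_deriv_nonpos (convex_Ici x₀)
      (fun x hx => (hder x (by linarith [mem_Ici.1 hx])).continuousAt.continuousWithinAt)
      (fun x hx => ?_) fun x hx => ?_
    · rw [interior_Ici] at hx
      exact (hder x (by linarith [mem_Ioi.1 hx])).differentiableAt.differentiableWithinAt
    · rw [interior_Ici] at hx
      have hx' : x₀ ≤ x := (mem_Ioi.1 hx).le
      rw [(hder x (by linarith)).deriv]
      refine mul_nonpos_of_nonneg_of_nonpos (Real.rpow_nonneg (by linarith) _) ?_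
      have h1 := key x hx'
      have h2 := le_abs_self (b x * b' x)
      have h3 : κ * (3 / 4) * (b x * b' x) ≤ κ * (3 / 4) * |b x * b' x| :=
        mul_le_mul_of_nonneg_left h2 (by rw [hκ]; linarith)
      have h4 : κ * (3 / 4) * |b x * b' x| ≤ 3 * M / 2 * |b x * b' x| :=
        mul_le_mul_of_nonneg_right (by rw [hκ]; linarith) (abs_nonneg _)
      linarith
  have hlow : ∀ x, x₀ ≤ x → x ^ (-p) * (b x ^ 2 / 2) ≤ E x := by
    intro x hx
    refine mul_le_mul_of_nonneg_left ?_ (Real.rpow_nonneg (by linarith) _)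
    have h1 := key x hx
    have h2 := le_abs_self (b x * b' x)
    have h3 : κ * (b x * b' x) ≤ κ * |b x * b' x| :=
      mul_le_mul_of_nonneg_left h2 (by rw [hκ]; linarith)
    have h4 : κ * |b x * b' x| ≤ 3 * M * |b x * b' x| :=
      mul_le_mul_of_nonneg_right (by rw [hκ]; linarith) (abs_nonneg _)
    have : 0 ≤ x * b' x ^ 2 := mul_nonneg (by linarith) (sq_nonneg _)
    linarith
  have hE0 : 0 ≤ E x₀ := (mul_nonneg (Real.rpow_nonneg (by linarith) _) (by positivity)).trans
    (hlow x₀ le_rfl)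
  have hexp : M / 2 - 1 / 8 = p / 2 := by rw [hp]; ring
  refine ⟨√(2 * E x₀) + x₀ ^ (M - p / 2) * Real.exp x₀, by positivity, fun x hx => ?_⟩
  rw [hexp]
  rcases le_total x₀ x with h | h
  · have h1 := (hlow x h).trans (hanti (mem_Ici.2 le_rfl) (mem_Ici.2 h) h)
    have h2 : b x ^ 2 ≤ 2 * E x₀ * x ^ p := by
      have hxp : 0 < x ^ p := Real.rpow_pos_of_pos hx _
      rw [Real.rpow_neg hx.le, inv_mul_le_iff₀ hxp] at h1
      linarith
    have h3 : |b x| ≤ √(2 * E x₀) * x ^ (p / 2) := by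
      have : x ^ (p / 2) = √(x ^ p) := by
        rw [Real.sqrt_eq_rpow, ← Real.rpow_mul hx.le]; ring_nf
      rw [this, ← Real.sqrt_mul (by positivity)]
      exact Real.abs_le_sqrt h2
    refine h3.trans (mul_le_mul_of_nonneg_right ?_ (by positivity))
    have : 0 ≤ x₀ ^ (M - p / 2) * Real.exp x₀ := by positivity
    linarith
  -- On the bounded range the power series bound is enough, because `b` vanishes at `0` to order `M
  -- > p/2`.
  · have h1 := abs_besselB_le (ν + 2) x
    rw [abs_of_pos hx] at h1
    have h2 : x ^ (ν + 2) = x ^ (M - p / 2) * x ^ (p / 2) := by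
      rw [← Real.rpow_add hx, sub_add_cancel, hM, ← Real.rpow_natCast]; push_cast; rfl
    have h3 : x ^ (M - p / 2) ≤ x₀ ^ (M - p / 2) :=
      Real.rpow_le_rpow hx.le h (by rw [hp]; linarith)
    have h4 : Real.exp x ≤ Real.exp x₀ := Real.exp_le_exp.2 h
    calc |b x| ≤ x ^ (M - p / 2) * x ^ (p / 2) * Real.exp x := by rw [← h2]; exact h1
      _ = (x ^ (M - p / 2) * Real.exp x) * x ^ (p / 2) := by ring
      _ ≤ (x₀ ^ (M - p / 2) * Real.exp x₀) * x ^ (p / 2) := by gcongr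
      _ ≤ _ := by
        refine mul_le_mul_of_nonneg_right ?_ (by positivity)
        have := Real.sqrt_nonneg (2 * E x₀)
        linarith

/-! ### Laplace and Mellin transforms of the Bessel–Clifford function. -/

/-- By Tonelli `∑ ‖F i‖` has finite integral, so the series converges absolutely almost everywhere;
measurability passes to the limit of the partial sums. -/
theorem integrable_tsum_of_summable_integral_norm {α : Type*} [MeasurableSpace α] {μ : Measure α}
    {F : ℕ → α → ℂ} (hF : ∀ i, Integrable (F i) μ) (hs : Summable fun i => ∫ a, ‖F i a‖ ∂μ) :
    Integrable (fun a => ∑' i, F i a) μ := by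
  have hlin : ∫⁻ a, ∑' i, ‖F i a‖ₑ ∂μ < ⊤ := by
    rw [lintegral_tsum fun i => (hF i).1.enorm]
    simp_rw [← ofReal_integral_norm_eq_lintegral_enorm (hF _)]
    rw [← ENNReal.ofReal_tsum_of_nonneg (fun i => integral_nonneg fun a => norm_nonneg _) hs]
    exact ENNReal.ofReal_lt_top
  have hae : ∀ᵐ a ∂μ, Summable fun i => F i a := by
    filter_upwards [ae_lt_top' (AEMeasurable.tsum fun i => (hF i).1.enorm) hlin.ne] with a ha
    refine Summable.of_norm ?_
    have := ENNReal.summable_toReal ha.ne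
    simpa using this
  refine ⟨?_, ?_⟩
  · refine aestronglyMeasurable_of_tendsto_ae atTop
      (f := fun (n : ℕ) a => ∑ i ∈ Finset.range n, F i a)
      (fun n => Finset.aestronglyMeasurable_fun_sum _ fun i _ => (hF i).1) ?_
    filter_upwards [hae] with a ha
    exact ha.hasSum.tendsto_sum_nat
  · refine (lintegral_mono fun a => ?_).trans_lt hlin
    exact enorm_tsum_le_tsum_enorm

theorem integrableOn_rpow_mul_exp_neg_mul {s r : ℝ} (hs : -1 < s) (hr : 0 < r) :
    IntegrableOn (fun x : ℝ => x ^ s * Real.exp (-(r * x))) (Ioi 0) := by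
  simpa using integrableOn_rpow_mul_exp_neg_mul_rpow hs one_pos hr

theorem integrableOn_pow_mul_cexp_neg_mul (n : ℕ) {p : ℂ} (hp : 0 < p.re) :
    IntegrableOn (fun x : ℝ => (x : ℂ) ^ n * Complex.exp (-(p * x))) (Ioi 0) := by
  have h := integrableOn_rpow_mul_exp_neg_mul (s := n) (by linarith [(Nat.cast_nonneg n : (0:ℝ) ≤ n)]) hp
  refine h.mono' (by fun_prop) ?_
  filter_upwards [ae_restrict_mem measurableSet_Ioi] with x hx
  simp [Complex.norm_exp, abs_of_pos (mem_Ioi.1 hx)]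

theorem tendsto_pow_mul_cexp_neg_mul (n : ℕ) {p : ℂ} (hp : 0 < p.re) :
    Tendsto (fun x : ℝ => (x : ℂ) ^ n * Complex.exp (-(p * x))) atTop (𝓝 0) := by
  rw [tendsto_zero_iff_norm_tendsto_zero]
  have h := tendsto_rpow_mul_exp_neg_mul_atTop_nhds_zero n p.re hp
  refine h.congr' ?_
  filter_upwards [eventually_gt_atTop 0] with x hx
  simp [Complex.norm_exp, abs_of_pos hx]

theorem integral_pow_mul_cexp_neg_mul (n : ℕ) {p : ℂ} (hp : 0 < p.re) :
    ∫ x in Ioi (0 : ℝ), (x : ℂ) ^ n * Complex.exp (-(p * x)) = n.factorial / p ^ (n + 1) := by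
  have hp0 : p ≠ 0 := fun h => by simp [h] at hp
  have hE : ∀ x : ℝ, HasDerivAt (fun x : ℝ => Complex.exp (-(p * x)))
      (Complex.exp (-(p * x)) * -p) x := fun x => by
    have := (((hasDerivAt_id (x : ℂ)).const_mul p).neg.cexp).comp_ofReal
    simpa using this
  induction n with
  | zero =>
    have h := integral_Ioi_of_hasDerivAt_of_tendsto' (a := 0) (fun x _ => hE x)
      (by simpa using! (integrableOn_pow_mul_cexp_neg_mul 0 hp).mul_const (-p))
      (by simpa using! tendsto_pow_mul_cexp_neg_mul 0 hp)
    rw [integral_mul_const] at h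
    simp only [ofReal_zero, mul_zero, neg_zero, Complex.exp_zero, zero_sub] at h
    simp only [pow_zero, one_mul, Nat.factorial_zero, Nat.cast_one, zero_add, pow_one]
    field_simp
    linear_combination -h
  | succ n ih =>
    have hP : ∀ x : ℝ, HasDerivAt (fun x : ℝ => (x : ℂ) ^ (n + 1) * Complex.exp (-(p * x)))
        ((n + 1) * ((x : ℂ) ^ n * Complex.exp (-(p * x))) -
          p * ((x : ℂ) ^ (n + 1) * Complex.exp (-(p * x)))) x := fun x => by
      have := ((hasDerivAt_pow (n + 1) (x : ℂ)).comp_ofReal).mul (hE x)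
      refine this.congr_deriv ?_
      simp
      ring
    have h1 := (integrableOn_pow_mul_cexp_neg_mul n hp).const_mul ((n : ℂ) + 1)
    have h2 := (integrableOn_pow_mul_cexp_neg_mul (n + 1) hp).const_mul p
    have h := integral_Ioi_of_hasDerivAt_of_tendsto' (a := 0) (fun x _ => hP x) (h1.sub h2)
      (tendsto_pow_mul_cexp_neg_mul (n + 1) hp)
    rw [integral_sub h1 h2, integral_const_mul, integral_const_mul, ih] at h
    simp only [ofReal_zero, ne_eq, Nat.add_eq_zero_iff, one_ne_zero, and_false, not_false_eq_true,
      zero_pow, zero_mul, sub_zero] at h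
    rw [Nat.factorial_succ]
    push_cast
    have h' : p * ∫ x in Ioi (0 : ℝ), (x : ℂ) ^ (n + 1) * Complex.exp (-(p * x)) =
      (n + 1) * (n.factorial / p ^ (n + 1)) := by linear_combination -h
    field_simp at h' ⊢
    linear_combination h'

/-- The `m`-th term of the series of `besselB ν (a x)` as a complex number. -/
theorem ofReal_besselB (ν : ℕ) (x : ℝ) : ((besselB ν x : ℝ) : ℂ) =
    ∑' m : ℕ, (-1 : ℂ) ^ m * x ^ (m + ν) / (m.factorial * (m + ν).factorial) := by
  rw [besselB, Complex.ofReal_tsum]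
  push_cast
  rfl

section Laplace

variable {p : ℂ} (ν : ℕ) {a : ℝ}

/-- Termwise integration turns the Bessel series into an exponential series. The factor `p^{-(ν+1)}
e^{-a/p}` is what the weight `ν + 1` inversion `p ↦ 1/p` produces. -/
theorem integrable_and_hasSum_laplace_besselB (hp : 0 < p.re) (ha : 0 ≤ a) :
    IntegrableOn (fun x : ℝ => ((besselB ν (a * x) : ℝ) : ℂ) * Complex.exp (-(p * x))) (Ioi 0) ∧
    ∫ x in Ioi (0 : ℝ), ((besselB ν (a * x) : ℝ) : ℂ) * Complex.exp (-(p * x)) =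
      a ^ ν / p ^ (ν + 1) * Complex.exp (-(a / p)) := by
  have hp0 : p ≠ 0 := fun h => by simp [h] at hp
  set F : ℕ → ℝ → ℂ := fun m x =>
    ((-1 : ℂ) ^ m * a ^ (m + ν) / (m.factorial * (m + ν).factorial)) *
      ((x : ℂ) ^ (m + ν) * Complex.exp (-(p * x))) with hF
  have hFi : ∀ m, IntegrableOn (F m) (Ioi 0) := fun m =>
    (integrableOn_pow_mul_cexp_neg_mul (m + ν) hp).const_mul _
  have hnorm : ∀ m, ∫ x in Ioi (0 : ℝ), ‖F m x‖ = a ^ ν / p.re ^ (ν + 1) *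
      ((a / p.re) ^ m / m.factorial) := by
    intro m
    have h1 : ∫ x in Ioi (0 : ℝ), ‖F m x‖ = ∫ x in Ioi (0 : ℝ),
        (a ^ (m + ν) / (m.factorial * (m + ν).factorial)) *
          (x ^ ((m + ν + 1 : ℝ) - 1) * Real.exp (-(p.re * x))) := by
      refine setIntegral_congr_fun measurableSet_Ioi fun x hx => ?_
      simp only [hF, norm_mul, norm_div, norm_pow, norm_neg, norm_one, one_pow, one_mul,
        Complex.norm_real, Real.norm_eq_abs, abs_of_nonneg ha, abs_of_pos (mem_Ioi.1 hx),
        Complex.norm_natCast, Complex.norm_exp]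
      rw [show ((m : ℝ) + ν + 1 - 1) = ((m + ν : ℕ) : ℝ) by push_cast; ring, Real.rpow_natCast]
      simp
    rw [h1, integral_const_mul, Real.integral_rpow_mul_exp_neg_mul_Ioi (by positivity) hp,
      show ((m : ℝ) + ν + 1) = ((m + ν : ℕ) : ℝ) + 1 by push_cast; ring,
      Real.Gamma_nat_eq_factorial, Real.rpow_add_one (by positivity), Real.rpow_natCast]
    rw [div_pow, div_pow]
    field_simp
    ring
  have hsum : Summable fun m => ∫ x in Ioi (0 : ℝ), ‖F m x‖ := by
    simp_rw [hnorm]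
    exact (Real.summable_pow_div_factorial _).mul_left _
  have htsum : (fun x : ℝ => ((besselB ν (a * x) : ℝ) : ℂ) * Complex.exp (-(p * x))) =
      fun x => ∑' m, F m x := by
    ext x
    rw [ofReal_besselB, ← tsum_mul_right]
    refine tsum_congr fun m => ?_
    simp only [hF]
    push_cast
    ring
  rw [htsum]
  refine ⟨integrable_tsum_of_summable_integral_norm hFi hsum, ?_⟩
  have h1 := hasSum_integral_of_summable_integral_norm hFi hsum
  have h2 : HasSum (fun m => ∫ x in Ioi (0 : ℝ), F m x)
      (a ^ ν / p ^ (ν + 1) * Complex.exp (-(a / p))) := by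
    have := (NormedSpace.expSeries_div_hasSum_exp (-((a : ℂ) / p))).mul_left ((a : ℂ) ^ ν / p ^ (ν + 1))
    rw [← congrFun Complex.exp_eq_exp_ℂ _] at this
    convert! this using 2 with m
    rw [integral_const_mul, integral_pow_mul_cexp_neg_mul _ hp]
    have : ((m + ν).factorial : ℂ) ≠ 0 := by exact_mod_cast Nat.factorial_ne_zero _
    rw [neg_pow ((a : ℂ) / p), div_pow]
    field_simp
    ring
  exact h1.unique h2

end Laplace

theorem summable_pow_mul_Gamma_div (ν : ℕ) {a c : ℝ} (ha : 0 ≤ a) (hc : 0 < c) :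
    Summable fun m : ℕ => a ^ (m + ν) * Real.Gamma (m + c) / (m.factorial * (m + ν).factorial) := by
  rcases ha.eq_or_lt with rfl | ha
  -- The ratio test needs nonzero terms. For `a = 0` every term with `m ≠ 0` vanishes.
  · refine summable_of_ne_finset_zero (s := {0}) fun m hm => ?_
    have : m + ν ≠ 0 := by simp at hm; omega
    rw [zero_pow this, zero_mul, zero_div]
  have hG : ∀ m : ℕ, 0 < Real.Gamma (m + c) := fun m => Real.Gamma_pos_of_pos (by positivity)
  have hpos : ∀ m : ℕ, 0 < a ^ (m + ν) * Real.Gamma (m + c) / (m.factorial * (m + ν).factorial) :=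
    fun m => by have := hG m; positivity
  refine summable_of_ratio_test_tendsto_lt_one (l := 0) one_pos
    (Eventually.of_forall fun m => (hpos m).ne') ?_
  have hr : ∀ m : ℕ, ‖a ^ (m + 1 + ν) * Real.Gamma ((m + 1 : ℕ) + c) /
      ((m + 1).factorial * (m + 1 + ν).factorial)‖ /
      ‖a ^ (m + ν) * Real.Gamma (m + c) / (m.factorial * (m + ν).factorial)‖ =
      (a / (m + 1)) * ((m + c) / (m + 1 + ν)) := by
    intro m
    rw [Real.norm_of_nonneg (hpos _).le, Real.norm_of_nonneg (hpos _).le,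
      show (((m + 1 : ℕ) : ℝ) + c) = (m + c) + 1 by push_cast; ring,
      Real.Gamma_add_one (by positivity), show m + 1 + ν = (m + ν) + 1 by ring,
      Nat.factorial_succ, Nat.factorial_succ]
    have := (hG m).ne'
    push_cast
    field_simp
    ring
  simp_rw [hr]
  have h1 : Tendsto (fun m : ℕ => a / ((m : ℝ) + 1)) atTop (𝓝 0) :=
    tendsto_const_div_atTop_nhds_zero_nat a |>.comp (tendsto_add_atTop_nat 1) |>.congr
      fun m => by simp
  refine squeeze_zero (fun m => by positivity) (fun m => ?_)
    (by simpa using h1.mul_const (1 + c))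
  refine mul_le_mul_of_nonneg_left ?_ (by positivity)
  rw [div_le_iff₀ (by positivity)]
  have : (0 : ℝ) ≤ m := by positivity
  have : (0 : ℝ) ≤ ν := by positivity
  nlinarith [mul_nonneg hc.le ‹(0:ℝ) ≤ m›, mul_nonneg hc.le ‹(0:ℝ) ≤ ν›]

/-- Each term is a Gamma integral, convergent because `Re w < ν + 1`. The resulting series is
identified later as a Kummer function. -/
theorem integrable_and_hasSum_mellin_besselB (ν : ℕ) {a : ℝ} {w : ℂ} (ha : 0 ≤ a)
    (hw : w.re < ν + 1) :
    IntegrableOn (fun x : ℝ => ((besselB ν (a * x) : ℝ) : ℂ) *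
      (Complex.exp (-x) * (x : ℂ) ^ (-w))) (Ioi 0) ∧
    HasSum (fun m : ℕ => (-1 : ℂ) ^ m * a ^ (m + ν) / (m.factorial * (m + ν).factorial) *
        Complex.Gamma (m + ν + 1 - w))
      (∫ x in Ioi (0 : ℝ), ((besselB ν (a * x) : ℝ) : ℂ) *
        (Complex.exp (-x) * (x : ℂ) ^ (-w))) := by
  set F : ℕ → ℝ → ℂ := fun m x =>
    ((-1 : ℂ) ^ m * a ^ (m + ν) / (m.factorial * (m + ν).factorial)) *
      (Complex.exp (-x) * (x : ℂ) ^ ((m + ν + 1 - w : ℂ) - 1)) with hF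
  have hre : ∀ m : ℕ, 0 < (m + ν + 1 - w : ℂ).re := fun m => by
    have : (0 : ℝ) ≤ m := by positivity
    simp
    linarith
  have hFi : ∀ m, IntegrableOn (F m) (Ioi 0) := fun m => by
    have := (Complex.GammaIntegral_convergent (hre m)).const_mul
      ((-1 : ℂ) ^ m * a ^ (m + ν) / (m.factorial * (m + ν).factorial))
    simpa [hF] using! this
  have hnorm : ∀ m, ∫ x in Ioi (0 : ℝ), ‖F m x‖ = a ^ (m + ν) * Real.Gamma (m + (ν + 1 - w.re)) /
      (m.factorial * (m + ν).factorial) := by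
    intro m
    have h1 : ∫ x in Ioi (0 : ℝ), ‖F m x‖ = ∫ x in Ioi (0 : ℝ),
        (a ^ (m + ν) / (m.factorial * (m + ν).factorial)) *
          (Real.exp (-x) * x ^ ((m + (ν + 1 - w.re)) - 1)) := by
      refine setIntegral_congr_fun measurableSet_Ioi fun x hx => ?_
      simp only [hF, norm_mul, norm_div, norm_pow, norm_neg, norm_one, one_pow, one_mul,
        Complex.norm_real, Real.norm_eq_abs, abs_of_nonneg ha,
        Complex.norm_natCast, Complex.norm_exp,
        Complex.norm_cpow_eq_rpow_re_of_pos (mem_Ioi.1 hx)]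
      simp [add_sub_assoc, add_assoc]
    have h2 := hre m
    rw [h1, integral_const_mul, ← Real.Gamma_eq_integral]
    · ring
    · simp at h2; linarith
  have hsum : Summable fun m => ∫ x in Ioi (0 : ℝ), ‖F m x‖ := by
    simp_rw [hnorm]
    exact summable_pow_mul_Gamma_div ν ha (by linarith)
  have htsum : EqOn (fun x : ℝ => ((besselB ν (a * x) : ℝ) : ℂ) *
      (Complex.exp (-x) * (x : ℂ) ^ (-w))) (fun x => ∑' m, F m x) (Ioi 0) := by
    intro x hx
    simp only
    rw [ofReal_besselB, ← tsum_mul_right]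
    refine tsum_congr fun m => ?_
    have hx0 : (x : ℂ) ≠ 0 := by exact_mod_cast (mem_Ioi.1 hx).ne'
    simp only [hF]
    rw [show ((m : ℂ) + ν + 1 - w - 1) = ((m + ν : ℕ) : ℂ) + -w by push_cast; ring,
      Complex.cpow_add _ _ hx0, Complex.cpow_natCast]
    push_cast
    ring
  refine ⟨(integrableOn_congr_fun htsum measurableSet_Ioi).2
    (integrable_tsum_of_summable_integral_norm hFi hsum), ?_⟩
  rw [setIntegral_congr_fun measurableSet_Ioi htsum]
  have h1 := hasSum_integral_of_summable_integral_norm hFi hsum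
  convert! h1 using 2 with m
  rw [integral_const_mul, Complex.Gamma_eq_integral (hre m), Complex.GammaIntegral]
  simp

/-! ### Kummer's function as an integral of the Bessel–Clifford function. -/

theorem ascPochhammer_eval_succ_left (n : ℕ) (z : ℂ) :
    (ascPochhammer ℂ (n + 1)).eval z = z * (ascPochhammer ℂ n).eval (z + 1) := by
  simp [ascPochhammer_succ_left]

theorem ascPochhammer_eval_natCast_add_one_ne_zero (n ν : ℕ) :
    (ascPochhammer ℂ n).eval ((ν : ℂ) + 1) ≠ 0 := by
  have h := ascPochhammer_pos n ((ν : ℝ) + 1) (by positivity)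
  have h2 := ascPochhammer_eval_cast (S := ℂ) n (ν + 1)
  push_cast at h2
  rw [← h2]
  have h3 := ascPochhammer_eval_cast (S := ℝ) n (ν + 1)
  push_cast at h3
  rw [← h3] at h
  exact_mod_cast h.ne'

/-- The Chu–Vandermonde identity. -/
theorem sum_antidiagonal_choose_mul_ascPochhammer (m ν : ℕ) (w : ℂ) :
    ∑ ij ∈ Finset.HasAntidiagonal.antidiagonal m, (m.choose ij.1 : ℂ) * ((-1) ^ ij.1 *
      (ascPochhammer ℂ ij.1).eval w / (ascPochhammer ℂ ij.1).eval ((ν : ℂ) + 1)) =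
    (ascPochhammer ℂ m).eval (ν + 1 - w) / (ascPochhammer ℂ m).eval ((ν : ℂ) + 1) := by
  induction m generalizing ν w with
  | zero => simp
  | succ m ih =>
    have h := Finset.sum_antidiagonal_choose_succ_mul (R := ℂ) (fun i _ => (-1) ^ i *
      (ascPochhammer ℂ i).eval w / (ascPochhammer ℂ i).eval ((ν : ℂ) + 1)) m
    rw [h, ih ν w]
    -- Pascal's rule splits the sum in two. The second half is a multiple of the same sum for `ν +
    -- 1` and `w + 1`, whence the induction over all `ν` and `w`.
    have h2 : ∑ ij ∈ Finset.HasAntidiagonal.antidiagonal m, (m.choose ij.2 : ℂ) * ((-1) ^ (ij.1 + 1) *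
        (ascPochhammer ℂ (ij.1 + 1)).eval w / (ascPochhammer ℂ (ij.1 + 1)).eval ((ν : ℂ) + 1)) =
        -(w / (ν + 1)) * ((ascPochhammer ℂ m).eval (((ν + 1 : ℕ) : ℂ) + 1 - (w + 1)) /
          (ascPochhammer ℂ m).eval (((ν + 1 : ℕ) : ℂ) + 1)) := by
      rw [← ih (ν + 1) (w + 1), Finset.mul_sum]
      refine Finset.sum_congr rfl fun ij hij => ?_
      rw [Nat.choose_symm_of_eq_add (Finset.HasAntidiagonal.mem_antidiagonal.1 hij).symm,
        ascPochhammer_eval_succ_left, ascPochhammer_eval_succ_left, pow_succ]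
      push_cast
      have := ascPochhammer_eval_natCast_add_one_ne_zero ij.1 (ν + 1)
      have : (ν : ℂ) + 1 ≠ 0 := by exact_mod_cast Nat.succ_ne_zero ν
      push_cast at *
      field_simp
    rw [h2, ascPochhammer_succ_eval]
    have e1 := ascPochhammer_eval_succ_left m ((ν : ℂ) + 1)
    have e2 := ascPochhammer_succ_eval (S := ℂ) m ((ν : ℂ) + 1)
    have n1 := ascPochhammer_eval_natCast_add_one_ne_zero m ν
    have n2 := ascPochhammer_eval_natCast_add_one_ne_zero m (ν + 1)
    have n3 := ascPochhammer_eval_natCast_add_one_ne_zero (m + 1) ν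
    have n4 : (ν : ℂ) + 1 ≠ 0 := by exact_mod_cast Nat.succ_ne_zero ν
    have e3 : ((ν + 1 : ℕ) : ℂ) + 1 - (w + 1) = ν + 1 - w := by push_cast; ring
    rw [e3]
    push_cast at *
    have e4 : (ascPochhammer ℂ m).eval ((ν : ℂ) + 1 + 1) =
        (ascPochhammer ℂ m).eval ((ν : ℂ) + 1) * (ν + 1 + m) / (ν + 1) := by
      rw [eq_div_iff n4, ← e2, e1]; ring
    have n5 : (ν : ℂ) + 1 + m ≠ 0 := by
      intro h0; rw [e2, h0, mul_zero] at n3; exact n3 rfl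
    rw [e2, e4]
    field_simp
    ring

theorem natCast_add_one_ne_neg (ν m : ℕ) : (ν : ℂ) + 1 ≠ -m := by
  intro h
  have : ((ν + 1 + m : ℕ) : ℂ) = 0 := by push_cast; linear_combination h
  have := Nat.cast_eq_zero.1 this
  omega

theorem summable_norm_kummerM_term (ν : ℕ) (w z : ℂ) :
    Summable fun n : ℕ => ‖(ascPochhammer ℂ n).eval w / (ascPochhammer ℂ n).eval ((ν : ℂ) + 1) *
      (z ^ n / (n.factorial : ℂ))‖ := by
  have hr : (regularizedHGFunSeries {w} {(ν : ℂ) + 1}).radius = ⊤ :=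
    radius_regularizedHGFunSeries_eq_top (by simp)
  have h := (regularizedHGFunSeries {w} {(ν : ℂ) + 1}).summable_norm_apply (x := z)
    (by rw [hr]; simp)
  refine (h.mul_left ‖Complex.Gamma ((ν : ℂ) + 1)‖).congr fun n => ?_
  rw [← norm_mul, FormalMultilinearSeries.apply_eq_pow_smul_coeff, regularizedHGFunSeries_coeff,
    smul_eq_mul]
  congr 1
  simp only [regularizedHGFunCoeff, Multiset.map_singleton, Multiset.prod_singleton]
  have h1 : Complex.Gamma ((ν : ℂ) + 1 + n) =
      (ascPochhammer ℂ n).eval ((ν : ℂ) + 1) * Complex.Gamma ((ν : ℂ) + 1) := by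
    clear h
    induction n with
    | zero => simp
    | succ n ih =>
      have : (ν : ℂ) + 1 + n ≠ 0 := fun h => natCast_add_one_ne_neg ν n (eq_neg_of_add_eq_zero_left h)
      rw [Nat.cast_succ, ← add_assoc, Complex.Gamma_add_one _ this, ih, ascPochhammer_succ_eval]
      ring
  have h2 := ascPochhammer_eval_natCast_add_one_ne_zero n ν
  have h3 : Complex.Gamma ((ν : ℂ) + 1) ≠ 0 := Complex.Gamma_ne_zero (natCast_add_one_ne_neg ν)
  rw [h1]
  field_simp

/-- Kummer's transformation, in the form of a power series for `e^{-a} M(w, ν + 1, a)`. -/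
theorem hasSum_exp_neg_mul_kummerM (ν : ℕ) (w a : ℂ) :
    HasSum (fun m : ℕ => (ascPochhammer ℂ m).eval (ν + 1 - w) /
      (ascPochhammer ℂ m).eval ((ν : ℂ) + 1) * ((-a) ^ m / m.factorial))
      (Complex.exp (-a) * kummerM w (ν + 1) a) := by
  have h1 := summable_norm_kummerM_term ν w a
  have h2 : Summable fun n : ℕ => ‖(-a) ^ n / (n.factorial : ℂ)‖ :=
    NormedSpace.norm_expSeries_div_summable (-a)
  have h3 := tsum_mul_tsum_eq_tsum_sum_antidiagonal_of_summable_norm h1 h2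
  have h4 := (summable_norm_sum_mul_antidiagonal_of_summable_norm h1 h2).of_norm
  -- The coefficients of the Cauchy product of `M(w, ν+1, a)` and `e^{-a}` are Chu–Vandermonde sums.
  have h5 : ∀ m : ℕ, ∑ kl ∈ Finset.HasAntidiagonal.antidiagonal m, (ascPochhammer ℂ kl.1).eval w /
      (ascPochhammer ℂ kl.1).eval ((ν : ℂ) + 1) * (a ^ kl.1 / (kl.1.factorial : ℂ)) *
      ((-a) ^ kl.2 / (kl.2.factorial : ℂ)) = (ascPochhammer ℂ m).eval (ν + 1 - w) /
      (ascPochhammer ℂ m).eval ((ν : ℂ) + 1) * ((-a) ^ m / m.factorial) := by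
    intro m
    rw [← sum_antidiagonal_choose_mul_ascPochhammer, Finset.sum_mul]
    refine Finset.sum_congr rfl fun kl hkl => ?_
    have hm := Finset.HasAntidiagonal.mem_antidiagonal.1 hkl
    have hc : (m.choose kl.1 : ℂ) * (kl.1.factorial * kl.2.factorial) = m.factorial := by
      rw [← hm, ← Nat.add_choose_mul_factorial_mul_factorial]
      rw [Nat.choose_symm_add]
      push_cast
      ring
    have f1 : (kl.1.factorial : ℂ) ≠ 0 := by exact_mod_cast Nat.factorial_ne_zero _
    have f2 : (kl.2.factorial : ℂ) ≠ 0 := by exact_mod_cast Nat.factorial_ne_zero _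
    have f3 : (m.factorial : ℂ) ≠ 0 := by exact_mod_cast Nat.factorial_ne_zero _
    have f4 := ascPochhammer_eval_natCast_add_one_ne_zero kl.1 ν
    have hp : (-a) ^ m = (-1) ^ kl.1 * a ^ kl.1 * (-a) ^ kl.2 := by
      rw [← hm, pow_add, neg_pow a kl.1]
    have hs : ((-1 : ℂ) ^ kl.1) * (-1) ^ kl.1 = 1 := by
      rw [← mul_pow]; simp
    rw [hp, ← hc]
    have f5 : (m.choose kl.1 : ℂ) ≠ 0 := by
      intro h0; rw [h0, zero_mul] at hc; exact f3 hc.symm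
    field_simp
    rw [pow_two, hs, mul_one]
  simp_rw [h5] at h3 h4
  have h6 : ∑' n : ℕ, (-a) ^ n / (n.factorial : ℂ) = Complex.exp (-a) := by
    rw [(NormedSpace.expSeries_div_hasSum_exp (-a)).tsum_eq, ← congrFun Complex.exp_eq_exp_ℂ _]
  rw [← kummerM_eq_tsum w (ν + 1) a (natCast_add_one_ne_neg ν), h6] at h3
  rw [mul_comm, h3]
  exact h4.hasSum

theorem Gamma_nat_add_eq (m : ℕ) {z : ℂ} (hz : 0 < z.re) :
    Complex.Gamma (m + z) = (ascPochhammer ℂ m).eval z * Complex.Gamma z := by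
  induction m with
  | zero => simp
  | succ n ih =>
    have : (n : ℂ) + z ≠ 0 := by
      intro h
      have := congrArg Complex.re h
      simp at this
      linarith [(Nat.cast_nonneg n : (0 : ℝ) ≤ n)]
    rw [show ((n + 1 : ℕ) : ℂ) + z = (n + z) + 1 by push_cast; ring, Complex.Gamma_add_one _ this,
      ih, ascPochhammer_succ_eval]
    ring

/-- An integral representation of Kummer's function by the Bessel–Clifford function. -/
theorem integral_besselB_mul_exp_mul_cpow (ν : ℕ) {a : ℝ} {w : ℂ} (ha : 0 ≤ a)
    (hw : w.re < ν + 1) :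
    ∫ x in Ioi (0 : ℝ), ((besselB ν (a * x) : ℝ) : ℂ) * (Complex.exp (-x) * (x : ℂ) ^ (-w)) =
      a ^ ν * Complex.exp (-a) * (Complex.Gamma (ν + 1 - w) / Complex.Gamma (ν + 1)) *
        kummerM w (ν + 1) a := by
  have h1 := (integrable_and_hasSum_mellin_besselB ν ha hw).2
  have h2 := (hasSum_exp_neg_mul_kummerM ν w a).mul_left
    ((a : ℂ) ^ ν * (Complex.Gamma (ν + 1 - w) / Complex.Gamma (ν + 1)))
  rw [show (a : ℂ) ^ ν * Complex.exp (-a) * (Complex.Gamma (ν + 1 - w) / Complex.Gamma (ν + 1)) *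
        kummerM w (ν + 1) a = (a : ℂ) ^ ν * (Complex.Gamma (ν + 1 - w) / Complex.Gamma (ν + 1)) *
        (Complex.exp (-a) * kummerM w (ν + 1) a) by ring]
  refine h1.unique ?_
  convert! h2 using 2 with m
  have hz : 0 < (ν + 1 - w : ℂ).re := by simp; linarith
  have hν : 0 < ((ν : ℂ) + 1).re := by simp; positivity
  -- Pulling Pochhammer symbols out of `Γ(m+ν+1-w)` and `(m+ν)!` makes the two series agree term by
  -- term.
  have e1 := Gamma_nat_add_eq m hz
  have e2 := Gamma_nat_add_eq m hν
  have e3 : Complex.Gamma (m + ((ν : ℂ) + 1)) = (m + ν).factorial := by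
    rw [← Complex.Gamma_nat_eq_factorial]; push_cast; ring_nf
  rw [e3] at e2
  rw [show (m : ℂ) + ν + 1 - w = m + (ν + 1 - w) by ring, e1, e2]
  have n1 : Complex.Gamma ((ν : ℂ) + 1) ≠ 0 := Complex.Gamma_ne_zero (natCast_add_one_ne_neg ν)
  have n2 := ascPochhammer_eval_natCast_add_one_ne_zero m ν
  rw [neg_pow (a : ℂ), pow_add]
  field_simp

/-! ### The Riesz cutoff and its Mellin transform to the left of the pole at 0. -/

/-- Only the origin needs care: `ρ > 1` makes both one-sided derivatives vanish there. -/
theorem hasDerivAt_max_zero_rpow {ρ : ℝ} (hρ : 1 < ρ) (x : ℝ) :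
    HasDerivAt (fun y : ℝ => (max y 0) ^ ρ) (ρ * (max x 0) ^ (ρ - 1)) x := by
  have hρ0 : ρ ≠ 0 := by linarith
  have hρ1 : ρ - 1 ≠ 0 := by linarith
  rcases lt_trichotomy x 0 with h | rfl | h
  · rw [max_eq_right h.le, Real.zero_rpow hρ1, mul_zero]
    refine (hasDerivAt_const x (0 : ℝ)).congr_of_eventuallyEq ?_
    filter_upwards [eventually_lt_nhds h] with y hy
    rw [max_eq_right hy.le, Real.zero_rpow hρ0]
  · rw [max_self, Real.zero_rpow hρ1, mul_zero, ← hasDerivWithinAt_univ, ← Iic_union_Ici (a := (0 : ℝ))]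
    refine HasDerivWithinAt.union ?_ ?_
    · refine (hasDerivWithinAt_const (0 : ℝ) (Iic 0) (0 : ℝ)).congr (fun y hy => ?_) ?_
      · rw [max_eq_right hy, Real.zero_rpow hρ0]
      · rw [max_self, Real.zero_rpow hρ0]
    · have h := (Real.hasDerivAt_rpow_const (x := 0) (p := ρ) (Or.inr hρ.le)).hasDerivWithinAt
        (s := Ici 0)
      rw [Real.zero_rpow hρ1, mul_zero] at h
      refine h.congr (fun y hy => ?_) ?_
      · rw [max_eq_left hy]
      · rw [max_self]
  · rw [max_eq_left h.le]
    refine (Real.hasDerivAt_rpow_const (p := ρ) (Or.inl h.ne')).congr_of_eventuallyEq ?_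
    filter_upwards [eventually_gt_nhds h] with y hy
    rw [max_eq_left hy.le]

/-- The function `(1 - v)_+^ρ - 1`. -/
def cutoff (ρ v : ℝ) : ℝ := (max (1 - v) 0) ^ ρ - 1

theorem hasDerivAt_cutoff {ρ : ℝ} (hρ : 1 < ρ) (v : ℝ) :
    HasDerivAt (cutoff ρ) (-(ρ * (max (1 - v) 0) ^ (ρ - 1))) v := by
  have h := ((hasDerivAt_max_zero_rpow hρ (1 - v)).comp v
    ((hasDerivAt_id v).const_sub 1)).sub_const 1
  refine (h.congr_deriv (by ring))

theorem continuous_cutoff {ρ : ℝ} (hρ : 1 < ρ) : Continuous (cutoff ρ) :=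
  continuous_iff_continuousAt.2 fun v => (hasDerivAt_cutoff hρ v).continuousAt

theorem abs_cutoff_le_one {ρ v : ℝ} (hρ : 0 ≤ ρ) (hv : 0 ≤ v) : |cutoff ρ v| ≤ 1 := by
  have h0 : 0 ≤ max (1 - v) 0 := le_max_right _ _
  have h1 : (max (1 - v) 0) ^ ρ ≤ 1 := Real.rpow_le_one h0 (max_le (by linarith) zero_le_one) hρ
  have h2 := Real.rpow_nonneg h0 ρ
  rw [cutoff, abs_le]
  constructor <;> linarith

/-- Bernoulli's inequality. Linear vanishing at `0`, together with boundedness at infinity, opens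
the Mellin strip `-1 < Re s < 0`. -/
theorem abs_cutoff_le {ρ v : ℝ} (hρ : 1 ≤ ρ) (hv : 0 ≤ v) : |cutoff ρ v| ≤ ρ * v := by
  rcases le_total v 1 with h | h
  · have h1 := one_add_mul_self_le_rpow_one_add (s := -v) (by linarith) hρ
    have h2 : (1 + -v) ^ ρ ≤ 1 := Real.rpow_le_one (by linarith) (by linarith) (by linarith)
    rw [cutoff, max_eq_left (by linarith), sub_eq_add_neg 1 v, abs_le]
    constructor <;> nlinarith
  · exact (abs_cutoff_le_one (by linarith) hv).trans (by nlinarith)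

theorem mellinConvergent_cutoff {ρ : ℝ} (hρ : 1 < ρ) {s : ℂ} (h1 : -1 < s.re) (h2 : s.re < 0) :
    MellinConvergent (fun v => ((cutoff ρ v : ℝ) : ℂ)) s := by
  have hc : Continuous fun v => ((cutoff ρ v : ℝ) : ℂ) :=
    Complex.continuous_ofReal.comp (continuous_cutoff hρ)
  refine mellinConvergent_of_isBigO_rpow (a := 0) (b := -1)
    (hc.locallyIntegrable.locallyIntegrableOn _) ?_ h2 ?_ h1
  · refine Asymptotics.IsBigO.of_bound 1 ?_
    filter_upwards [eventually_ge_atTop 0] with v hv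
    simpa using abs_cutoff_le_one (by linarith) hv
  · refine Asymptotics.IsBigO.of_bound ρ ?_
    filter_upwards [self_mem_nhdsWithin] with v hv
    have := abs_cutoff_le hρ.le (mem_Ioi.1 hv).le
    simpa [abs_of_pos (mem_Ioi.1 hv)] using this

/-- Integration by parts: the derivative `-ρ (1 - v)_+^{ρ-1}` lives on `(0, 1)` and leaves `-(ρ/s)
B(s+1, ρ)`. Formally this is the Mellin transform of `(1 - v)_+^ρ` continued past `s = 0`, the
subtracted `1` accounting for the pole. -/
theorem mellin_cutoff {ρ : ℝ} (hρ : 1 < ρ) {s : ℂ} (h1 : -1 < s.re) (h2 : s.re < 0) :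
    mellin (fun v => ((cutoff ρ v : ℝ) : ℂ)) s =
      Complex.Gamma (ρ + 1) * (Complex.Gamma s / Complex.Gamma (s + ρ + 1)) := by
  have hs : s ≠ 0 := fun h => by simp [h] at h2
  have hs1 : 0 < (s + 1).re := by simp; linarith
  have hρ0 : 0 < (ρ : ℂ).re := by simp; linarith
  have hρc : (ρ : ℂ) ≠ 0 := by intro h; simp [h] at hρ0
  have hbeta := betaIntegral_convergent hs1 hρ0
  rw [intervalIntegrable_iff_integrableOn_Ioc_of_le zero_le_one] at hbeta
  set g : ℝ → ℂ := fun x => ((-(ρ * (max (1 - x) 0) ^ (ρ - 1)) : ℝ) : ℂ) * ((x : ℂ) ^ s / s) with hg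
  have hg1 : EqOn g (fun x => -(ρ / s) *
      ((x : ℂ) ^ (s + 1 - 1) * (1 - (x : ℂ)) ^ ((ρ : ℂ) - 1))) (Ioc 0 1) := by
    intro x hx
    simp only [hg]
    rw [max_eq_left (by linarith [hx.2])]
    push_cast
    rw [Complex.ofReal_cpow (by linarith [hx.2])]
    push_cast
    rw [add_sub_cancel_right]
    ring
  have hg2 : EqOn g 0 (Ioi 1) := by
    intro x hx
    simp only [hg, Pi.zero_apply]
    rw [max_eq_right (by linarith [mem_Ioi.1 hx]), Real.zero_rpow (by linarith)]
    simp
  have hgi1 : IntegrableOn g (Ioc 0 1) :=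
    (integrableOn_congr_fun hg1 measurableSet_Ioc).2 (hbeta.const_mul _)
  have hgi2 : IntegrableOn g (Ioi 1) :=
    (integrableOn_congr_fun hg2 measurableSet_Ioi).2 integrableOn_zero
  have hgi : IntegrableOn g (Ioi 0) := by
    rw [← Ioc_union_Ioi_eq_Ioi zero_le_one]
    exact hgi1.union hgi2
  have hint : ∫ x in Ioi (0 : ℝ), g x = -(ρ / s) * betaIntegral (s + 1) ρ := by
    rw [← Ioc_union_Ioi_eq_Ioi zero_le_one, setIntegral_union (Ioc_disjoint_Ioi le_rfl)
      measurableSet_Ioi hgi1 hgi2, setIntegral_congr_fun measurableSet_Ioc hg1,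
      setIntegral_congr_fun measurableSet_Ioi hg2, integral_const_mul, betaIntegral,
      intervalIntegral.integral_of_le zero_le_one]
    simp
  have hu : ∀ x ∈ Ioi (0 : ℝ), HasDerivAt (fun v => ((cutoff ρ v : ℝ) : ℂ))
      ((-(ρ * (max (1 - x) 0) ^ (ρ - 1)) : ℝ) : ℂ) x :=
    fun x _ => (hasDerivAt_cutoff hρ x).ofReal_comp
  have hv : ∀ x ∈ Ioi (0 : ℝ), HasDerivAt (fun x : ℝ => (x : ℂ) ^ s / s) ((x : ℂ) ^ (s - 1)) x := by
    intro x hx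
    have := hasDerivAt_ofReal_cpow_const' (x := x) (r := s - 1) (mem_Ioi.1 hx).ne' (by
      intro h; apply hs; linear_combination h)
    simpa using this
  have hbound : ∀ x : ℝ, 0 < x → ‖((cutoff ρ x : ℝ) : ℂ) * ((x : ℂ) ^ s / s)‖ =
      |cutoff ρ x| * x ^ s.re / ‖s‖ := by
    intro x hx
    rw [norm_mul, norm_div, Complex.norm_cpow_eq_rpow_re_of_pos hx, Complex.norm_real,
      Real.norm_eq_abs, mul_div_assoc]
  have hmc := mellinConvergent_cutoff hρ h1 h2
  -- The boundary terms vanish: at `0` by the linear bound and `Re s > -1`, at infinity by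
  -- boundedness and `Re s < 0`.
  have hparts := integral_Ioi_mul_deriv_eq_deriv_mul (a := (0 : ℝ)) (a' := (0 : ℂ)) (b' := (0 : ℂ))
    hu hv ?_ hgi ?_ ?_
  · rw [mellin]
    simp_rw [smul_eq_mul, mul_comm _ (((cutoff ρ _ : ℝ) : ℂ))]
    rw [hparts, hint]
    have hB := Gamma_mul_Gamma_eq_betaIntegral hs1 hρ0
    rw [Complex.Gamma_add_one _ hs, add_right_comm] at hB
    rw [Complex.Gamma_add_one _ hρc]
    have hne : Complex.Gamma (s + ρ + 1) ≠ 0 := Complex.Gamma_ne_zero_of_re_pos (by simp; linarith)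
    field_simp
    linear_combination (-(ρ : ℂ)) * hB
  · refine hmc.congr_fun (fun x _ => ?_) measurableSet_Ioi
    simp [mul_comm]
  · refine squeeze_zero_norm' (a := fun x => ρ * x ^ (s.re + 1) / ‖s‖) ?_ ?_
    · filter_upwards [self_mem_nhdsWithin] with x hx
      have hx' : 0 < x := hx
      simp only [Pi.mul_apply]
      rw [hbound x hx', Real.rpow_add_one hx'.ne']
      have := abs_cutoff_le hρ.le hx'.le
      have : 0 < x ^ s.re := Real.rpow_pos_of_pos hx' _
      rw [mul_comm (x ^ s.re) x, ← mul_assoc]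
      gcongr
    · have h := (Real.continuousAt_rpow_const 0 (s.re + 1) (Or.inr (by linarith))).tendsto
      rw [Real.zero_rpow (by linarith)] at h
      have := ((h.mono_left (nhdsWithin_le_nhds (s := Ioi 0))).const_mul ρ).div_const ‖s‖
      simpa using this
  · refine squeeze_zero_norm' (a := fun x => x ^ (-(-s.re)) / ‖s‖) ?_ ?_
    · filter_upwards [eventually_gt_atTop 0] with x hx
      simp only [Pi.mul_apply]
      rw [hbound x hx, neg_neg]
      have := abs_cutoff_le_one (by linarith : 0 ≤ ρ) hx.le
      have : 0 < x ^ s.re := Real.rpow_pos_of_pos hx _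
      gcongr
      nlinarith
    · have := (tendsto_rpow_neg_atTop (y := -s.re) (by linarith)).div_const ‖s‖
      simpa using this

/-- Two steps of the functional equation give `Γ(s)/Γ(s+ρ+1) = B(s+2, ρ-1) / (Γ(ρ-1) s (s+1))`, and
the beta integral is bounded in terms of `Re s` alone. This yields quadratic decay on vertical
lines; `ρ > 1` is needed for the beta integral. -/
theorem norm_Gamma_div_Gamma_le {ρ : ℝ} (hρ : 1 < ρ) {s : ℂ} (h1 : -1 < s.re) (h2 : s.re < 0) :
    ‖Complex.Gamma s / Complex.Gamma (s + ρ + 1)‖ ≤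
      (∫ x in Ioc (0 : ℝ) 1, x ^ (s.re + 1) * (1 - x) ^ (ρ - 2)) / Real.Gamma (ρ - 1) /
        (‖s‖ * ‖s + 1‖) := by
  have hs : s ≠ 0 := fun h => by simp [h] at h2
  have hs1 : s + 1 ≠ 0 := fun h => by
    have := congrArg Complex.re h
    simp at this; linarith
  have hs2 : 0 < (s + 2).re := by simp; linarith
  have hρ0 : 0 < ((ρ : ℂ) - 1).re := by simp; linarith
  have hB := Gamma_mul_Gamma_eq_betaIntegral hs2 hρ0
  have hG : Complex.Gamma (s + 2) = (s + 1) * (s * Complex.Gamma s) := by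
    rw [show s + 2 = s + 1 + 1 by ring, Complex.Gamma_add_one _ hs1, Complex.Gamma_add_one _ hs]
  rw [hG, show s + 2 + ((ρ : ℂ) - 1) = s + ρ + 1 by ring] at hB
  have hne : Complex.Gamma (s + ρ + 1) ≠ 0 := Complex.Gamma_ne_zero_of_re_pos (by simp; linarith)
  have hne2 : Complex.Gamma ((ρ : ℂ) - 1) ≠ 0 := Complex.Gamma_ne_zero_of_re_pos hρ0
  have hGr : ‖Complex.Gamma ((ρ : ℂ) - 1)‖ = Real.Gamma (ρ - 1) := by
    have : (ρ : ℂ) - 1 = ((ρ - 1 : ℝ) : ℂ) := by push_cast; ring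
    rw [this, Complex.Gamma_ofReal, Complex.norm_real,
      Real.norm_of_nonneg (Real.Gamma_pos_of_pos (by linarith)).le]
  have heq : Complex.Gamma s / Complex.Gamma (s + ρ + 1) =
      betaIntegral (s + 2) (ρ - 1) / Complex.Gamma ((ρ : ℂ) - 1) / (s * (s + 1)) := by
    field_simp
    linear_combination hB
  rw [heq, norm_div, norm_div, norm_mul, hGr]
  have hpos : 0 < Real.Gamma (ρ - 1) := Real.Gamma_pos_of_pos (by linarith)
  gcongr
  rw [betaIntegral, intervalIntegral.integral_of_le zero_le_one, integral_Ioc_eq_integral_Ioo,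
    integral_Ioc_eq_integral_Ioo]
  refine (norm_integral_le_integral_norm _).trans (le_of_eq ?_)
  refine setIntegral_congr_fun measurableSet_Ioo fun x hx => ?_
  have h3 : 0 < 1 - x := by linarith [hx.2]
  rw [norm_mul, Complex.norm_cpow_eq_rpow_re_of_pos hx.1,
    show (1 : ℂ) - x = ((1 - x : ℝ) : ℂ) by push_cast; rfl,
    Complex.norm_cpow_eq_rpow_re_of_pos h3]
  congr 2 <;> simp <;> ring

theorem continuous_Gamma_div_Gamma_line {ρ ε : ℝ} (hε : 0 < ε) (hε1 : ε < 1) :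
    Continuous fun t : ℝ => Complex.Gamma (((-ε : ℝ) : ℂ) + t * Complex.I) /
      Complex.Gamma (((-ε : ℝ) : ℂ) + t * Complex.I + ρ + 1) := by
  simp_rw [div_eq_mul_inv]
  refine Continuous.mul ?_ ?_
  · refine continuous_iff_continuousAt.2 fun t => ?_
    refine ContinuousAt.comp (g := Complex.Gamma) ?_ (by fun_prop)
    refine (Complex.differentiableAt_Gamma _ fun m h => ?_).continuousAt
    have h1 := congrArg Complex.re h
    simp at h1
    rcases Nat.eq_zero_or_pos m with rfl | hm
    · simp at h1; linarith
    · have : (1 : ℝ) ≤ m := by exact_mod_cast hm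
      linarith
  · exact Complex.differentiable_one_div_Gamma.continuous.comp (by fun_prop)

theorem integrable_Gamma_div_Gamma_line {ρ ε : ℝ} (hρ : 1 < ρ) (hε : 0 < ε) (hε1 : ε < 1) :
    Integrable fun t : ℝ => Complex.Gamma (((-ε : ℝ) : ℂ) + t * Complex.I) /
      Complex.Gamma (((-ε : ℝ) : ℂ) + t * Complex.I + ρ + 1) := by
  set A := (∫ x in Ioc (0 : ℝ) 1, x ^ (-ε + 1) * (1 - x) ^ (ρ - 2)) / Real.Gamma (ρ - 1) with hA
  have hA0 : 0 ≤ A := by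
    refine div_nonneg (setIntegral_nonneg measurableSet_Ioc fun x hx => ?_)
      (Real.Gamma_pos_of_pos (by linarith)).le
    exact mul_nonneg (Real.rpow_nonneg hx.1.le _) (Real.rpow_nonneg (by linarith [hx.2]) _)
  -- The distance from the line `Re s = -ε` to the points `0` and `-1`.
  set κ := min ε (1 - ε) with hκ
  have hκ0 : 0 < κ := lt_min hε (by linarith)
  have hκ1 : κ ≤ ε := min_le_left _ _
  have hκ2 : κ ≤ 1 - ε := min_le_right _ _
  refine (integrable_inv_one_add_sq.const_mul (A / κ ^ 2)).mono'
    (continuous_Gamma_div_Gamma_line hε hε1).aestronglyMeasurable (Eventually.of_forall fun t => ?_)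
  set s : ℂ := ((-ε : ℝ) : ℂ) + t * Complex.I with hs
  have hre : s.re = -ε := by simp [hs]
  have hb := norm_Gamma_div_Gamma_le hρ (s := s) (by rw [hre]; linarith) (by rw [hre]; linarith)
  rw [hre, ← hA] at hb
  refine hb.trans ?_
  have hsq : ∀ u : ℝ, κ ≤ |u| → κ * √(1 + t ^ 2) ≤ ‖(u : ℂ) + t * Complex.I‖ := by
    intro u hu
    rw [Complex.norm_add_mul_I]
    refine Real.le_sqrt_of_sq_le ?_
    rw [mul_pow, Real.sq_sqrt (by positivity), ← sq_abs u]
    have : κ ≤ 1 := by linarith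
    have h1 : κ ^ 2 ≤ |u| ^ 2 := by gcongr
    have h2 : κ ^ 2 ≤ 1 := pow_le_one₀ hκ0.le this
    nlinarith [sq_nonneg t]
  have hs1 : κ * √(1 + t ^ 2) ≤ ‖s‖ := hsq (-ε) (by rw [abs_neg, abs_of_pos hε]; exact hκ1)
  have hs2 : κ * √(1 + t ^ 2) ≤ ‖s + 1‖ := by
    have := hsq (1 - ε) (by rw [abs_of_pos (by linarith)]; exact hκ2)
    rwa [show ((1 - ε : ℝ) : ℂ) + t * Complex.I = s + 1 by rw [hs]; push_cast; ring] at this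
  have hpos : 0 < κ * √(1 + t ^ 2) := by positivity
  have hprod : κ ^ 2 * (1 + t ^ 2) ≤ ‖s‖ * ‖s + 1‖ := by
    have := mul_le_mul hs1 hs2 hpos.le (norm_nonneg _)
    calc κ ^ 2 * (1 + t ^ 2) = (κ * √(1 + t ^ 2)) * (κ * √(1 + t ^ 2)) := by
          rw [mul_mul_mul_comm, Real.mul_self_sqrt (by positivity)]; ring
      _ ≤ _ := this
  calc A / (‖s‖ * ‖s + 1‖) ≤ A / (κ ^ 2 * (1 + t ^ 2)) := by gcongr
    _ = A / κ ^ 2 * (1 + t ^ 2)⁻¹ := by field_simp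

/-- The Perron-type formula for Riesz means, on a line to the left of the pole at `0`. -/
theorem integral_cpow_mul_Gamma_div_Gamma_line {ρ ε v : ℝ} (hρ : 1 < ρ) (hε : 0 < ε) (hε1 : ε < 1)
    (hv : 0 < v) :
    ∫ t : ℝ, (v : ℂ) ^ (-(((-ε : ℝ) : ℂ) + t * Complex.I)) * (Complex.Gamma (((-ε : ℝ) : ℂ) + t * Complex.I) /
      Complex.Gamma (((-ε : ℝ) : ℂ) + t * Complex.I + ρ + 1)) =
      2 * Real.pi / Complex.Gamma (ρ + 1) * (cutoff ρ v : ℝ) := by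
  have hΓ : Complex.Gamma ((ρ : ℂ) + 1) ≠ 0 :=
    Complex.Gamma_ne_zero_of_re_pos (by simp; linarith)
  have hm : ∀ t : ℝ, mellin (fun v => ((cutoff ρ v : ℝ) : ℂ)) (((-ε : ℝ) : ℂ) + t * Complex.I) =
      Complex.Gamma (ρ + 1) * (Complex.Gamma (((-ε : ℝ) : ℂ) + t * Complex.I) /
        Complex.Gamma (((-ε : ℝ) : ℂ) + t * Complex.I + ρ + 1)) :=
    fun t => mellin_cutoff hρ (by simp; linarith) (by simp; linarith)
  have h := mellinInv_mellin_eq (-ε) (fun v => ((cutoff ρ v : ℝ) : ℂ)) hv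
    (mellinConvergent_cutoff hρ (by simp; linarith) (by simp; linarith))
    (by
      unfold Complex.VerticalIntegrable
      simp_rw [hm]
      exact (integrable_Gamma_div_Gamma_line hρ hε hε1).const_mul _)
    (Complex.continuous_ofReal.comp (continuous_cutoff hρ)).continuousAt
  rw [mellinInv] at h
  simp_rw [hm, smul_eq_mul, mul_left_comm _ (Complex.Gamma ((ρ : ℂ) + 1))] at h
  rw [integral_const_mul, Complex.real_smul] at h
  have hπ : (Real.pi : ℂ) ≠ 0 := by exact_mod_cast Real.pi_ne_zero
  have key : ∀ J : ℂ, J = 2 * Real.pi / Complex.Gamma (ρ + 1) *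
      (((1 / (2 * Real.pi) : ℝ) : ℂ) * (Complex.Gamma (ρ + 1) * J)) := by
    intro J
    push_cast
    field_simp
  rw [← h]
  exact key _

/-! ### The contour integral as a Bessel transform of the weight. -/

/-- The weight `e^{-x} x^{-ν/2} ((1 - x/X)_+^ρ - 1)`. -/
def rieszWeight (ν : ℕ) (ρ X x : ℝ) : ℝ :=
  Real.exp (-x) * x ^ (-((ν : ℝ) / 2)) * cutoff ρ (x / X)

section Kernel

variable (ν : ℕ) {ρ X ε : ℝ}

/-- The Bessel integral for Kummer's function at `w = ν/2 + s` and `a = 2πn`: here `Γ(ν+1-w)` is the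
factor `Γ((k+1)/2 - s)` with `k = ν + 1`. -/
theorem kernel_eq_integral {n : ℕ} (hn : 1 ≤ n) {s : ℂ} (hs : s.re < 0) :
    kernel (ν + 1) ρ X n s =
      Real.exp (2 * Real.pi * n) * ν.factorial / (2 * Real.pi * n) ^ ν *
        ∫ x in Ioi (0 : ℝ), Complex.Gamma s / Complex.Gamma (s + ρ + 1) * (X : ℂ) ^ s *
          (((besselB ν (2 * Real.pi * n * x) : ℝ) : ℂ) *
            (Complex.exp (-x) * (x : ℂ) ^ (-((ν : ℂ) / 2 + s)))) := by
  have hn0 : (0 : ℝ) < n := by exact_mod_cast hn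
  have ha : (0 : ℝ) ≤ 2 * Real.pi * n := by positivity
  have hw : ((ν : ℂ) / 2 + s).re < ν + 1 := by
    have : ((ν : ℂ) / 2).re = (ν : ℝ) / 2 := by
      rw [show (ν : ℂ) / 2 = (((ν : ℝ) / 2 : ℝ) : ℂ) by push_cast; rfl, Complex.ofReal_re]
    rw [Complex.add_re, this]
    have : (0 : ℝ) ≤ ν := by positivity
    linarith
  rw [integral_const_mul, integral_besselB_mul_exp_mul_cpow ν ha hw, kernel]
  have e1 : (((ν + 1 : ℕ) : ℂ) + 1) / 2 - s = ν + 1 - (ν / 2 + s) := by push_cast; ring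
  have e2 : (((ν + 1 : ℕ) : ℂ) - 1) / 2 + s = ν / 2 + s := by push_cast; ring
  rw [e1, e2]
  have hexp : Complex.exp (2 * Real.pi * n) * Complex.exp (-(2 * Real.pi * n)) = 1 := by
    rw [← Complex.exp_add, add_neg_cancel, Complex.exp_zero]
  have hπ : (2 * Real.pi * n : ℂ) ≠ 0 := by
    have : (2 * Real.pi * n : ℝ) ≠ 0 := by positivity
    exact_mod_cast this
  have hπn : (2 * Real.pi * n : ℂ) ^ ν ≠ 0 := pow_ne_zero _ hπ
  have hf : (ν.factorial : ℂ) ≠ 0 := by exact_mod_cast Nat.factorial_ne_zero _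
  rw [Complex.Gamma_nat_eq_factorial]
  push_cast
  generalize (2 * Real.pi * n : ℂ) = a at *
  generalize kummerM (ν / 2 + s) (ν + 1) a = M at *
  rw [show Complex.exp a * ν.factorial / a ^ ν * (Complex.Gamma s / Complex.Gamma (s + ρ + 1) *
      (X : ℂ) ^ s * (a ^ ν * Complex.exp (-a) * (Complex.Gamma (ν + 1 - (ν / 2 + s)) / ν.factorial) * M))
    = (Complex.exp a * Complex.exp (-a)) * (ν.factorial / ν.factorial) * (a ^ ν / a ^ ν) *
      (Complex.Gamma s / Complex.Gamma (s + ρ + 1) *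
      (X : ℂ) ^ s * Complex.Gamma (ν + 1 - (ν / 2 + s)) * M) by ring, hexp, div_self hf,
    div_self hπn]
  ring

/-- On the line the powers of `x` and `X` have absolute value independent of `t`, so the norm of the
integrand is a function of `t` times a function of `x`, each integrable. -/
theorem integrable_kernel_prod (hρ : 1 < ρ) (hX : 0 < X) (hε : 0 < ε) (hε1 : ε < 1) {a : ℝ}
    (ha : 0 ≤ a) :
    Integrable (fun p : ℝ × ℝ => Complex.Gamma (((-ε : ℝ) : ℂ) + p.1 * Complex.I) /
        Complex.Gamma (((-ε : ℝ) : ℂ) + p.1 * Complex.I + ρ + 1) *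
        (X : ℂ) ^ (((-ε : ℝ) : ℂ) + p.1 * Complex.I) *
          (((besselB ν (a * p.2) : ℝ) : ℂ) *
            (Complex.exp (-p.2) *
              (p.2 : ℂ) ^ (-((ν : ℂ) / 2 + (((-ε : ℝ) : ℂ) + p.1 * Complex.I))))))
      (volume.prod (volume.restrict (Ioi 0))) := by
  have h1 := integrable_Gamma_div_Gamma_line hρ hε hε1
  have hw : ((ν : ℂ) / 2 + ((-ε : ℝ) : ℂ)) = (((ν : ℝ) / 2 - ε : ℝ) : ℂ) := by push_cast; ring
  have h2 := (integrable_and_hasSum_mellin_besselB ν (w := (ν : ℂ) / 2 + ((-ε : ℝ) : ℂ)) ha (by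
    rw [hw, Complex.ofReal_re]
    have : (0 : ℝ) ≤ ν := by positivity
    linarith)).1
  have h3 := (h1.mul_prod h2).norm.mul_const (X ^ (-ε))
  refine h3.mono' ?_ ?_
  · have hb := (continuous_besselB ν).measurable
    have hR := (continuous_Gamma_div_Gamma_line (ρ := ρ) hε hε1).measurable
    refine Measurable.aestronglyMeasurable ?_
    refine Measurable.mul (Measurable.mul (hR.comp measurable_fst) ?_) ?_
    · fun_prop
    · refine Measurable.mul (Complex.measurable_ofReal.comp (hb.comp (by fun_prop))) ?_
      fun_prop
  · have hpos : ∀ᵐ p : ℝ × ℝ ∂(volume.prod (volume.restrict (Ioi 0))), p.2 ∈ Ioi (0 : ℝ) :=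
      Measure.quasiMeasurePreserving_snd.ae (ae_restrict_mem measurableSet_Ioi)
    filter_upwards [hpos] with p hp
    have hp0 : 0 < p.2 := hp
    rw [norm_mul, norm_mul, norm_mul (_ / _), mul_right_comm]
    have hXn : ‖(X : ℂ) ^ (((-ε : ℝ) : ℂ) + p.1 * Complex.I)‖ = X ^ (-ε) := by
      rw [Complex.norm_cpow_eq_rpow_re_of_pos hX]; simp
    rw [hXn]
    refine mul_le_mul_of_nonneg_right (mul_le_mul_of_nonneg_left (le_of_eq ?_) (norm_nonneg _))
      (Real.rpow_nonneg hX.le _)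
    rw [norm_mul, norm_mul, norm_mul, norm_mul, Complex.norm_cpow_eq_rpow_re_of_pos hp0,
      Complex.norm_cpow_eq_rpow_re_of_pos hp0]
    simp

theorem integrable_kernel_line (hρ : 1 < ρ) (hX : 0 < X) (hε : 0 < ε) (hε1 : ε < 1) {n : ℕ}
    (hn : 1 ≤ n) :
    Integrable fun t : ℝ => kernel (ν + 1) ρ X n (((-ε : ℝ) : ℂ) + t * Complex.I) := by
  have hre : ∀ t : ℝ, (((-ε : ℝ) : ℂ) + t * Complex.I).re < 0 := fun t => by simp [hε]
  simp_rw [fun t : ℝ => kernel_eq_integral ν (ρ := ρ) (X := X) hn (hre t)]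
  exact (integrable_kernel_prod ν hρ hX hε hε1 (a := 2 * Real.pi * n)
    (by positivity)).integral_prod_left.const_mul _

/-- After Fubini the inner integral over `t` is the Perron formula at `v = x/X`, which reproduces
`rieszWeight`. -/
theorem lineIntegral_kernel (hρ : 1 < ρ) (hX : 0 < X) (hε : 0 < ε) (hε1 : ε < 1) {n : ℕ}
    (hn : 1 ≤ n) :
    lineIntegral (-ε) (kernel (ν + 1) ρ X n) =
      2 * Real.pi * Complex.I * Real.exp (2 * Real.pi * n) * ν.factorial / Complex.Gamma (ρ + 1) *
        ((∫ x in Ioi (0 : ℝ), besselB ν (2 * Real.pi * n * x) / (2 * Real.pi * n) ^ ν *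
          rieszWeight ν ρ X x : ℝ) : ℂ) := by
  have hre : ∀ t : ℝ, (((-ε : ℝ) : ℂ) + t * Complex.I).re < 0 := fun t => by simp [hε]
  have hF := integrable_kernel_prod ν hρ hX hε hε1 (a := 2 * Real.pi * n) (by positivity)
  have hinner : ∀ x ∈ Ioi (0 : ℝ), ∫ t : ℝ,
      Complex.Gamma (((-ε : ℝ) : ℂ) + t * Complex.I) /
        Complex.Gamma (((-ε : ℝ) : ℂ) + t * Complex.I + ρ + 1) *
        (X : ℂ) ^ (((-ε : ℝ) : ℂ) + t * Complex.I) *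
          (((besselB ν (2 * Real.pi * n * x) : ℝ) : ℂ) *
            (Complex.exp (-x) *
              (x : ℂ) ^ (-((ν : ℂ) / 2 + (((-ε : ℝ) : ℂ) + t * Complex.I))))) =
      2 * Real.pi / Complex.Gamma (ρ + 1) *
        ((besselB ν (2 * Real.pi * n * x) * rieszWeight ν ρ X x : ℝ) : ℂ) := by
    intro x hx
    have hx0 : 0 < x := hx
    have hxc : (x : ℂ) ≠ 0 := by exact_mod_cast hx0.ne'
    have h := integral_cpow_mul_Gamma_div_Gamma_line hρ hε hε1 (div_pos hx0 hX)
    have hcongr : ∀ t : ℝ, Complex.Gamma (((-ε : ℝ) : ℂ) + t * Complex.I) /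
        Complex.Gamma (((-ε : ℝ) : ℂ) + t * Complex.I + ρ + 1) *
        (X : ℂ) ^ (((-ε : ℝ) : ℂ) + t * Complex.I) *
          (((besselB ν (2 * Real.pi * n * x) : ℝ) : ℂ) *
            (Complex.exp (-x) *
              (x : ℂ) ^ (-((ν : ℂ) / 2 + (((-ε : ℝ) : ℂ) + t * Complex.I))))) =
        (((besselB ν (2 * Real.pi * n * x) : ℝ) : ℂ) *
            (Complex.exp (-x) * (x : ℂ) ^ (-((ν : ℂ) / 2)))) *
          (((x / X : ℝ) : ℂ) ^ (-(((-ε : ℝ) : ℂ) + t * Complex.I)) *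
            (Complex.Gamma (((-ε : ℝ) : ℂ) + t * Complex.I) /
              Complex.Gamma (((-ε : ℝ) : ℂ) + t * Complex.I + ρ + 1))) := by
      intro t
      generalize ((-ε : ℝ) : ℂ) + t * Complex.I = s
      have e1 : (x : ℂ) ^ (-((ν : ℂ) / 2 + s)) = (x : ℂ) ^ (-((ν : ℂ) / 2)) * (x : ℂ) ^ (-s) := by
        rw [neg_add, Complex.cpow_add _ _ hxc]
      have e2 : ((x / X : ℝ) : ℂ) ^ (-s) = (x : ℂ) ^ (-s) * (X : ℂ) ^ s := by
        rw [div_eq_mul_inv, Complex.ofReal_mul, Complex.mul_cpow_ofReal_nonneg hx0.le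
          (inv_nonneg.2 hX.le), Complex.ofReal_inv, Complex.inv_cpow _ _ ?_, Complex.cpow_neg _ s,
          Complex.cpow_neg _ s, inv_inv]
        rw [Complex.arg_ofReal_of_nonneg hX.le]
        exact Real.pi_ne_zero.symm
      rw [e1, e2]
      ring
    simp_rw [hcongr]
    rw [integral_const_mul, h, rieszWeight]
    push_cast
    rw [Complex.ofReal_cpow hx0.le]
    push_cast
    ring
  rw [lineIntegral]
  simp_rw [fun t : ℝ => kernel_eq_integral ν (ρ := ρ) (X := X) hn (hre t)]
  rw [integral_const_mul, integral_integral_swap hF,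
    setIntegral_congr_fun measurableSet_Ioi hinner, integral_const_mul]
  have hdiv : (fun x : ℝ => besselB ν (2 * Real.pi * n * x) / (2 * Real.pi * n) ^ ν *
      rieszWeight ν ρ X x) = fun x => ((2 * Real.pi * n) ^ ν)⁻¹ *
      (besselB ν (2 * Real.pi * n * x) * rieszWeight ν ρ X x) := by
    ext x; ring
  rw [hdiv, integral_const_mul, integral_complex_ofReal]
  push_cast
  ring

end Kernel

/-! ### Derivatives of the weight and its representation by the functions `(x - y)_+`. -/

/-- The first derivative of `rieszWeight`. -/
def rieszWeightDeriv (ν : ℕ) (ρ X x : ℝ) : ℝ :=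
  Real.exp (-x) * x ^ (-((ν : ℝ) / 2)) * (-(1 + (ν : ℝ) / 2 / x) * cutoff ρ (x / X) -
    ρ / X * (max (1 - x / X) 0) ^ (ρ - 1))

/-- The second derivative of `rieszWeight` away from `X`. -/
def rieszWeightDeriv2 (ν : ℕ) (ρ X x : ℝ) : ℝ :=
  Real.exp (-x) * x ^ (-((ν : ℝ) / 2)) *
    (((1 + (ν : ℝ) / 2 / x) ^ 2 + (ν : ℝ) / 2 / x ^ 2) * cutoff ρ (x / X) +
      2 * (1 + (ν : ℝ) / 2 / x) * (ρ / X) * (max (1 - x / X) 0) ^ (ρ - 1) +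
      (Iio X).indicator (fun x => ρ * (ρ - 1) / X ^ 2 * (1 - x / X) ^ (ρ - 2)) x)

section Weight

variable (ν : ℕ) {ρ X : ℝ}

theorem hasDerivAt_exp_mul_rpow (μ : ℝ) {x : ℝ} (hx : 0 < x) :
    HasDerivAt (fun x : ℝ => Real.exp (-x) * x ^ (-μ))
      (-(Real.exp (-x) * x ^ (-μ) * (1 + μ / x))) x := by
  have h := ((hasDerivAt_neg x).exp).mul (Real.hasDerivAt_rpow_const (p := -μ) (Or.inl hx.ne'))
  refine h.congr_deriv ?_
  rw [Real.rpow_sub_one hx.ne']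
  ring

theorem hasDerivAt_rieszWeight (hρ : 1 < ρ) {x : ℝ} (hx : 0 < x) :
    HasDerivAt (rieszWeight ν ρ X) (rieszWeightDeriv ν ρ X x) x := by
  have hq : HasDerivAt (fun x => cutoff ρ (x / X))
      (-(ρ * (max (1 - x / X) 0) ^ (ρ - 1)) * (1 / X)) x :=
    HasDerivAt.comp (h₂ := cutoff ρ) (h := fun x => x / X) x (hasDerivAt_cutoff hρ (x / X))
      ((hasDerivAt_id' x).div_const X)
  have h := (hasDerivAt_exp_mul_rpow ((ν : ℝ) / 2) hx).mul hq
  refine h.congr_deriv ?_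
  rw [rieszWeightDeriv]
  ring

theorem hasDerivAt_rieszWeightDeriv (hρ : 1 < ρ) (hX : 0 < X) {x : ℝ} (hx : 0 < x) (hxX : x ≠ X) :
    HasDerivAt (rieszWeightDeriv ν ρ X) (rieszWeightDeriv2 ν ρ X x) x := by
  have hq : HasDerivAt (fun x => cutoff ρ (x / X))
      (-(ρ * (max (1 - x / X) 0) ^ (ρ - 1)) * (1 / X)) x :=
    HasDerivAt.comp (h₂ := cutoff ρ) (h := fun x => x / X) x (hasDerivAt_cutoff hρ (x / X))
      ((hasDerivAt_id' x).div_const X)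
  have hm : HasDerivAt (fun x => (max (1 - x / X) 0) ^ (ρ - 1))
      (-((Iio X).indicator (fun x => (ρ - 1) / X * (1 - x / X) ^ (ρ - 2)) x)) x := by
    rcases lt_or_gt_of_ne hxX with h | h
    · have hpos : 0 < 1 - x / X := by rw [sub_pos, div_lt_one hX]; exact h
      rw [indicator_of_mem (mem_Iio.2 h)]
      have h1 := ((((hasDerivAt_id x).div_const X).const_sub 1).rpow_const (p := ρ - 1)
        (Or.inl hpos.ne'))
      refine (h1.congr_of_eventuallyEq ?_).congr_deriv ?_
      · filter_upwards [eventually_lt_nhds h] with y hy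
        rw [max_eq_left]
        · rfl
        · rw [sub_nonneg, div_le_one hX]; exact hy.le
      · simp only [id]
        rw [show ρ - 1 - 1 = ρ - 2 by ring]
        ring
    · rw [indicator_of_notMem (by simpa using h.le), neg_zero]
      refine (hasDerivAt_const x (0 : ℝ)).congr_of_eventuallyEq ?_
      filter_upwards [eventually_gt_nhds h] with y hy
      rw [max_eq_right, Real.zero_rpow (by linarith)]
      rw [sub_nonpos, one_le_div hX]; exact hy.le
  have hd : HasDerivAt (fun x : ℝ => -(1 + (ν : ℝ) / 2 / x)) ((ν : ℝ) / 2 / x ^ 2) x := by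
    have := (((hasDerivAt_inv hx.ne').const_mul ((ν : ℝ) / 2)).const_add 1).neg
    refine (this.congr_of_eventuallyEq (Eventually.of_forall fun y => ?_)).congr_deriv ?_
    · simp [div_eq_mul_inv]
    · rw [div_eq_mul_inv _ (x ^ 2)]; ring
  have h := (hasDerivAt_exp_mul_rpow ((ν : ℝ) / 2) hx).mul ((hd.mul hq).sub (hm.const_mul (ρ / X)))
  refine h.congr_deriv ?_
  rw [rieszWeightDeriv2]
  have : (Iio X).indicator (fun x => ρ * (ρ - 1) / X ^ 2 * (1 - x / X) ^ (ρ - 2)) x =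
      ρ / X * (Iio X).indicator (fun x => (ρ - 1) / X * (1 - x / X) ^ (ρ - 2)) x := by
    rw [← indicator_const_mul]
    congr 1
    ext y
    ring
  rw [this]
  simp only [Pi.mul_apply, Pi.sub_apply]
  ring

theorem measurable_rieszWeightDeriv2 (hρ : 1 < ρ) : Measurable (rieszWeightDeriv2 ν ρ X) := by
  unfold rieszWeightDeriv2
  have h1 : Measurable (cutoff ρ) := (continuous_cutoff hρ).measurable
  refine Measurable.mul (by fun_prop) (Measurable.add (Measurable.add ?_ ?_) ?_)
  · exact Measurable.mul (by fun_prop) (h1.comp (by fun_prop))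
  · fun_prop
  · exact Measurable.indicator (by fun_prop) measurableSet_Iio

theorem integrableOn_one_sub_div_rpow (hρ : 1 < ρ) (hX : 0 < X) :
    IntegrableOn (fun x => (1 - x / X) ^ (ρ - 2)) (Ioo 0 X) := by
  have h := (intervalIntegral.intervalIntegrable_rpow' (a := 0) (b := 1) (r := ρ - 2)
    (by linarith)).comp_sub_left 1
  have h2 := h.comp_mul_right (c := X⁻¹)
  simp only [sub_zero, sub_self, div_inv_eq_mul, one_mul, zero_mul] at h2
  have h3 := h2.symm
  rw [intervalIntegrable_iff_integrableOn_Ioc_of_le hX.le] at h3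
  exact h3.mono_set Ioo_subset_Ioc_self

/-- The bound `cutoff ρ (x/X) = O(x/X)` removes one power from the singularity `x^{-2}` produced by
differentiating twice. -/
theorem abs_rieszWeightDeriv2_le (hρ : 1 < ρ) (hX : 0 < X) {x : ℝ} (hx : 0 < x) :
    |rieszWeightDeriv2 ν ρ X x| ≤ Real.exp (-x) * x ^ (-((ν : ℝ) / 2)) *
      (ρ / X * (x + (2 * ν + 2) + (((ν : ℝ) / 2) ^ 2 + ν / 2 + ν) * x⁻¹) +
      (Iio X).indicator (fun x => ρ * (ρ - 1) / X ^ 2 * (1 - x / X) ^ (ρ - 2)) x) := by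
  have hE : 0 < Real.exp (-x) * x ^ (-((ν : ℝ) / 2)) := by positivity
  have hind : 0 ≤ (Iio X).indicator (fun x => ρ * (ρ - 1) / X ^ 2 * (1 - x / X) ^ (ρ - 2)) x := by
    refine indicator_nonneg (fun y hy => ?_) x
    have : 0 ≤ 1 - y / X := by rw [sub_nonneg, div_le_one hX]; exact (mem_Iio.1 hy).le
    have h2 : 0 ≤ ρ - 1 := by linarith
    have h3 : 0 ≤ ρ := by linarith
    exact mul_nonneg (by positivity) (Real.rpow_nonneg this _)
  have hρ0 : 0 < ρ := by linarith
  have hν : (0 : ℝ) ≤ ν := by positivity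
  have hm0 : 0 ≤ max (1 - x / X) 0 := le_max_right _ _
  have hm1 : (max (1 - x / X) 0) ^ (ρ - 1) ≤ 1 := by
    refine Real.rpow_le_one hm0 (max_le ?_ zero_le_one) (by linarith)
    have : 0 < x / X := div_pos hx hX
    linarith
  have hm2 := Real.rpow_nonneg hm0 (ρ - 1)
  have hc := abs_cutoff_le hρ.le (div_pos hx hX).le
  rw [rieszWeightDeriv2, abs_mul, abs_of_pos hE]
  refine mul_le_mul_of_nonneg_left ?_ hE.le
  have hA : 0 ≤ (1 + (ν : ℝ) / 2 / x) ^ 2 + (ν : ℝ) / 2 / x ^ 2 := by positivity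
  have hB : 0 ≤ 2 * (1 + (ν : ℝ) / 2 / x) * (ρ / X) := by positivity
  calc _ ≤ |((1 + (ν : ℝ) / 2 / x) ^ 2 + (ν : ℝ) / 2 / x ^ 2) * cutoff ρ (x / X)| +
        |2 * (1 + (ν : ℝ) / 2 / x) * (ρ / X) * (max (1 - x / X) 0) ^ (ρ - 1)| +
        |(Iio X).indicator (fun x => ρ * (ρ - 1) / X ^ 2 * (1 - x / X) ^ (ρ - 2)) x| :=
        abs_add_three _ _ _
    _ ≤ ((1 + (ν : ℝ) / 2 / x) ^ 2 + (ν : ℝ) / 2 / x ^ 2) * (ρ * (x / X)) +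
        2 * (1 + (ν : ℝ) / 2 / x) * (ρ / X) * 1 +
        (Iio X).indicator (fun x => ρ * (ρ - 1) / X ^ 2 * (1 - x / X) ^ (ρ - 2)) x := by
        rw [abs_mul, abs_of_nonneg hA, abs_mul, abs_of_nonneg hB, abs_of_nonneg hm2,
          abs_of_nonneg hind]
        gcongr
    _ ≤ _ := by
        refine add_le_add_left (le_of_sub_nonneg ?_) _
        -- The sharp constant is `ν + 2`; the difference of the two sides is therefore `ρν/X`.
        have : ρ / X * (x + (2 * ν + 2) + (((ν : ℝ) / 2) ^ 2 + ν / 2 + ν) * x⁻¹) -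
            (((1 + (ν : ℝ) / 2 / x) ^ 2 + (ν : ℝ) / 2 / x ^ 2) * (ρ * (x / X)) +
            2 * (1 + (ν : ℝ) / 2 / x) * (ρ / X) * 1) = ρ / X * ν := by
          field_simp
          ring
        rw [this]
        positivity

/-- At `0` the integrand is `O(x^{β-ν/2-1})`, near `X` it is `O((1-x/X)^{ρ-2})` up to bounded terms,
and half of the decay `e^{-x}` is left at infinity. Both exponents `ν/2 + 7/8` and `ν/2 + 1` used
below for `β` are admissible. -/
theorem integrableOn_rieszWeightDeriv2 (hρ : 1 < ρ) (hX : 0 < X) {β : ℝ} (hβ : (ν : ℝ) / 2 < β) :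
    IntegrableOn (fun x => x ^ β * Real.exp (x / 2) * rieszWeightDeriv2 ν ρ X x) (Ioi 0) := by
  set δ := β - (ν : ℝ) / 2 with hδ
  have hδ0 : 0 < δ := by rw [hδ]; linarith
  have hr : (0 : ℝ) < 1 / 2 := by norm_num
  have g0 := integrableOn_rpow_mul_exp_neg_mul (s := δ) (by linarith) hr
  have g1 := integrableOn_rpow_mul_exp_neg_mul (s := δ + 1) (by linarith) hr
  have g2 := integrableOn_rpow_mul_exp_neg_mul (s := δ - 1) (by linarith) hr
  have g3 : IntegrableOn ((Iio X).indicator fun x => X ^ δ * (ρ * (ρ - 1) / X ^ 2) *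
      (1 - x / X) ^ (ρ - 2)) (Ioi 0) := by
    rw [IntegrableOn, integrable_indicator_iff measurableSet_Iio, IntegrableOn,
      Measure.restrict_restrict measurableSet_Iio, Iio_inter_Ioi]
    exact (integrableOn_one_sub_div_rpow hρ hX).const_mul _
  have g := (((g1.add (g0.const_mul (2 * ν + 2))).add
    (g2.const_mul (((ν : ℝ) / 2) ^ 2 + ν / 2 + ν))).const_mul (ρ / X)).add g3
  refine g.mono' ?_ ?_
  · refine Measurable.aestronglyMeasurable ?_
    exact Measurable.mul (by fun_prop) (measurable_rieszWeightDeriv2 ν hρ)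
  · filter_upwards [ae_restrict_mem measurableSet_Ioi] with x hx
    have hx0 : 0 < x := hx
    have h := abs_rieszWeightDeriv2_le ν hρ hX hx0
    have hfac : 0 < x ^ β * Real.exp (x / 2) := by positivity
    rw [norm_mul, Real.norm_of_nonneg hfac.le, Real.norm_eq_abs]
    refine (mul_le_mul_of_nonneg_left h hfac.le).trans ?_
    have e1 : x ^ β * Real.exp (x / 2) * (Real.exp (-x) * x ^ (-((ν : ℝ) / 2))) =
        x ^ δ * Real.exp (-(1 / 2 * x)) := by
      rw [hδ, sub_eq_add_neg, Real.rpow_add hx0, show -(1 / 2 * x) = x / 2 + -x by ring,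
        Real.exp_add]
      ring
    have e2 : x ^ (δ + 1) = x ^ δ * x := Real.rpow_add_one hx0.ne' _
    have e3 : x ^ (δ - 1) = x ^ δ * x⁻¹ := by rw [Real.rpow_sub_one hx0.ne', div_eq_mul_inv]
    rw [← mul_assoc, e1]
    simp only [Pi.add_apply]
    rw [e2, e3]
    rw [mul_add]
    refine add_le_add (le_of_eq (by ring)) ?_
    by_cases hxX : x ∈ Iio X
    · rw [indicator_of_mem hxX, indicator_of_mem hxX, mul_assoc (X ^ δ)]
      have hnn : 0 ≤ ρ * (ρ - 1) / X ^ 2 * (1 - x / X) ^ (ρ - 2) := by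
        have : 0 ≤ 1 - x / X := by rw [sub_nonneg, div_le_one hX]; exact (mem_Iio.1 hxX).le
        have h2 : 0 ≤ ρ - 1 := by linarith
        have h3 : 0 ≤ ρ := by linarith
        exact mul_nonneg (by positivity) (Real.rpow_nonneg this _)
      refine mul_le_mul_of_nonneg_right ?_ hnn
      have h1 : x ^ δ ≤ X ^ δ := Real.rpow_le_rpow hx0.le (mem_Iio.1 hxX).le hδ0.le
      have h2 : Real.exp (-(1 / 2 * x)) ≤ 1 := Real.exp_le_one_iff.2 (by linarith)
      have h3 : 0 ≤ X ^ δ := by positivity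
      calc x ^ δ * Real.exp (-(1 / 2 * x)) ≤ X ^ δ * 1 := by gcongr
        _ = X ^ δ := mul_one _
    · rw [indicator_of_notMem hxX, indicator_of_notMem hxX, mul_zero]

/-- When `y < x` the inserted factors `(x/y)^μ` and `e^{(x-y)/2}` are at least `1`. The bound
separates the variables, as Fubini requires, and supplies decay in `y`. -/
theorem max_sub_zero_le {μ x y : ℝ} (hμ : 0 ≤ μ) (hx : 0 < x) (hy : 0 < y) :
    max (x - y) 0 ≤ x ^ (μ + 1) * Real.exp (x / 2) * (y ^ (-μ) * Real.exp (-(y / 2))) := by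
  rcases le_total x y with h | h
  · rw [max_eq_right (by linarith)]; positivity
  · rw [max_eq_left (by linarith)]
    have h1 : 1 ≤ x ^ μ * y ^ (-μ) := by
      rw [Real.rpow_neg hy.le, ← div_eq_mul_inv, one_le_div (by positivity)]
      exact Real.rpow_le_rpow hy.le h hμ
    have h2 : 1 ≤ Real.exp (x / 2) * Real.exp (-(y / 2)) := by
      rw [← Real.exp_add]; exact Real.one_le_exp (by linarith)
    calc x - y ≤ x * 1 := by linarith
      _ ≤ x * ((x ^ μ * y ^ (-μ)) * (Real.exp (x / 2) * Real.exp (-(y / 2)))) :=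
        mul_le_mul_of_nonneg_left (by nlinarith) hx.le
      _ = _ := by rw [Real.rpow_add_one hx.ne']; ring

theorem integrableOn_max_sub_mul_rieszWeightDeriv2 (hρ : 1 < ρ) (hX : 0 < X) {y : ℝ} (hy : 0 < y) :
    IntegrableOn (fun x => max (x - y) 0 * rieszWeightDeriv2 ν ρ X x) (Ioi 0) := by
  have h := integrableOn_rieszWeightDeriv2 ν hρ hX (β := (ν : ℝ) / 2 + 1) (by linarith)
  refine (h.norm.mul_const (y ^ (-((ν : ℝ) / 2)) * Real.exp (-(y / 2)))).mono' ?_ ?_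
  · exact (Measurable.mul (by fun_prop) (measurable_rieszWeightDeriv2 ν hρ)).aestronglyMeasurable
  · filter_upwards [ae_restrict_mem measurableSet_Ioi] with x hx
    have hx0 : 0 < x := hx
    have h1 := max_sub_zero_le (μ := (ν : ℝ) / 2) (by positivity) hx0 hy
    have h2 : 0 < x ^ ((ν : ℝ) / 2 + 1) := by positivity
    simp only [norm_mul, Real.norm_eq_abs, abs_of_nonneg (le_max_right (x - y) 0), abs_of_pos h2,
      Real.abs_exp]
    calc max (x - y) 0 * |rieszWeightDeriv2 ν ρ X x| ≤ _ :=
        mul_le_mul_of_nonneg_right h1 (abs_nonneg _)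
      _ = _ := by ring

/-- Taylor's formula with integral remainder, expanding at infinity. -/
theorem integral_max_sub_mul_rieszWeightDeriv2 (hρ : 1 < ρ) (hX : 0 < X) {y : ℝ} (hy : 0 < y) :
    ∫ x in Ioi (0 : ℝ), max (x - y) 0 * rieszWeightDeriv2 ν ρ X x = rieszWeight ν ρ X y := by
  have hint := integrableOn_max_sub_mul_rieszWeightDeriv2 ν hρ hX hy
  have hsub : Ioi y ⊆ Ioi 0 := Ioi_subset_Ioi hy.le
  have h1 : ∫ x in Ioi (0 : ℝ), max (x - y) 0 * rieszWeightDeriv2 ν ρ X x =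
      ∫ x in Ioi y, max (x - y) 0 * rieszWeightDeriv2 ν ρ X x := by
    refine (setIntegral_eq_of_subset_of_forall_sdiff_eq_zero
      (f := fun x => max (x - y) 0 * rieszWeightDeriv2 ν ρ X x) (μ := volume)
      measurableSet_Ioi hsub fun x hx => ?_)
    have : x ≤ y := by simpa using hx.2
    rw [max_eq_right (by linarith), zero_mul]
  have h2 : ∫ x in Ioi y, max (x - y) 0 * rieszWeightDeriv2 ν ρ X x =
      ∫ x in Ioi y, (x - y) * rieszWeightDeriv2 ν ρ X x :=
    setIntegral_congr_fun measurableSet_Ioi fun x hx => by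
      rw [max_eq_left (by linarith [mem_Ioi.1 hx])]
  have hint2 : IntegrableOn (fun x => (x - y) * rieszWeightDeriv2 ν ρ X x) (Ioi y) :=
    (integrableOn_congr_fun (fun x hx => by
      rw [max_eq_left (by linarith [mem_Ioi.1 hx])]) measurableSet_Ioi).1 (hint.mono_set hsub)
  rw [h1, h2]
  -- The antiderivative of `(x - y) w''(x)`.
  set G : ℝ → ℝ := fun x => (x - y) * rieszWeightDeriv ν ρ X x - rieszWeight ν ρ X x with hG
  have hGc : ∀ x, 0 < x → ContinuousAt G x := by
    intro x hx
    have c1 := (hasDerivAt_rieszWeight ν (X := X) hρ hx).continuousAt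
    have c2 : ContinuousAt (rieszWeightDeriv ν ρ X) x := by
      unfold rieszWeightDeriv
      have c3 : ContinuousAt (fun x => cutoff ρ (x / X)) x :=
        ((continuous_cutoff hρ).comp (by fun_prop)).continuousAt
      have c4 : ContinuousAt (fun x : ℝ => (max (1 - x / X) 0) ^ (ρ - 1)) x :=
        ContinuousAt.rpow_const (by fun_prop) (Or.inr (by linarith))
      have c5 : ContinuousAt (fun x : ℝ => x ^ (-((ν : ℝ) / 2))) x :=
        Real.continuousAt_rpow_const _ _ (Or.inl hx.ne')
      have c6 : ContinuousAt (fun x : ℝ => (ν : ℝ) / 2 / x) x :=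
        continuousAt_const.div continuousAt_id hx.ne'
      fun_prop
    exact ((continuousAt_id.sub continuousAt_const).mul c2).sub c1
  have hGd : ∀ x, 0 < x → x ≠ X → HasDerivAt G ((x - y) * rieszWeightDeriv2 ν ρ X x) x := by
    intro x hx hxX
    have d1 := hasDerivAt_rieszWeight ν (X := X) hρ hx
    have d2 := hasDerivAt_rieszWeightDeriv ν hρ hX hx hxX
    refine ((((hasDerivAt_id x).sub_const y).mul d2).sub d1).congr_deriv ?_
    simp
  have hFTC : ∀ R, y ≤ R → ∫ x in y..R, (x - y) * rieszWeightDeriv2 ν ρ X x = G R - G y := by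
    intro R hR
    -- At `x = X` the function `G` is continuous but possibly not differentiable, so that point is
    -- excepted.
    refine integral_eq_of_hasDerivAt_off_countable_of_le G _ hR (countable_singleton X)
      (fun x hx => (hGc x (by linarith [hx.1])).continuousWithinAt)
      (fun x hx => hGd x (by linarith [hx.1.1]) (by simpa using hx.2)) ?_
    rw [intervalIntegrable_iff_integrableOn_Ioc_of_le hR]
    exact hint2.mono_set Ioc_subset_Ioi_self
  have hGy : G y = -rieszWeight ν ρ X y := by simp [hG]
  have hlim : Tendsto G atTop (𝓝 0) := by
    have hb : Tendsto (fun x : ℝ => (1 + (ν : ℝ) / 2) * (x ^ (1 : ℝ) * Real.exp (-1 * x)) +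
        x ^ (0 : ℝ) * Real.exp (-1 * x)) atTop (𝓝 0) := by
      simpa using ((tendsto_rpow_mul_exp_neg_mul_atTop_nhds_zero 1 1 one_pos).const_mul
        (1 + (ν : ℝ) / 2)).add (tendsto_rpow_mul_exp_neg_mul_atTop_nhds_zero 0 1 one_pos)
    refine squeeze_zero_norm' ?_ hb
    filter_upwards [eventually_ge_atTop 1, eventually_ge_atTop y, eventually_ge_atTop X]
      with x hx1 hxy hxX
    have hx0 : 0 < x := by linarith
    -- Beyond `X` the cutoff is `-1`, so the weight is `-e^{-x} x^{-ν/2}` and decays exponentially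
    -- together with its derivative.
    have hm : max (1 - x / X) 0 = 0 := max_eq_right (by rw [sub_nonpos, one_le_div hX]; exact hxX)
    have hq : cutoff ρ (x / X) = -1 := by
      rw [cutoff, hm, Real.zero_rpow (by linarith)]; ring
    have hE0 : 0 < Real.exp (-x) * x ^ (-((ν : ℝ) / 2)) := by positivity
    have hE1 : Real.exp (-x) * x ^ (-((ν : ℝ) / 2)) ≤ Real.exp (-x) := by
      have : x ^ (-((ν : ℝ) / 2)) ≤ 1 :=
        Real.rpow_le_one_of_one_le_of_nonpos hx1 (by
          have : (0 : ℝ) ≤ ν := by positivity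
          linarith)
      nlinarith [Real.exp_pos (-x)]
    have hGx : G x = (x - y) * (Real.exp (-x) * x ^ (-((ν : ℝ) / 2)) * (1 + (ν : ℝ) / 2 / x)) +
        Real.exp (-x) * x ^ (-((ν : ℝ) / 2)) := by
      simp only [hG, rieszWeight, rieszWeightDeriv]
      rw [hm, hq, Real.zero_rpow (by linarith : ρ - 1 ≠ 0)]
      ring
    have hd : (ν : ℝ) / 2 / x ≤ (ν : ℝ) / 2 := div_le_self (by positivity) hx1
    rw [hGx, Real.norm_of_nonneg (by
      have : 0 ≤ x - y := by linarith
      positivity)]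
    rw [Real.rpow_one, Real.rpow_zero, neg_one_mul, one_mul]
    refine add_le_add ?_ hE1
    calc (x - y) * (Real.exp (-x) * x ^ (-((ν : ℝ) / 2)) * (1 + (ν : ℝ) / 2 / x))
        ≤ x * (Real.exp (-x) * (1 + (ν : ℝ) / 2)) := by
          gcongr
          linarith
      _ = _ := by ring
  have ht := intervalIntegral_tendsto_integral_Ioi y hint2 tendsto_id
  have ht2 : Tendsto (fun R => ∫ x in y..id R, (x - y) * rieszWeightDeriv2 ν ρ X x) atTop
      (𝓝 (0 - G y)) := by
    refine (hlim.sub_const (G y)).congr' ?_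
    filter_upwards [eventually_ge_atTop y] with R hR
    exact (hFTC R hR).symm
  rw [tendsto_nhds_unique ht ht2, hGy]
  ring

end Weight

/-! ### Moving two derivatives from the Bessel function to the weight. -/

theorem besselB_succ_zero (ν : ℕ) : besselB (ν + 1) 0 = 0 := by
  have := abs_besselB_le (ν + 1) 0
  simpa using this

section Duality

variable (ν : ℕ) {ρ X : ℝ}

theorem integral_max_sub_mul_besselB {a x : ℝ} (ha : a ≠ 0) (hx : 0 ≤ x) :
    ∫ y in Ioi (0 : ℝ), max (x - y) 0 * besselB ν (a * y) = besselB (ν + 2) (a * x) / a ^ 2 := by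
  have h1 : ∫ y in Ioi (0 : ℝ), max (x - y) 0 * besselB ν (a * y) =
      ∫ y in Ioc 0 x, max (x - y) 0 * besselB ν (a * y) := by
    refine setIntegral_eq_of_subset_of_forall_sdiff_eq_zero
      (f := fun y => max (x - y) 0 * besselB ν (a * y)) (μ := volume)
      measurableSet_Ioi Ioc_subset_Ioi_self fun y hy => ?_
    have h0 : 0 < y := hy.1
    have : x < y := by
      by_contra h
      exact hy.2 ⟨h0, not_lt.1 h⟩
    rw [max_eq_right (by linarith), zero_mul]
  have h2 : ∫ y in Ioc 0 x, max (x - y) 0 * besselB ν (a * y) =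
      ∫ y in Ioc 0 x, (x - y) * besselB ν (a * y) :=
    setIntegral_congr_fun measurableSet_Ioc fun y hy => by
      rw [max_eq_left (by linarith [hy.2])]
  rw [h1, h2, ← intervalIntegral.integral_of_le hx]
  have hb : ∀ m y, HasDerivAt (fun y => besselB (m + 1) (a * y)) (besselB m (a * y) * a) y := by
    intro m y
    have := (hasDerivAt_besselB m (a * y)).comp y ((hasDerivAt_id' y).const_mul a)
    simpa using! this
  -- An explicit antiderivative, from integrating by parts with `B_{m+1}' = B_m`.
  have hd : ∀ y ∈ uIcc 0 x, HasDerivAt (fun y => (x - y) * (besselB (ν + 1) (a * y) / a) +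
      besselB (ν + 2) (a * y) / a ^ 2) ((x - y) * besselB ν (a * y)) y := by
    intro y _
    refine ((((hasDerivAt_id' y).const_sub x).mul ((hb ν y).div_const a)).add
      ((hb (ν + 1) y).div_const (a ^ 2))).congr_deriv ?_
    field_simp
    ring
  rw [intervalIntegral.integral_eq_sub_of_hasDerivAt hd]
  · simp [besselB_succ_zero]
  · refine Continuous.intervalIntegrable ?_ _ _
    have := continuous_besselB ν
    fun_prop

theorem integrableOn_rpow_mul_exp_mul_besselB {a : ℝ} (ha : 0 ≤ a) :
    IntegrableOn (fun y => y ^ (-((ν : ℝ) / 2)) * Real.exp (-(y / 2)) * besselB ν (a * y))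
      (Ioi 0) := by
  have h := (integrable_and_hasSum_mellin_besselB ν (a := 2 * a) (w := (((ν : ℝ) / 2 : ℝ) : ℂ))
    (by positivity) (by
      rw [Complex.ofReal_re]
      have : (0 : ℝ) ≤ ν := by positivity
      linarith)).1
  -- The substitution `x = y/2` turns `e^{-x}` into `e^{-y/2}`; this is why the Mellin integral was
  -- taken with `2a`.
  rw [← mul_zero (1 / 2 : ℝ), ← integrableOn_Ioi_comp_mul_left_iff _ _ (by norm_num)] at h
  refine (h.norm.const_mul ((1 / 2 : ℝ) ^ ((ν : ℝ) / 2))).mono' ?_ ?_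
  · refine Measurable.aestronglyMeasurable ?_
    have := (continuous_besselB ν).measurable
    exact Measurable.mul (by fun_prop) (this.comp (by fun_prop))
  · filter_upwards [ae_restrict_mem measurableSet_Ioi] with y hy
    have hy0 : 0 < y := hy
    have hy2 : 0 < 1 / 2 * y := by positivity
    rw [norm_mul, norm_mul, norm_mul, norm_mul, Complex.norm_cpow_eq_rpow_re_of_pos hy2,
      Complex.norm_exp, Complex.norm_real, Real.norm_of_nonneg (Real.exp_pos _).le,
      Real.norm_of_nonneg (Real.rpow_nonneg hy0.le _)]
    rw [show 2 * a * (1 / 2 * y) = a * y by ring]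
    have e1 : (-(((ν : ℝ) / 2 : ℝ) : ℂ)).re = -((ν : ℝ) / 2) := by
      rw [← Complex.ofReal_neg, Complex.ofReal_re]
    have e2 : (-((1 / 2 * y : ℝ) : ℂ)).re = -(y / 2) := by
      rw [← Complex.ofReal_neg, Complex.ofReal_re]; ring
    rw [e1, e2, Real.mul_rpow (by norm_num) hy0.le]
    have e3 : (1 / 2 : ℝ) ^ ((ν : ℝ) / 2) * (1 / 2 : ℝ) ^ (-((ν : ℝ) / 2)) = 1 := by
      rw [← Real.rpow_add (by norm_num), add_neg_cancel, Real.rpow_zero]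
    refine le_of_eq ?_
    linear_combination (-(‖besselB ν (a * y)‖ * (Real.exp (-(y / 2)) * y ^ (-((ν : ℝ) / 2))))) * e3

/-- Both sides are iterated integrals of `B_ν(ay) (x-y)_+ w''(x)`. Passing to `B_{ν+2}/a²` gains
enough decay in `a` for the sum over `n` to converge absolutely. -/
theorem integral_besselB_mul_rieszWeight (hρ : 1 < ρ) (hX : 0 < X) {a : ℝ} (ha : 0 < a) :
    ∫ y in Ioi (0 : ℝ), besselB ν (a * y) * rieszWeight ν ρ X y =
      ∫ x in Ioi (0 : ℝ), besselB (ν + 2) (a * x) / a ^ 2 * rieszWeightDeriv2 ν ρ X x := by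
  have hD := integrableOn_rieszWeightDeriv2 ν hρ hX (β := (ν : ℝ) / 2 + 1) (by linarith)
  have hB := integrableOn_rpow_mul_exp_mul_besselB ν ha.le
  have hmB := (continuous_besselB ν).measurable
  have hmD := measurable_rieszWeightDeriv2 ν (X := X) hρ
  have hint : Integrable (Function.uncurry fun y x : ℝ =>
      besselB ν (a * y) * (max (x - y) 0 * rieszWeightDeriv2 ν ρ X x))
      ((volume.restrict (Ioi 0)).prod (volume.restrict (Ioi 0))) := by
    refine (hB.mul_prod hD).norm.mono' ?_ ?_
    · refine Measurable.aestronglyMeasurable ?_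
      exact Measurable.mul (hmB.comp (by fun_prop))
        (Measurable.mul (by fun_prop) (hmD.comp measurable_snd))
    · have hp1 : ∀ᵐ p : ℝ × ℝ ∂((volume.restrict (Ioi 0)).prod (volume.restrict (Ioi 0))),
          p.1 ∈ Ioi (0 : ℝ) :=
        Measure.quasiMeasurePreserving_fst.ae (ae_restrict_mem measurableSet_Ioi)
      have hp2 : ∀ᵐ p : ℝ × ℝ ∂((volume.restrict (Ioi 0)).prod (volume.restrict (Ioi 0))),
          p.2 ∈ Ioi (0 : ℝ) :=
        Measure.quasiMeasurePreserving_snd.ae (ae_restrict_mem measurableSet_Ioi)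
      filter_upwards [hp1, hp2] with p h1 h2
      have h1' : 0 < p.1 := h1
      have h2' : 0 < p.2 := h2
      have h := max_sub_zero_le (μ := (ν : ℝ) / 2) (by positivity) h2' h1'
      simp only [Function.uncurry, norm_mul, Real.norm_eq_abs,
        abs_of_nonneg (le_max_right (p.2 - p.1) 0), Real.abs_exp,
        abs_of_nonneg (Real.rpow_nonneg h1'.le _), abs_of_nonneg (Real.rpow_nonneg h2'.le _)]
      calc |besselB ν (a * p.1)| * (max (p.2 - p.1) 0 * |rieszWeightDeriv2 ν ρ X p.2|) ≤
          |besselB ν (a * p.1)| * ((p.2 ^ ((ν : ℝ) / 2 + 1) * Real.exp (p.2 / 2) *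
            (p.1 ^ (-((ν : ℝ) / 2)) * Real.exp (-(p.1 / 2)))) * |rieszWeightDeriv2 ν ρ X p.2|) := by
            gcongr
        _ = _ := by ring
  have h1 : ∀ y ∈ Ioi (0 : ℝ), besselB ν (a * y) * rieszWeight ν ρ X y =
      ∫ x in Ioi (0 : ℝ), besselB ν (a * y) * (max (x - y) 0 * rieszWeightDeriv2 ν ρ X x) := by
    intro y hy
    rw [integral_const_mul, integral_max_sub_mul_rieszWeightDeriv2 ν hρ hX hy]
  have h2 : ∀ x ∈ Ioi (0 : ℝ), besselB (ν + 2) (a * x) / a ^ 2 * rieszWeightDeriv2 ν ρ X x =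
      ∫ y in Ioi (0 : ℝ), besselB ν (a * y) * (max (x - y) 0 * rieszWeightDeriv2 ν ρ X x) := by
    intro x hx
    rw [← integral_max_sub_mul_besselB ν ha.ne' (mem_Ioi.1 hx).le, ← integral_mul_const]
    refine integral_congr_ae (Eventually.of_forall fun y => ?_)
    simp only
    ring
  rw [setIntegral_congr_fun measurableSet_Ioi h1, setIntegral_congr_fun measurableSet_Ioi h2]
  exact integral_integral_swap hint

/-- A bound, uniform in `a`, for the integrals in `integral_besselB_mul_rieszWeight`. -/
theorem exists_integral_abs_besselB_mul_rieszWeightDeriv2_le (hρ : 1 < ρ) (hX : 0 < X) :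
    ∃ K : ℝ, 0 ≤ K ∧ ∀ a : ℝ, 0 < a →
      IntegrableOn (fun x => besselB (ν + 2) (a * x) / a ^ (ν + 2) * rieszWeightDeriv2 ν ρ X x)
        (Ioi 0) ∧
      ∫ x in Ioi (0 : ℝ), ‖besselB (ν + 2) (a * x) / a ^ (ν + 2) * rieszWeightDeriv2 ν ρ X x‖ ≤
        K * a ^ (-(((ν : ℝ) + 2) / 2 + 1 / 8)) := by
  obtain ⟨K, hK, hbound⟩ := exists_abs_besselB_le ν
  set β : ℝ := ((ν : ℝ) + 2) / 2 - 1 / 8 with hβ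
  have hD := (integrableOn_rieszWeightDeriv2 ν hρ hX (β := β) (by rw [hβ]; linarith)).norm
  have hpt : ∀ a : ℝ, 0 < a → ∀ x ∈ Ioi (0 : ℝ),
      ‖besselB (ν + 2) (a * x) / a ^ (ν + 2) * rieszWeightDeriv2 ν ρ X x‖ ≤
      K * a ^ (-(((ν : ℝ) + 2) / 2 + 1 / 8)) *
        ‖x ^ β * Real.exp (x / 2) * rieszWeightDeriv2 ν ρ X x‖ := by
    intro a ha x hx
    have hx0 : 0 < x := hx
    have h1 := hbound (a * x) (mul_pos ha hx0)
    rw [Real.mul_rpow ha.le hx0.le] at h1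
    have h2 : a ^ β / a ^ (ν + 2) = a ^ (-(((ν : ℝ) + 2) / 2 + 1 / 8)) := by
      rw [← Real.rpow_natCast, ← Real.rpow_sub ha]
      congr 1
      rw [hβ]
      push_cast
      ring
    have h3 : 1 ≤ Real.exp (x / 2) := Real.one_le_exp (by linarith)
    have h4 : 0 < x ^ β := by positivity
    rw [norm_mul, norm_mul, norm_div, Real.norm_eq_abs, Real.norm_of_nonneg (by positivity : 0 ≤ a ^ (ν + 2)),
      Real.norm_of_nonneg (by positivity : 0 ≤ x ^ β * Real.exp (x / 2)), ← h2, ← mul_assoc]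
    refine mul_le_mul_of_nonneg_right ?_ (norm_nonneg _)
    calc |besselB (ν + 2) (a * x)| / a ^ (ν + 2) ≤ K * (a ^ β * x ^ β) / a ^ (ν + 2) := by gcongr
      _ = K * (a ^ β / a ^ (ν + 2)) * (x ^ β * 1) := by ring
      _ ≤ K * (a ^ β / a ^ (ν + 2)) * (x ^ β * Real.exp (x / 2)) := by gcongr
  refine ⟨K * ∫ x in Ioi (0 : ℝ), ‖x ^ β * Real.exp (x / 2) * rieszWeightDeriv2 ν ρ X x‖,
    mul_nonneg hK (integral_nonneg fun _ => norm_nonneg _), fun a ha => ?_⟩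
  have hi : IntegrableOn (fun x => besselB (ν + 2) (a * x) / a ^ (ν + 2) *
      rieszWeightDeriv2 ν ρ X x) (Ioi 0) := by
    refine (hD.const_mul (K * a ^ (-(((ν : ℝ) + 2) / 2 + 1 / 8)))).mono' ?_ ?_
    · have h1 := (continuous_besselB (ν + 2)).measurable
      have h2 := measurable_rieszWeightDeriv2 ν (X := X) hρ
      exact (Measurable.mul ((h1.comp (by fun_prop)).div_const _) h2).aestronglyMeasurable
    · filter_upwards [ae_restrict_mem measurableSet_Ioi] with x hx using hpt a ha x hx
  refine ⟨hi, ?_⟩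
  calc _ ≤ ∫ x in Ioi (0 : ℝ), K * a ^ (-(((ν : ℝ) + 2) / 2 + 1 / 8)) *
        ‖x ^ β * Real.exp (x / 2) * rieszWeightDeriv2 ν ρ X x‖ :=
        setIntegral_mono_on hi.norm (hD.const_mul _) measurableSet_Ioi (hpt a ha)
    _ = _ := by rw [integral_const_mul]; ring

end Duality

/-! ### Fourier expansions of `f` and `f|w_N`, and the relation between them. -/

section Fricke

theorem hasSum_fourierCoefficient {Γ : Subgroup (GL (Fin 2) ℝ)} {k : ℤ} (f : CuspForm Γ k)
    (h1 : (1 : ℝ) ∈ Γ.strictPeriods) (z : ℍ) :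
    HasSum (fun n : ℕ => fourierCoefficient f n *
      Complex.exp (2 * Real.pi * Complex.I * n * (z : ℂ))) (f z) := by
  have : Fact (IsCusp OnePoint.infty Γ) := ⟨Γ.isCusp_of_mem_strictPeriods one_pos h1⟩
  convert! UpperHalfPlane.hasSum_qExpansion one_pos
    (SlashInvariantFormClass.periodic_comp_ofComplex f h1)
    (ModularFormClass.holo f) (ModularFormClass.bdd_at_infty f) z using 2 with n
  rw [fourierCoefficient, smul_eq_mul, Function.Periodic.qParam, ← Complex.exp_nat_mul]
  congr 2
  push_cast
  ring

section Gamma1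

variable {N : ℕ} {k : ℤ}
    (f : CuspForm ((CongruenceSubgroup.Gamma1 N : Subgroup SL(2, ℤ)) : Subgroup (GL (Fin 2) ℝ)) k)

theorem fourierCoefficient_zero : fourierCoefficient f 0 = 0 :=
  CuspFormClass.qExpansion_coeff_zero f one_pos (by simp)

theorem hasSum_fourierCoefficient_of_re_pos {p : ℂ} (hp : 0 < p.re) :
    HasSum (fun n : ℕ => fourierCoefficient f n * Complex.exp (-(2 * Real.pi * n * p)))
      (f ⟨Complex.I * p, by simpa using hp⟩) := by
  convert! hasSum_fourierCoefficient f (by simp) ⟨Complex.I * p, by simpa using hp⟩ using 4 with n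
  linear_combination (-(2 * Real.pi * n * p : ℂ)) * Complex.I_mul_I

end Gamma1

variable (N : ℕ) [NeZero N]

def frickeMatrix : GL (Fin 2) ℝ :=
  Matrix.GeneralLinearGroup.mkOfDetNeZero !![0, -1; (N : ℝ), 0]
    (by simpa using NeZero.ne N)

theorem frickeMatrix_smul (z : ℍ) : frickeMatrix N • z = frickePoint N z := by
  have hN : (0 : ℝ) < N := by exact_mod_cast Nat.pos_of_ne_zero (NeZero.ne N)
  ext
  rw [UpperHalfPlane.coe_smul_of_det_pos]
  · simp [frickePoint, num, denom, frickeMatrix, Matrix.GeneralLinearGroup.mkOfDetNeZero]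
  · simpa [frickeMatrix, Matrix.GeneralLinearGroup.mkOfDetNeZero] using hN

/-- The slash action carries `|det|^{k-1} = N^{k-1}`, which `N^{1-k}` undoes. Thus `f|w_N` is a
multiple of the cusp form `CuspForm.translate f (frickeMatrix N)`. -/
theorem frickeSlash_eq (k : ℤ) (f : ℍ → ℂ) :
    frickeSlash N k f = (((N : ℝ) ^ ((k : ℝ) / 2) * (N : ℝ) ^ (1 - k) : ℝ) : ℂ) •
      (f ∣[k] frickeMatrix N) := by
  have hN : (0 : ℝ) < N := by exact_mod_cast Nat.pos_of_ne_zero (NeZero.ne N)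
  have hd : 0 < (frickeMatrix N).det.val := by
    simpa [frickeMatrix, Matrix.GeneralLinearGroup.mkOfDetNeZero] using hN
  have hdv : (frickeMatrix N).det.val = N := by
    simp [frickeMatrix, Matrix.GeneralLinearGroup.mkOfDetNeZero] 
  ext z
  rw [Pi.smul_apply, ModularForm.slash_apply, frickeMatrix_smul, frickeSlash, σ, if_pos hd, hdv,
    abs_of_pos hN]
  have : denom (frickeMatrix N) z = N * z := by
    simp [denom, frickeMatrix, Matrix.GeneralLinearGroup.mkOfDetNeZero]
  rw [this]
  have h2 : (N : ℂ) ^ (1 - k) * (N : ℂ) ^ (k - 1) = 1 := by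
    rw [← zpow_add₀ (by exact_mod_cast hN.ne')]; simp
  simp only [ofReal_mul, ofReal_zpow, ofReal_natCast, smul_eq_mul, ContinuousAlgEquiv.refl_apply]
  linear_combination (-(((N : ℝ) ^ ((k : ℝ) / 2) : ℝ) : ℂ) * ((N : ℂ) * (z : ℂ)) ^ (-k) * f (frickePoint N z)) * h2

-- Conjugating the translation by `w_N` gives `(1 0; -N 1)`, which lies in `Γ₁(N)`; hence `f|w_N`
-- has period `1`.
open Pointwise in
theorem one_mem_strictPeriods_conj_frickeMatrix :
    (1 : ℝ) ∈ (ConjAct.toConjAct (frickeMatrix N)⁻¹ •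
      ((CongruenceSubgroup.Gamma1 N : Subgroup SL(2, ℤ)) : Subgroup (GL (Fin 2) ℝ))).strictPeriods := by
  rw [Subgroup.mem_strictPeriods_iff, Subgroup.mem_pointwise_smul_iff_inv_smul_mem]
  rw [← ConjAct.toConjAct_inv, inv_inv, ConjAct.toConjAct_smul]
  let γ : SL(2, ℤ) := ⟨!![1, 0; -N, 1], by simp [Matrix.det_fin_two]⟩
  refine Subgroup.mem_map.mpr ⟨γ, ?_, ?_⟩
  · rw [CongruenceSubgroup.Gamma1_mem]
    simp [γ]
  · have hγ : (Matrix.SpecialLinearGroup.mapGL ℝ γ : Matrix (Fin 2) (Fin 2) ℝ) =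
        !![1, 0; -(N : ℝ), 1] := by
      rw [Matrix.SpecialLinearGroup.mapGL_coe_matrix]
      ext i j
      change algebraMap ℤ ℝ (γ.1 i j) = _
      fin_cases i <;> fin_cases j <;> simp [γ]
    rw [eq_mul_inv_iff_mul_eq]
    ext i j
    rw [Units.val_mul, hγ]
    fin_cases i <;> fin_cases j <;>
    simp [frickeMatrix, Matrix.GeneralLinearGroup.mkOfDetNeZero, Matrix.mul_apply,
      Fin.sum_univ_two, Matrix.GeneralLinearGroup.upperRightHom]

variable {N} {k : ℤ}
    (f : CuspForm ((CongruenceSubgroup.Gamma1 N : Subgroup SL(2, ℤ)) : Subgroup (GL (Fin 2) ℝ)) k)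

theorem fourierCoefficient_frickeSlash :
    fourierCoefficient (frickeSlash N k f) = (((N : ℝ) ^ ((k : ℝ) / 2) * (N : ℝ) ^ (1 - k) : ℝ) : ℂ) •
      fourierCoefficient (CuspForm.translate f (frickeMatrix N)) := by
  rw [frickeSlash_eq]
  ext n
  have := ModularForm.qExpansion_smul one_pos (one_mem_strictPeriods_conj_frickeMatrix N)
     (((N : ℝ) ^ ((k : ℝ) / 2) * (N : ℝ) ^ (1 - k) : ℝ) : ℂ) (CuspForm.translate f (frickeMatrix N))
  simp only [fourierCoefficient, Pi.smul_apply]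
  exact (congrArg (fun P => PowerSeries.coeff n P) this).trans (by simp)

theorem fourierCoefficient_frickeSlash_zero : fourierCoefficient (frickeSlash N k f) 0 = 0 := by
  rw [fourierCoefficient_frickeSlash, Pi.smul_apply]
  have := CuspFormClass.qExpansion_coeff_zero (CuspForm.translate f (frickeMatrix N)) one_pos
    (one_mem_strictPeriods_conj_frickeMatrix N)
  rw [fourierCoefficient, this, smul_zero]

theorem hasSum_fourierCoefficient_frickeSlash (z : ℍ) :
    HasSum (fun n : ℕ => fourierCoefficient (frickeSlash N k f) n *
      Complex.exp (2 * Real.pi * Complex.I * n * (z : ℂ))) (frickeSlash N k f z) := by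
  rw [fourierCoefficient_frickeSlash, frickeSlash_eq]
  simpa [mul_assoc] using! (hasSum_fourierCoefficient (CuspForm.translate f (frickeMatrix N))
    (one_mem_strictPeriods_conj_frickeMatrix N) z).mul_left
    (((N : ℝ) ^ ((k : ℝ) / 2) * (N : ℝ) ^ (1 - k) : ℝ) : ℂ)

/-- Evaluate at `z = ip/N`: then `-1/(Nz) = i/p` and `(Nz)^{-k} = i^{-k} p^{-k}`. -/
theorem hasSum_fricke_transform {p : ℂ} (hp : 0 < p.re) {S : ℂ}
    (hS : HasSum (fun n : ℕ => fourierCoefficient f n * Complex.exp (-(2 * Real.pi * n / p))) S) :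
    HasSum (fun n : ℕ => fourierCoefficient (frickeSlash N k f) n *
      Complex.exp (-(2 * Real.pi * n / N * p)))
      (Complex.I ^ (-k) * (((N : ℝ) ^ ((k : ℝ) / 2) : ℝ) : ℂ) * p ^ (-k) * S) := by
  have hN : (0 : ℝ) < N := by exact_mod_cast Nat.pos_of_ne_zero (NeZero.ne N)
  have hN' : (N : ℂ) ≠ 0 := by exact_mod_cast hN.ne'
  have hp0 : p ≠ 0 := by rintro rfl; simp at hp
  have hpi : 0 < (p⁻¹).re := by
    rw [Complex.inv_re]; exact div_pos hp (Complex.normSq_pos.mpr hp0)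
  let z : ℍ := ⟨Complex.I * p / N, by
    have : (Complex.I * p / N).im = p.re / N := by
      rw [Complex.div_natCast_im]; simp
    rw [this]; positivity⟩
  have hz : (z : ℂ) = Complex.I * p / N := rfl
  have h1 := hasSum_fourierCoefficient_of_re_pos f hpi
  have hS' : S = f ⟨Complex.I * p⁻¹, by simpa using hpi⟩ := hS.unique (by simpa [div_eq_mul_inv] using h1)
  have h2 := hasSum_fourierCoefficient_frickeSlash f z
  have hpt : frickePoint N z = ⟨Complex.I * p⁻¹, by simpa using hpi⟩ := by
    ext
    simp only [frickePoint, hz]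
    field_simp
    simp
  convert! h2 using 1
  · ext n
    congr 2
    rw [hz]
    linear_combination (-(2 * Real.pi * n * p / N : ℂ)) * Complex.I_mul_I
  · rw [frickeSlash, hpt, hS', hz, mul_div_cancel₀ _ hN', mul_zpow]
    ring

end Fricke

/-! ### Mean-square bounds for the Fourier coefficients. -/

/-- Dyadic decomposition: `n^{-β}` is dominated by `∑ 2^{-jβ} e^{-n/2^j}`. The hypothesis at `y =
2^{-j}` then gives a geometric series of ratio `2^{κ-β}`. -/
theorem summable_mul_rpow_of_sum_mul_exp_le {a : ℕ → ℝ} (ha : ∀ n, 0 ≤ a n) {C κ β : ℝ}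
    (hC : 0 ≤ C) (hκβ : κ < β) (hβ : 0 < β)
    (h : ∀ y : ℝ, 0 < y → ∀ s : Finset ℕ, ∑ n ∈ s, a n * Real.exp (-(n * y)) ≤ C * y ^ (-κ)) :
    Summable fun n : ℕ => a n * (n : ℝ) ^ (-β) := by
  set r : ℝ := (2 : ℝ) ^ (κ - β)
  have hr0 : 0 ≤ r := by positivity
  have hr1 : r < 1 := Real.rpow_lt_one_of_one_lt_of_neg one_lt_two (by linarith)
  have hg := (summable_geometric_of_lt_one hr0 hr1)
  -- Only `j = ⌊log₂ n⌋` is used, where `n/2^j ≤ 2`; this accounts for `e²`. For `n = 0` the left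
  -- side is `0` by convention.
  have hpt : ∀ n M : ℕ, n < M → (n : ℝ) ^ (-β) ≤ Real.exp 2 *
      ∑ j ∈ Finset.range M, ((2 : ℝ) ^ j) ^ (-β) * Real.exp (-(n * ((2 : ℝ) ^ j)⁻¹)) := by
    intro n M hnM
    rcases Nat.eq_zero_or_pos n with rfl | hn
    · rw [Nat.cast_zero, Real.zero_rpow (by linarith)]; positivity
    have hlog : Nat.log 2 n ∈ Finset.range M :=
      Finset.mem_range.mpr ((Nat.log_lt_self 2 hn.ne').trans hnM)
    have h1 : (2 : ℝ) ^ Nat.log 2 n ≤ n := by exact_mod_cast Nat.pow_log_le_self 2 hn.ne'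
    have h2 : (n : ℝ) ≤ 2 ^ Nat.log 2 n * 2 := by
      have := (Nat.lt_pow_succ_log_self one_lt_two n).le
      rw [pow_succ] at this
      exact_mod_cast this
    have h3 : (n : ℝ) ^ (-β) ≤ ((2 : ℝ) ^ Nat.log 2 n) ^ (-β) :=
      Real.rpow_le_rpow_of_nonpos (by positivity) h1 (by linarith)
    have h4 : 1 ≤ Real.exp 2 * Real.exp (-(n * ((2 : ℝ) ^ Nat.log 2 n)⁻¹)) := by
      rw [← Real.exp_add]
      refine Real.one_le_exp ?_
      have : (n : ℝ) * ((2 : ℝ) ^ Nat.log 2 n)⁻¹ ≤ 2 := by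
        rw [← div_eq_mul_inv, div_le_iff₀ (by positivity)]; linarith
      linarith
    calc (n : ℝ) ^ (-β) ≤ ((2 : ℝ) ^ Nat.log 2 n) ^ (-β) * 1 := by rw [mul_one]; exact h3
      _ ≤ ((2 : ℝ) ^ Nat.log 2 n) ^ (-β) *
          (Real.exp 2 * Real.exp (-(n * ((2 : ℝ) ^ Nat.log 2 n)⁻¹))) :=
        mul_le_mul_of_nonneg_left h4 (by positivity)
      _ = Real.exp 2 * (((2 : ℝ) ^ Nat.log 2 n) ^ (-β) *
          Real.exp (-(n * ((2 : ℝ) ^ Nat.log 2 n)⁻¹))) := by ring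
      _ ≤ _ := mul_le_mul_of_nonneg_left (Finset.single_le_sum
        (f := fun j => ((2 : ℝ) ^ j) ^ (-β) * Real.exp (-(n * ((2 : ℝ) ^ j)⁻¹)))
        (fun j _ => by positivity) hlog) (Real.exp_pos 2).le
  refine summable_of_sum_le (c := Real.exp 2 * (C * ∑' j : ℕ, r ^ j))
    (fun n => mul_nonneg (ha n) (by positivity)) fun s => ?_
  obtain ⟨M, hM⟩ := s.exists_nat_subset_range
  calc ∑ n ∈ s, a n * (n : ℝ) ^ (-β)
      ≤ ∑ n ∈ s, a n * (Real.exp 2 * ∑ j ∈ Finset.range M,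
          ((2 : ℝ) ^ j) ^ (-β) * Real.exp (-(n * ((2 : ℝ) ^ j)⁻¹))) :=
        Finset.sum_le_sum fun n hn => mul_le_mul_of_nonneg_left
          (hpt n M (Finset.mem_range.mp (hM hn))) (ha n)
    _ = Real.exp 2 * ∑ j ∈ Finset.range M, ((2 : ℝ) ^ j) ^ (-β) *
          ∑ n ∈ s, a n * Real.exp (-(n * ((2 : ℝ) ^ j)⁻¹)) := by
        simp only [Finset.mul_sum]
        rw [Finset.sum_comm]
        refine Finset.sum_congr rfl fun j _ => Finset.sum_congr rfl fun n _ => by ring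
    _ ≤ Real.exp 2 * ∑ j ∈ Finset.range M, C * r ^ j := by
        refine mul_le_mul_of_nonneg_left (Finset.sum_le_sum fun j _ => ?_) (Real.exp_pos 2).le
        refine (mul_le_mul_of_nonneg_left (h _ (by positivity) s) (by positivity)).trans_eq ?_
        have h2 : ((2 : ℝ) ^ j) ^ (-β) * ((2 : ℝ) ^ j) ^ κ = r ^ j := by
          rw [← Real.rpow_add (by positivity), ← Real.rpow_natCast r, ← Real.rpow_natCast 2,
            ← Real.rpow_mul (by norm_num), ← Real.rpow_mul (by norm_num)]
          ring_nf
        rw [Real.rpow_neg (by positivity) κ, Real.inv_rpow (by positivity), inv_inv, ← h2]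
        ring
    _ ≤ _ := by
        rw [← Finset.mul_sum]
        exact mul_le_mul_of_nonneg_left (mul_le_mul_of_nonneg_left
          (hg.sum_le_tsum _ fun j _ => by positivity) hC) (Real.exp_pos 2).le

theorem summable_norm_mul_rpow_of_sq {c : ℕ → ℂ} {κ τ : ℝ} (hτ : (κ + 1) / 2 < τ)
    (h : ∀ β, κ < β → Summable fun n : ℕ => ‖c n‖ ^ 2 * (n : ℝ) ^ (-β)) :
    Summable fun n : ℕ => ‖c n‖ * (n : ℝ) ^ (-τ) := by
  -- Any `β` between `κ` and `2τ - 1` would do: then `2τ - β > 1`, and `|c| n^{-τ}` is at most the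
  -- sum of `|c|² n^{-β}` and `n^{-(2τ-β)}`. The term at `n = 0` is absorbed by a summand supported
  -- there.
  set β : ℝ := (κ + (2 * τ - 1)) / 2 with hβ
  have h1 := h β (by linarith)
  have h2 : Summable fun n : ℕ => (n : ℝ) ^ (-(2 * τ - β)) :=
    Real.summable_nat_rpow.mpr (by linarith)
  refine Summable.of_nonneg_of_le (fun n => by positivity) (fun n => ?_) ((h1.add h2).add
    (summable_of_ne_finset_zero (f := fun n : ℕ => if n = 0 then ‖c 0‖ * (0 : ℝ) ^ (-τ) else 0) (s := {0}) ?_))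
  · rcases Nat.eq_zero_or_pos n with rfl | hn
    · rw [if_pos rfl, Nat.cast_zero]
      have : 0 ≤ ‖c 0‖ ^ 2 * (0 : ℝ) ^ (-β) + (0 : ℝ) ^ (-(2 * τ - β)) := by positivity
      linarith
    · rw [if_neg hn.ne', add_zero]
      have hn' : (0 : ℝ) < n := by exact_mod_cast hn
      have e1 : (n : ℝ) ^ (-β) = ((n : ℝ) ^ (-β / 2)) ^ 2 := by
        rw [← Real.rpow_natCast, ← Real.rpow_mul hn'.le]; congr 1; push_cast; ring
      have e2 : (n : ℝ) ^ (-(2 * τ - β)) = ((n : ℝ) ^ (-(2 * τ - β) / 2)) ^ 2 := by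
        rw [← Real.rpow_natCast, ← Real.rpow_mul hn'.le]; congr 1; push_cast; ring
      have e3 : (n : ℝ) ^ (-τ) = (n : ℝ) ^ (-β / 2) * (n : ℝ) ^ (-(2 * τ - β) / 2) := by
        rw [← Real.rpow_add hn']; congr 1; ring
      rw [e1, e2, e3]
      have p1 : 0 ≤ ‖c n‖ * (n : ℝ) ^ (-β / 2) := by positivity
      have p2 : 0 ≤ (n : ℝ) ^ (-(2 * τ - β) / 2) := by positivity
      nlinarith [sq_nonneg (‖c n‖ * (n : ℝ) ^ (-β / 2) - (n : ℝ) ^ (-(2 * τ - β) / 2)),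
        mul_nonneg p1 p2]
  · intro n hn
    rw [if_neg (by simpa using hn)]

section Parseval

variable {N k : ℕ} [NeZero N]
    (f : CuspForm ((CongruenceSubgroup.Gamma1 N : Subgroup SL(2, ℤ)) : Subgroup (GL (Fin 2) ℝ)) k)

/-- Parseval on a horizontal segment of height `t`, with `|f(x+it)| ≤ C t^{-k/2}`. The choice `t =
y/(4π)` makes the squared factor `e^{-2πnt}` equal to `e^{-ny}` after squaring once. -/
theorem exists_sum_sq_fourierCoefficient_le : ∃ C : ℝ, 0 ≤ C ∧ ∀ y : ℝ, 0 < y → ∀ s : Finset ℕ,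
    ∑ n ∈ s, ‖fourierCoefficient f n‖ ^ 2 * Real.exp (-(n * y)) ≤ C * y ^ (-(k : ℝ)) := by
  obtain ⟨C, hC⟩ := CuspFormClass.exists_bound f
  refine ⟨C ^ 2 * (4 * Real.pi) ^ (k : ℝ), by positivity, fun y hy s => ?_⟩
  set t : ℝ := y / (4 * Real.pi) with ht
  have ht0 : 0 < t := by positivity
  let F : ℝ → ℂ := fun x => f ⟨(x : ℂ) + t * Complex.I, by simpa using ht0⟩
  have hFc : Continuous F := by
    refine (CuspFormClass.holo f).continuous.comp ?_
    rw [UpperHalfPlane.isEmbedding_coe.continuous_iff]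
    exact (by fun_prop : Continuous fun x : ℝ => (x : ℂ) + t * Complex.I)
  have hFb : ∀ x, ‖F x‖ ≤ C / t ^ ((k : ℝ) / 2) := fun x => by
    have := hC ⟨(x : ℂ) + t * Complex.I, by simpa using ht0⟩
    simpa [← UpperHalfPlane.coe_im] using this
  have hcoef : ∀ n : ℕ, fourierCoeffOn zero_lt_one F n =
      fourierCoefficient f n * Real.exp (-(2 * Real.pi * n * t)) := by
    intro n
    rw [fourierCoeffOn_eq_integral, fourierCoefficient,
      ModularFormClass.qExpansion_coeff_eq_intervalIntegral (t := t) f one_pos (by simp) n ht0]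
    simp only [sub_zero, ne_eq, one_ne_zero, not_false_eq_true, div_self, one_smul, ofReal_one, one_mul]
    rw [← intervalIntegral.integral_mul_const]
    refine intervalIntegral.integral_congr fun x _ => ?_
    have hq : fourier (-(n : ℤ)) ((x : ℝ) : AddCircle ((1 : ℝ) - 0)) =
        1 / Function.Periodic.qParam 1 ((x : ℂ) + t * Complex.I) ^ n *
          (Real.exp (-(2 * Real.pi * n * t)) : ℂ) := by
      rw [fourier_coe_apply, Function.Periodic.qParam, ← Complex.exp_nat_mul, one_div,
        ← Complex.exp_neg, ofReal_exp, ← Complex.exp_add]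
      congr 1
      push_cast
      simp only [sub_zero, div_one]
      linear_combination (2 * Real.pi * n * t : ℂ) * Complex.I_mul_I
    simp only [smul_eq_mul]
    rw [hq]
    ring
  have hmem : MemLp F 2 (volume.restrict (Ioc (0 : ℝ) 1)) :=
    MemLp.of_bound hFc.aestronglyMeasurable _ (ae_of_all _ hFb)
  have hP := hasSum_sq_fourierCoeffOn zero_lt_one hmem
  have hint : (1 - (0 : ℝ))⁻¹ • ∫ x in (0 : ℝ)..1, ‖F x‖ ^ 2 ≤ (C / t ^ ((k : ℝ) / 2)) ^ 2 := by
    have : ∫ x in (0 : ℝ)..1, ‖F x‖ ^ 2 ≤ ∫ x in (0 : ℝ)..1, (C / t ^ ((k : ℝ) / 2)) ^ 2 := by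
      refine intervalIntegral.integral_mono_on zero_le_one ?_ ?_ fun x _ => ?_
      · exact (by fun_prop : Continuous fun x => ‖F x‖ ^ 2).intervalIntegrable _ _
      · exact continuous_const.intervalIntegrable _ _
      · exact pow_le_pow_left₀ (norm_nonneg _) (hFb x) 2
    simpa using this
  have hle : ∑ n ∈ s, ‖fourierCoeffOn zero_lt_one F (n : ℤ)‖ ^ 2 ≤
      (1 - (0 : ℝ))⁻¹ • ∫ x in (0 : ℝ)..1, ‖F x‖ ^ 2 := by
    have := sum_le_hasSum (s.map ⟨((↑) : ℕ → ℤ), Nat.cast_injective⟩) (fun i _ => by positivity) hP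
    simpa using this
  have hR : (C / t ^ ((k : ℝ) / 2)) ^ 2 = C ^ 2 * (4 * Real.pi) ^ (k : ℝ) * y ^ (-(k : ℝ)) := by
    have : (t ^ ((k : ℝ) / 2)) ^ 2 = t ^ (k : ℝ) := by
      rw [← Real.rpow_natCast, ← Real.rpow_mul ht0.le]; congr 1; push_cast; ring
    rw [div_pow, this, ht, Real.div_rpow hy.le (by positivity), Real.rpow_neg hy.le]
    field_simp
  rw [← hR]
  refine (Eq.le ?_).trans (hle.trans hint)
  refine Finset.sum_congr rfl fun n _ => ?_
  rw [hcoef, norm_mul, mul_pow, Complex.norm_real, Real.norm_eq_abs, Real.abs_exp, ← Real.exp_nat_mul]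
  congr 2
  rw [ht]; push_cast; field_simp; ring

theorem summable_norm_fourierCoefficient_mul_rpow {τ : ℝ} (hτ : ((k : ℝ) + 1) / 2 < τ) :
    Summable fun n : ℕ => ‖fourierCoefficient f n‖ * (n : ℝ) ^ (-τ) := by
  obtain ⟨C, hC, h⟩ := exists_sum_sq_fourierCoefficient_le f
  exact summable_norm_mul_rpow_of_sq hτ fun β hβ =>
    summable_mul_rpow_of_sum_mul_exp_le (fun n => by positivity) hC hβ
      (lt_of_le_of_lt (Nat.cast_nonneg k) hβ) h

end Parseval

/-! ### Voronoi summation for the test functions `(x - ·)_+`. -/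

theorem eq_zero_of_forall_integral_cexp_mul_eq_zero {h : ℝ → ℂ} (hc : Continuous h)
    (hi : Integrable h) (h0 : ∀ ξ : ℝ, ∫ x : ℝ, Complex.exp (-(2 * Real.pi * ξ * Complex.I * x)) * h x = 0) :
    h = 0 := by
  have hF : FourierTransform.fourier h = (0 : ℝ → ℂ) := by
    ext ξ
    rw [Real.fourier_real_eq_integral_exp_smul]
    refine Eq.trans (integral_congr_ae (ae_of_all _ fun x => ?_)) (h0 ξ)
    simp only [smul_eq_mul]
    congr 2
    push_cast
    ring
  have := hc.fourierInv_fourier_eq hi (by rw [hF]; exact integrable_zero _ _ _)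
  rw [← this, hF]
  ext x
  simp [Real.fourierInv_eq]

theorem rpow_le_mul_exp_half {β x : ℝ} (hβ : 0 < β) (hx : 0 ≤ x) :
    x ^ β ≤ (2 * β) ^ β * Real.exp (x / 2) := by
  have h1 : x ≤ 2 * β * Real.exp (x / (2 * β)) := by
    have := Real.add_one_le_exp (x / (2 * β))
    calc x = 2 * β * (x / (2 * β)) := by field_simp
      _ ≤ _ := mul_le_mul_of_nonneg_left (by linarith) (by positivity)
  calc x ^ β ≤ (2 * β * Real.exp (x / (2 * β))) ^ β := Real.rpow_le_rpow hx h1 hβ.le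
    _ = (2 * β) ^ β * Real.exp (x / 2) := by
      rw [Real.mul_rpow (by positivity) (by positivity), ← Real.exp_mul]
      congr 2
      field_simp

theorem integral_max_sub_mul_cexp {y : ℝ} (hy : 0 ≤ y) {p : ℂ} (hp : 0 < p.re) :
    ∫ x in Ioi (0 : ℝ), ((max (x - y) 0 : ℝ) : ℂ) * Complex.exp (-(p * x)) =
      Complex.exp (-(y * p)) / p ^ 2 := by
  have h1 : ∫ x in Ioi (0 : ℝ), ((max (x - y) 0 : ℝ) : ℂ) * Complex.exp (-(p * x)) =
      ∫ x in Ioi y, ((max (x - y) 0 : ℝ) : ℂ) * Complex.exp (-(p * x)) := by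
    refine setIntegral_eq_of_subset_of_forall_sdiff_eq_zero measurableSet_Ioi
      (Ioi_subset_Ioi hy) fun x hx => ?_
    have : x ≤ y := not_lt.mp hx.2
    rw [max_eq_right (by linarith)]
    simp
  have h2 := integral_pow_mul_cexp_neg_mul 1 hp
  have h3 : ∫ x in Ioi y, ((max (x - y) 0 : ℝ) : ℂ) * Complex.exp (-(p * x)) =
      ∫ x in Ioi (0 : ℝ), (((max (x + y - y) 0 : ℝ)) : ℂ) * Complex.exp (-(p * ((x + y : ℝ) : ℂ))) := by
    have := (measurePreserving_add_right volume y).setIntegral_preimage_emb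
      (measurableEmbedding_addRight y)
      (fun x : ℝ => ((max (x - y) 0 : ℝ) : ℂ) * Complex.exp (-(p * x))) (Ioi y)
    rw [preimage_add_const_Ioi, sub_self] at this
    exact this.symm
  rw [h1, h3]
  have h4 : ∫ x in Ioi (0 : ℝ), (((max (x + y - y) 0 : ℝ)) : ℂ) * Complex.exp (-(p * ((x + y : ℝ) : ℂ)))
      = ∫ x in Ioi (0 : ℝ), Complex.exp (-(y * p)) * ((x : ℂ) ^ 1 * Complex.exp (-(p * x))) := by
    refine setIntegral_congr_fun measurableSet_Ioi fun x hx => ?_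
    have hx0 : (0 : ℝ) < x := hx
    simp only [add_sub_cancel_right, max_eq_left hx0.le]
    rw [mul_left_comm, ← Complex.exp_add, pow_one]
    congr 2
    push_cast; ring
  rw [h4, integral_const_mul, h2]
  simp [div_eq_mul_inv]

/-- Coefficient sequences `c`, `d` whose exponential series are exchanged by `p ↦ 1 / p` with
weight `ν + 1`, with `c` bounded on average as for cusp forms of that weight. -/
structure FrickePair (ν : ℕ) (L : ℝ) (C : ℂ) (c d : ℕ → ℂ) : Prop where
  pos : 0 < L
  left_zero : c 0 = 0
  right_zero : d 0 = 0
  summable_left : ∀ τ : ℝ, ((ν : ℝ) + 2) / 2 < τ → Summable fun n : ℕ => ‖c n‖ * (n : ℝ) ^ (-τ)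
  summable_right : ∀ y : ℝ, 0 < y → Summable fun n : ℕ => ‖d n‖ * Real.exp (-(n * y))
  transform : ∀ p : ℂ, 0 < p.re → ∑' n : ℕ, d n * Complex.exp (-(L * n * p)) =
    C / p ^ (ν + 1) * ∑' n : ℕ, c n * Complex.exp (-(2 * Real.pi * n / p))

/-- The kernel of the Voronoi summation formula for the test functions `(x - ·)₊`. -/
def voronoiKernel (ν n : ℕ) (x : ℝ) : ℝ :=
  besselB (ν + 2) (2 * Real.pi * n * x) / (2 * Real.pi * n) ^ (ν + 2)

/-- The exponent of `n` lies beyond the threshold `(ν+2)/2` in `FrickePair.summable_left`, so the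
dual series converges absolutely. -/
theorem exists_abs_voronoiKernel_le (ν : ℕ) : ∃ K : ℝ, 0 ≤ K ∧ ∀ n : ℕ, 1 ≤ n → ∀ x : ℝ, 0 < x →
    |voronoiKernel ν n x| ≤
      K * (n : ℝ) ^ (-(((ν : ℝ) + 2) / 2 + 1 / 8)) * x ^ (((ν : ℝ) + 2) / 2 - 1 / 8) := by
  obtain ⟨K, hK, hb⟩ := exists_abs_besselB_le ν
  refine ⟨K * (2 * Real.pi) ^ (-(((ν : ℝ) + 2) / 2 + 1 / 8)), by positivity, fun n hn x hx => ?_⟩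
  have hn0 : (0 : ℝ) < n := by exact_mod_cast hn
  have ha : 0 < 2 * Real.pi * n := by positivity
  rw [voronoiKernel, abs_div, abs_of_pos (pow_pos ha _), div_le_iff₀ (pow_pos ha _)]
  refine (hb _ (by positivity)).trans_eq ?_
  rw [Real.mul_rpow ha.le hx.le]
  have : (2 * Real.pi * n) ^ (((ν : ℝ) + 2) / 2 - 1 / 8) =
      (2 * Real.pi) ^ (-(((ν : ℝ) + 2) / 2 + 1 / 8)) * (n : ℝ) ^ (-(((ν : ℝ) + 2) / 2 + 1 / 8)) *
        (2 * Real.pi * n) ^ (ν + 2) := by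
    rw [← Real.mul_rpow (by positivity) hn0.le, ← Real.rpow_natCast, ← Real.rpow_add ha]
    congr 1
    push_cast
    ring
  rw [this]
  ring

theorem integral_voronoiKernel_mul_cexp (ν : ℕ) {n : ℕ} (hn : 1 ≤ n) {p : ℂ} (hp : 0 < p.re) :
    ∫ x in Ioi (0 : ℝ), ((voronoiKernel ν n x : ℝ) : ℂ) * Complex.exp (-(p * x)) =
      Complex.exp (-(2 * Real.pi * n / p)) / p ^ (ν + 3) := by
  have hn0 : (0 : ℝ) < n := by exact_mod_cast hn
  have ha : 0 < 2 * Real.pi * n := by positivity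
  have h := (integrable_and_hasSum_laplace_besselB (ν + 2) hp ha.le).2
  have ha' : ((2 * Real.pi * n : ℝ) : ℂ) ^ (ν + 2) ≠ 0 := pow_ne_zero _ (by exact_mod_cast ha.ne')
  calc _ = ∫ x in Ioi (0 : ℝ), (((2 * Real.pi * n : ℝ) : ℂ) ^ (ν + 2))⁻¹ *
        (((besselB (ν + 2) (2 * Real.pi * n * x) : ℝ) : ℂ) * Complex.exp (-(p * x))) := by
        refine integral_congr_ae (ae_of_all _ fun x => ?_)
        simp only [voronoiKernel, ofReal_div, ofReal_pow]
        field_simp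
    _ = _ := by
        rw [integral_const_mul, h]
        push_cast at ha' ⊢
        field_simp

namespace FrickePair

variable {ν : ℕ} {L : ℝ} {C : ℂ} {c d : ℕ → ℂ} (H : FrickePair ν L C c d)
include H

theorem summable_left_mul_exp {y : ℝ} (hy : 0 < y) :
    Summable fun n : ℕ => ‖c n‖ * Real.exp (-(n * y)) := by
  set τ : ℝ := ((ν : ℝ) + 2) / 2 + 1
  have hτ : 0 < τ := by positivity
  refine Summable.of_nonneg_of_le (fun n => by positivity) (fun n => ?_)
    ((H.summable_left τ (by simp [τ])).mul_left ((2 * τ) ^ τ * y ^ (-τ)))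
  rcases Nat.eq_zero_or_pos n with rfl | hn
  · simp [H.left_zero]
  have hn0 : (0 : ℝ) < n := by exact_mod_cast hn
  have h1 := rpow_le_mul_exp_half hτ (x := n * y) (by positivity)
  have h2 : Real.exp (n * y / 2) ≤ Real.exp (n * y) :=
    Real.exp_le_exp.mpr (by linarith [mul_pos hn0 hy])
  have h3 : Real.exp (-(n * y)) ≤ (2 * τ) ^ τ * (n * y) ^ (-τ) := by
    rw [Real.exp_neg, Real.rpow_neg (by positivity), ← div_eq_mul_inv, le_div_iff₀ (by positivity),
      inv_mul_le_iff₀ (by positivity), mul_comm (Real.exp _)]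
    exact h1.trans (mul_le_mul_of_nonneg_left h2 (by positivity))
  calc ‖c n‖ * Real.exp (-(n * y)) ≤ ‖c n‖ * ((2 * τ) ^ τ * (n * y) ^ (-τ)) :=
        mul_le_mul_of_nonneg_left h3 (norm_nonneg _)
    _ = _ := by rw [Real.mul_rpow hn0.le hy.le]; ring

theorem summable_right_mul_max_sub {x : ℝ} (hx : 0 < x) :
    Summable fun n : ℕ => d n * ((max (x - L * n) 0 : ℝ) : ℂ) := by
  have hL := H.pos
  refine Summable.of_norm_bounded ((H.summable_right (L / 2) (by positivity)).mul_left
    (x * Real.exp (x / 2))) fun n => ?_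
  rcases Nat.eq_zero_or_pos n with rfl | hn
  · simp [H.right_zero]
  have hn0 : (0 : ℝ) < n := by exact_mod_cast hn
  have b1 := max_sub_zero_le le_rfl hx (mul_pos hL hn0)
  rw [zero_add, neg_zero, Real.rpow_zero, one_mul, Real.rpow_one] at b1
  rw [norm_mul, Complex.norm_real, Real.norm_eq_abs, abs_of_nonneg (le_max_right _ _)]
  refine (mul_le_mul_of_nonneg_left b1 (norm_nonneg _)).trans_eq ?_
  rw [show L * n / 2 = n * (L / 2) by ring]
  ring

theorem summable_left_mul_voronoiKernel {x : ℝ} (hx : 0 < x) :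
    Summable fun n : ℕ => c n * ((voronoiKernel ν n x : ℝ) : ℂ) := by
  obtain ⟨K, hK, hb⟩ := exists_abs_voronoiKernel_le ν
  refine Summable.of_norm_bounded ((H.summable_left (((ν : ℝ) + 2) / 2 + 1 / 8) (by linarith)).mul_left
    (K * x ^ (((ν : ℝ) + 2) / 2 - 1 / 8))) fun n => ?_
  rcases Nat.eq_zero_or_pos n with rfl | hn
  · simp [H.left_zero]
  rw [norm_mul, Complex.norm_real, Real.norm_eq_abs]
  refine (mul_le_mul_of_nonneg_left (hb n hn x hx) (norm_nonneg _)).trans_eq ?_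
  ring

/-- The two sides have Laplace transforms `p^{-2} ∑ d(n) e^{-Lnp}` and `C p^{-ν-3} ∑ c(n)
e^{-2πn/p}`, equal by `transform`. Both are continuous in `x`, so uniqueness of the Fourier
transform on the line `Re p = 1` gives pointwise equality. -/
theorem tsum_max_sub {x : ℝ} (hx : 0 < x) :
    ∑' n : ℕ, d n * ((max (x - L * n) 0 : ℝ) : ℂ) =
      C * ∑' n : ℕ, c n * ((voronoiKernel ν n x : ℝ) : ℂ) := by
  obtain ⟨K, hK, hb⟩ := exists_abs_voronoiKernel_le ν
  have hL := H.pos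
  set τ : ℝ := ((ν : ℝ) + 2) / 2 + 1 / 8 with hτ
  set β : ℝ := ((ν : ℝ) + 2) / 2 - 1 / 8 with hβ
  have hβ0 : 0 < β := by rw [hβ]; linarith [(Nat.cast_nonneg ν : (0 : ℝ) ≤ ν)]
  -- The difference of the `n`-th terms, damped by `e^{-x}` and equal to `0` for `x ≤ 0`. The bound
  -- `w n * G x` below serves for uniform convergence and for integrability at once.
  let F : ℕ → ℝ → ℂ := fun n x => (d n * ((max (x - L * n) 0 : ℝ) : ℂ) -
    C * (c n * ((voronoiKernel ν n (max x 0) : ℝ) : ℂ))) * ((Real.exp (-x) : ℝ) : ℂ)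
  let G : ℝ → ℝ := (Ioi (0 : ℝ)).indicator fun x =>
    x ^ (1 : ℝ) * Real.exp (-(1 / 2 * x)) + x ^ β * Real.exp (-(1 / 2 * x))
  let w : ℕ → ℝ := fun n => ‖d n‖ * Real.exp (-(n * (L / 2))) + ‖C‖ * K * (‖c n‖ * (n : ℝ) ^ (-τ))
  have hw : Summable w := (H.summable_right _ (by positivity)).add
    ((H.summable_left τ (by rw [hτ]; linarith)).mul_left _)
  have hw0 : ∀ n, 0 ≤ w n := fun n => by positivity
  have hGi : Integrable G := by
    refine (integrable_indicator_iff measurableSet_Ioi).mpr (Integrable.add ?_ ?_)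
    · exact integrableOn_rpow_mul_exp_neg_mul (by norm_num) (by norm_num)
    · exact integrableOn_rpow_mul_exp_neg_mul (by linarith) (by norm_num)
  have hGb : ∀ x, G x ≤ (2 * 1) ^ (1 : ℝ) + (2 * β) ^ β := by
    intro x
    by_cases hx : 0 < x
    · rw [show G x = _ from indicator_of_mem (mem_Ioi.mpr hx) _]
      have e : ∀ γ : ℝ, 0 < γ → x ^ γ * Real.exp (-(1 / 2 * x)) ≤ (2 * γ) ^ γ := by
        intro γ hγ
        rw [Real.exp_neg, ← div_eq_mul_inv, div_le_iff₀ (Real.exp_pos _)]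
        refine (rpow_le_mul_exp_half hγ hx.le).trans_eq ?_
        congr 2
        ring
      exact add_le_add (e 1 one_pos) (e β hβ0)
    · rw [show G x = _ from indicator_of_notMem (by simpa using hx) _]
      positivity
  have hF0 : ∀ n x, x ≤ 0 → F n x = 0 := by
    intro n x hx
    have h1 : max (x - L * n) 0 = 0 := max_eq_right (by
      have : 0 ≤ L * n := by positivity
      linarith)
    have h2 : voronoiKernel ν n (max x 0) = 0 := by
      rw [max_eq_right hx, voronoiKernel, mul_zero, besselB_succ_zero, zero_div]
    simp only [F, h1, h2]
    simp
  have hFb : ∀ n x, ‖F n x‖ ≤ w n * G x := by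
    intro n x
    by_cases hx : 0 < x
    swap
    · rw [hF0 n x (not_lt.mp hx), norm_zero, show G x = 0 from indicator_of_notMem (by simpa using hx) _,
        mul_zero]
    rcases Nat.eq_zero_or_pos n with rfl | hn
    · have : F 0 x = 0 := by simp only [F, H.left_zero, H.right_zero]; simp
      rw [this, norm_zero]
      refine mul_nonneg (hw0 _) (indicator_nonneg (fun y hy => ?_) _)
      have : (0 : ℝ) < y := hy
      positivity
    have hn0 : (0 : ℝ) < n := by exact_mod_cast hn
    rw [show G x = _ from indicator_of_mem (mem_Ioi.mpr hx) _]
    have b1 := max_sub_zero_le le_rfl hx (mul_pos hL hn0)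
    have b2 := hb n hn x hx
    rw [zero_add, neg_zero, Real.rpow_zero, one_mul] at b1
    have hex : Real.exp (-x) = Real.exp (-(1 / 2 * x)) * Real.exp (-(1 / 2 * x)) := by
      rw [← Real.exp_add]; ring_nf
    have hex2 : Real.exp (x / 2) * Real.exp (-(1 / 2 * x)) = 1 := by
      rw [← Real.exp_add]; simp; ring
    have hex3 : Real.exp (-(1 / 2 * x)) ≤ 1 := Real.exp_le_one_iff.mpr (by linarith)
    set E := Real.exp (-(1 / 2 * x)) with hE
    have hE0 : 0 < E := Real.exp_pos _
    have t1 : max (x - L * n) 0 * Real.exp (-x) ≤ Real.exp (-(n * (L / 2))) * (x ^ (1 : ℝ) * E) := by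
      calc max (x - L * n) 0 * Real.exp (-x)
          ≤ (x ^ (1 : ℝ) * Real.exp (x / 2) * Real.exp (-(L * n / 2))) * (E * E) := by
            rw [hex]; exact mul_le_mul_of_nonneg_right b1 (by positivity)
        _ = (Real.exp (x / 2) * E) * (Real.exp (-(L * n / 2)) * (x ^ (1 : ℝ) * E)) := by ring
        _ = _ := by rw [hex2, one_mul]; congr 3; ring
    have t2 : |voronoiKernel ν n x| * Real.exp (-x) ≤ K * (n : ℝ) ^ (-τ) * (x ^ β * E) := by
      calc |voronoiKernel ν n x| * Real.exp (-x)
          ≤ (K * (n : ℝ) ^ (-τ) * x ^ β) * (E * E) := by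
            rw [hex]; exact mul_le_mul_of_nonneg_right b2 (by positivity)
        _ = K * (n : ℝ) ^ (-τ) * (x ^ β * E) * E := by ring
        _ ≤ K * (n : ℝ) ^ (-τ) * (x ^ β * E) * 1 := mul_le_mul_of_nonneg_left hex3 (by positivity)
        _ = _ := mul_one _
    have hm0 : 0 ≤ max (x - L * n) 0 := le_max_right _ _
    calc ‖F n x‖ ≤ (‖d n‖ * max (x - L * n) 0 + ‖C‖ * (‖c n‖ * |voronoiKernel ν n x|)) *
          Real.exp (-x) := by
          simp only [F, max_eq_left hx.le]
          rw [norm_mul, Complex.norm_real, Real.norm_eq_abs, Real.abs_exp]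
          refine mul_le_mul_of_nonneg_right ((norm_sub_le _ _).trans_eq ?_) (Real.exp_pos _).le
          simp only [norm_mul, Complex.norm_real, Real.norm_eq_abs, abs_of_nonneg hm0]
      _ = ‖d n‖ * (max (x - L * n) 0 * Real.exp (-x)) +
          ‖C‖ * ‖c n‖ * (|voronoiKernel ν n x| * Real.exp (-x)) := by ring
      _ ≤ ‖d n‖ * (Real.exp (-(n * (L / 2))) * (x ^ (1 : ℝ) * E)) +
          ‖C‖ * ‖c n‖ * (K * (n : ℝ) ^ (-τ) * (x ^ β * E)) :=
          add_le_add (mul_le_mul_of_nonneg_left t1 (norm_nonneg _))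
            (mul_le_mul_of_nonneg_left t2 (by positivity))
      _ = ‖d n‖ * Real.exp (-(n * (L / 2))) * (x ^ (1 : ℝ) * E) +
          ‖C‖ * K * (‖c n‖ * (n : ℝ) ^ (-τ)) * (x ^ β * E) := by ring
      _ ≤ w n * (x ^ (1 : ℝ) * E + x ^ β * E) := by
          have p1 : 0 ≤ ‖d n‖ * Real.exp (-(n * (L / 2))) := by positivity
          have p2 : 0 ≤ ‖C‖ * K * (‖c n‖ * (n : ℝ) ^ (-τ)) := by positivity
          have p3 : 0 ≤ x ^ (1 : ℝ) * E := by positivity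
          have p4 : 0 ≤ x ^ β * E := by positivity
          simp only [w]
          nlinarith [mul_nonneg p1 p4, mul_nonneg p2 p3]
  have hFc : ∀ n, Continuous (F n) := by
    intro n
    have h1 : Continuous fun x : ℝ => voronoiKernel ν n (max x 0) :=
      ((continuous_besselB (ν + 2)).comp (by fun_prop)).div_const _
    have h2 : Continuous fun x : ℝ => max (x - L * n) 0 := by fun_prop
    simp only [F]
    fun_prop
  have hFi : ∀ n, Integrable (F n) := fun n =>
    (hGi.const_mul (w n)).mono' (hFc n).aestronglyMeasurable (ae_of_all _ (hFb n))
  have hsum : ∀ x, Summable fun n => F n x := fun x =>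
    Summable.of_norm_bounded (hw.mul_right (G x)) fun n => hFb n x
  have hcont : Continuous fun x => ∑' n, F n x :=
    continuous_tsum hFc (hw.mul_right ((2 * 1) ^ (1 : ℝ) + (2 * β) ^ β)) fun n x =>
      (hFb n x).trans (mul_le_mul_of_nonneg_left (hGb x) (hw0 n))
  have hnorm : Summable fun n => ∫ x, ‖F n x‖ :=
    Summable.of_nonneg_of_le (fun n => integral_nonneg fun x => norm_nonneg _)
      (fun n => (integral_mono (hFi n).norm (hGi.const_mul (w n)) (hFb n)).trans_eq
        (integral_const_mul _ _)) (hw.mul_right (∫ x, G x))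
  have hint : Integrable fun x => ∑' n, F n x := integrable_tsum_of_summable_integral_norm hFi hnorm
  have hzero : (fun x => ∑' n, F n x) = 0 := by
    refine eq_zero_of_forall_integral_cexp_mul_eq_zero hcont hint fun ξ => ?_
    -- The damping `e^{-x}` combines with the Fourier character to `e^{-px}` on the line `Re p = 1`.
    set p : ℂ := 1 + 2 * Real.pi * ξ * Complex.I with hp
    have hpre : p.re = 1 := by simp [hp]
    have hp0 : p ≠ 0 := fun h => by simp [h] at hpre
    have hp1 : 0 < p.re := by rw [hpre]; exact one_pos
    have hen : ∀ x : ℝ, ‖Complex.exp (-(2 * Real.pi * ξ * Complex.I * x))‖ = 1 := fun x => by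
      rw [Complex.norm_exp]; simp
    have hec : Continuous fun x : ℝ => Complex.exp (-(2 * Real.pi * ξ * Complex.I * x)) := by fun_prop
    have hEi : ∀ n, Integrable fun x : ℝ => Complex.exp (-(2 * Real.pi * ξ * Complex.I * x)) * F n x :=
      fun n => (hFi n).norm.mono' (hec.mul (hFc n)).aestronglyMeasurable
        (ae_of_all _ fun x => by rw [norm_mul, hen, one_mul])
    have hS := hasSum_integral_of_summable_integral_norm hEi
      (by simpa only [norm_mul, hen, one_mul] using hnorm)
    simp only [tsum_mul_left] at hS
    have hterm : ∀ n, ∫ x : ℝ, Complex.exp (-(2 * Real.pi * ξ * Complex.I * x)) * F n x =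
        d n * Complex.exp (-(L * n * p)) / p ^ 2 -
          C * (c n * Complex.exp (-(2 * Real.pi * n / p))) / p ^ (ν + 3) := by
      intro n
      rcases Nat.eq_zero_or_pos n with rfl | hn
      · simp only [F, H.left_zero, H.right_zero]; simp
      have i1 := integral_max_sub_mul_cexp (y := L * n) (by positivity) hp1
      have i2 := integral_voronoiKernel_mul_cexp ν hn hp1
      have hn0 : (0 : ℝ) < n := by exact_mod_cast hn
      have ha : 0 < 2 * Real.pi * n := by positivity
      have j1 : IntegrableOn (fun x : ℝ => ((max (x - L * n) 0 : ℝ) : ℂ) * Complex.exp (-(p * x)))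
          (Ioi 0) := by
        refine (integrableOn_pow_mul_cexp_neg_mul 1 hp1).norm.mono' (by fun_prop) ?_
        filter_upwards [ae_restrict_mem measurableSet_Ioi] with x hx
        have hx0 : (0 : ℝ) < x := hx
        rw [norm_mul, norm_mul, Complex.norm_real, Real.norm_eq_abs, pow_one, Complex.norm_real,
          Real.norm_eq_abs, abs_of_pos hx0, abs_of_nonneg (le_max_right _ _)]
        refine mul_le_mul_of_nonneg_right (max_le ?_ hx0.le) (norm_nonneg _)
        linarith [mul_pos hL hn0]
      have j2 : IntegrableOn (fun x : ℝ => ((voronoiKernel ν n x : ℝ) : ℂ) * Complex.exp (-(p * x)))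
          (Ioi 0) := by
        refine ((integrable_and_hasSum_laplace_besselB (ν + 2) hp1 ha.le).1.div_const
          (((2 * Real.pi * n : ℝ) : ℂ) ^ (ν + 2))).congr (ae_of_all _ fun x => ?_)
        simp only [voronoiKernel, ofReal_div, ofReal_pow]
        ring
      rw [← setIntegral_eq_integral_of_forall_compl_eq_zero (s := Ioi 0) fun x hx => by
        rw [hF0 n x (by simpa using hx), mul_zero]]
      calc _ = ∫ x in Ioi (0 : ℝ), (d n * (((max (x - L * n) 0 : ℝ) : ℂ) * Complex.exp (-(p * x))) -
            C * c n * (((voronoiKernel ν n x : ℝ) : ℂ) * Complex.exp (-(p * x)))) := by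
            refine setIntegral_congr_fun measurableSet_Ioi fun x hx => ?_
            have hx0 : (0 : ℝ) < x := hx
            have he : Complex.exp (-(p * x)) = Complex.exp (-(2 * Real.pi * ξ * Complex.I * x)) *
                ((Real.exp (-x) : ℝ) : ℂ) := by
              rw [ofReal_exp, ← Complex.exp_add, hp]
              congr 1
              push_cast
              ring
            simp only [F, max_eq_left hx0.le, he]
            ring
        _ = _ := by
            rw [integral_sub (j1.const_mul _) (j2.const_mul _), integral_const_mul,
              integral_const_mul, i1, i2]
            push_cast
            ring
    rw [← hS.tsum_eq]
    simp only [hterm]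
    have s1 : Summable fun n : ℕ => d n * Complex.exp (-(L * n * p)) := by
      refine Summable.of_norm_bounded (H.summable_right L hL) fun n => ?_
      rw [norm_mul, Complex.norm_exp]
      refine (mul_le_mul_of_nonneg_left (Real.exp_le_exp.mpr (Eq.le ?_)) (norm_nonneg _))
      simp [hp]; ring
    have s2 : Summable fun n : ℕ => c n * Complex.exp (-(2 * Real.pi * n / p)) := by
      have hpi : 0 < (p⁻¹).re := by
        rw [Complex.inv_re]; exact div_pos hp1 (Complex.normSq_pos.mpr hp0)
      refine Summable.of_norm_bounded (H.summable_left_mul_exp (y := 2 * Real.pi * (p⁻¹).re)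
        (by positivity)) fun n => ?_
      rw [norm_mul, Complex.norm_exp]
      refine (mul_le_mul_of_nonneg_left (Real.exp_le_exp.mpr (Eq.le ?_)) (norm_nonneg _))
      rw [div_eq_mul_inv, show (2 * Real.pi * n : ℂ) = ((2 * Real.pi * n : ℝ) : ℂ) by push_cast; rfl,
        Complex.neg_re, Complex.re_ofReal_mul]
      ring
    rw [(s1.div_const _).tsum_sub ((s2.mul_left C).div_const _), tsum_div_const, tsum_div_const,
      tsum_mul_left, H.transform p hp1]
    field_simp
    ring
  have hx0 := congrFun hzero x
  simp only [F, max_eq_left hx.le, tsum_mul_right, Pi.zero_apply] at hx0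
  have hx1 := (mul_eq_zero.mp hx0).resolve_right (by exact_mod_cast (Real.exp_pos (-x)).ne')
  rw [(H.summable_right_mul_max_sub hx).tsum_sub ((H.summable_left_mul_voronoiKernel hx).mul_left C),
    tsum_mul_left] at hx1
  exact sub_eq_zero.mp hx1

end FrickePair

/-! ### Voronoi summation for the Riesz weight. -/

/-- The transform of `rieszWeight` in the Voronoi summation formula. -/
def rieszTransform (ν : ℕ) (ρ X : ℝ) (n : ℕ) : ℝ :=
  ∫ x in Ioi (0 : ℝ), besselB ν (2 * Real.pi * n * x) / (2 * Real.pi * n) ^ ν * rieszWeight ν ρ X x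

theorem rieszTransform_eq (ν : ℕ) {ρ X : ℝ} (hρ : 1 < ρ) (hX : 0 < X) {n : ℕ} (hn : 1 ≤ n) :
    rieszTransform ν ρ X n =
      ∫ x in Ioi (0 : ℝ), voronoiKernel ν n x * rieszWeightDeriv2 ν ρ X x := by
  have hn0 : (0 : ℝ) < n := by exact_mod_cast hn
  have ha : 0 < 2 * Real.pi * n := by positivity
  have h := integral_besselB_mul_rieszWeight ν hρ hX ha
  rw [rieszTransform]
  calc _ = ((2 * Real.pi * n) ^ ν)⁻¹ * ∫ x in Ioi (0 : ℝ),
        besselB ν (2 * Real.pi * n * x) * rieszWeight ν ρ X x := by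
        rw [← integral_const_mul]
        refine integral_congr_ae (ae_of_all _ fun x => ?_)
        simp only
        ring
    _ = _ := by
        rw [h, ← integral_const_mul]
        refine integral_congr_ae (ae_of_all _ fun x => ?_)
        simp only [voronoiKernel]
        rw [pow_add]
        field_simp

namespace FrickePair

variable {ν : ℕ} {L : ℝ} {C : ℂ} {c d : ℕ → ℂ} (H : FrickePair ν L C c d) {ρ X : ℝ}
include H

/-- Termwise integration against `w''`, legitimate because the integrals of absolute values are
`O(n^{-τ})` with `τ = (ν+2)/2 + 1/8`, uniformly in `n`. -/
theorem hasSum_left_rieszTransform (hρ : 1 < ρ) (hX : 0 < X) :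
    (Summable fun n : ℕ => ‖c n‖ * |rieszTransform ν ρ X n|) ∧
    HasSum (fun n : ℕ => c n * (rieszTransform ν ρ X n : ℂ)) (∫ x in Ioi (0 : ℝ),
      (∑' n : ℕ, c n * ((voronoiKernel ν n x : ℝ) : ℂ)) * ((rieszWeightDeriv2 ν ρ X x : ℝ) : ℂ)) := by
  obtain ⟨K, hK, hb⟩ := exists_integral_abs_besselB_mul_rieszWeightDeriv2_le ν hρ hX
  set τ : ℝ := ((ν : ℝ) + 2) / 2 + 1 / 8 with hτ
  have hs := (H.summable_left τ (by rw [hτ]; linarith)).mul_left (K * (2 * Real.pi) ^ (-τ))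
  let F : ℕ → ℝ → ℂ := fun n x => c n *
    ((voronoiKernel ν n x * rieszWeightDeriv2 ν ρ X x : ℝ) : ℂ)
  have hFi : ∀ n, IntegrableOn (F n) (Ioi 0) := by
    intro n
    rcases Nat.eq_zero_or_pos n with rfl | hn
    · simp [F, H.left_zero]
    have hn0 : (0 : ℝ) < n := by exact_mod_cast hn
    exact ((hb (2 * Real.pi * n) (by positivity)).1.ofReal).const_mul _
  have hle : ∀ n, ∫ x in Ioi (0 : ℝ), ‖F n x‖ ≤ K * (2 * Real.pi) ^ (-τ) * (‖c n‖ * (n : ℝ) ^ (-τ)) := by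
    intro n
    rcases Nat.eq_zero_or_pos n with rfl | hn
    · simp [F, H.left_zero]
    have hn0 : (0 : ℝ) < n := by exact_mod_cast hn
    have := (hb (2 * Real.pi * n) (by positivity)).2
    simp only [F, norm_mul, Complex.norm_real, integral_const_mul]
    simp only [norm_mul] at this
    refine (mul_le_mul_of_nonneg_left this (norm_nonneg (c n))).trans_eq ?_
    rw [Real.mul_rpow (by positivity) hn0.le]
    ring
  have hsum : Summable fun n => ∫ x in Ioi (0 : ℝ), ‖F n x‖ :=
    Summable.of_nonneg_of_le (fun n => integral_nonneg fun x => norm_nonneg _) hle hs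
  have hint : ∀ n, ∫ x in Ioi (0 : ℝ), F n x = c n * (rieszTransform ν ρ X n : ℂ) := by
    intro n
    rcases Nat.eq_zero_or_pos n with rfl | hn
    · simp [F, H.left_zero]
    simp only [F]
    rw [integral_const_mul, integral_complex_ofReal, rieszTransform_eq ν hρ hX hn]
  have hS := hasSum_integral_of_summable_integral_norm hFi hsum
  refine ⟨Summable.of_nonneg_of_le (fun n => by positivity) (fun n => ?_) hsum, ?_⟩
  · have := norm_integral_le_integral_norm (μ := volume.restrict (Ioi 0)) (F n)
    rwa [hint, norm_mul, Complex.norm_real] at this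
  · simp only [hint] at hS
    convert! hS using 2
    ext x
    rw [← tsum_mul_right]
    refine tsum_congr fun n => ?_
    simp only [F]
    push_cast
    ring

/-- Termwise integration again; the separated bound for `(x - Ln)_+` supplies the factor
`e^{-nL/2}`. -/
theorem hasSum_right_rieszWeight (hρ : 1 < ρ) (hX : 0 < X) :
    HasSum (fun n : ℕ => d n * (rieszWeight ν ρ X (L * n) : ℂ)) (∫ x in Ioi (0 : ℝ),
      (∑' n : ℕ, d n * ((max (x - L * n) 0 : ℝ) : ℂ)) * ((rieszWeightDeriv2 ν ρ X x : ℝ) : ℂ)) := by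
  have hL := H.pos
  set μ : ℝ := (ν : ℝ) / 2 with hμ
  have hμ0 : 0 ≤ μ := by positivity
  have hD := (integrableOn_rieszWeightDeriv2 ν hρ hX (β := μ + 1) (by rw [← hμ]; linarith)).norm
  set M := ∫ x in Ioi (0 : ℝ), ‖x ^ (μ + 1) * Real.exp (x / 2) * rieszWeightDeriv2 ν ρ X x‖
  have hM : 0 ≤ M := integral_nonneg fun x => norm_nonneg _
  have hs := (H.summable_right (L / 2) (by positivity)).mul_left (M * L ^ (-μ))
  let F : ℕ → ℝ → ℂ := fun n x => d n *
    ((max (x - L * n) 0 * rieszWeightDeriv2 ν ρ X x : ℝ) : ℂ)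
  have hFi : ∀ n, IntegrableOn (F n) (Ioi 0) := by
    intro n
    rcases Nat.eq_zero_or_pos n with rfl | hn
    · simp [F, H.right_zero]
    have hn0 : (0 : ℝ) < n := by exact_mod_cast hn
    exact ((integrableOn_max_sub_mul_rieszWeightDeriv2 ν hρ hX (mul_pos hL hn0)).ofReal).const_mul _
  have hle : ∀ n, ∫ x in Ioi (0 : ℝ), ‖F n x‖ ≤
      M * L ^ (-μ) * (‖d n‖ * Real.exp (-(n * (L / 2)))) := by
    intro n
    rcases Nat.eq_zero_or_pos n with rfl | hn
    · simp [F, H.right_zero]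
    have hn0 : (1 : ℝ) ≤ n := by exact_mod_cast hn
    have hy : 0 < L * n := by positivity
    have hLn : (L * n) ^ (-μ) ≤ L ^ (-μ) :=
      Real.rpow_le_rpow_of_nonpos hL (by nlinarith) (by linarith)
    calc ∫ x in Ioi (0 : ℝ), ‖F n x‖ ≤ ∫ x in Ioi (0 : ℝ),
          ‖d n‖ * (L ^ (-μ) * Real.exp (-(n * (L / 2)))) *
            ‖x ^ (μ + 1) * Real.exp (x / 2) * rieszWeightDeriv2 ν ρ X x‖ := by
          refine setIntegral_mono_on (hFi n).norm (hD.const_mul _) measurableSet_Ioi fun x hx => ?_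
          have hx0 : (0 : ℝ) < x := hx
          have b1 := max_sub_zero_le hμ0 hx0 hy
          have b2 : max (x - L * n) 0 ≤ x ^ (μ + 1) * Real.exp (x / 2) *
              (L ^ (-μ) * Real.exp (-(n * (L / 2)))) := by
            refine b1.trans (mul_le_mul_of_nonneg_left ?_ (by positivity))
            rw [show L * n / 2 = n * (L / 2) by ring]
            exact mul_le_mul_of_nonneg_right hLn (Real.exp_pos _).le
          have hp : 0 ≤ x ^ (μ + 1) * Real.exp (x / 2) := by positivity
          simp only [F]
          rw [norm_mul, Complex.norm_real, norm_mul, Real.norm_of_nonneg (le_max_right _ _),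
            norm_mul (x ^ (μ + 1) * Real.exp (x / 2)), Real.norm_of_nonneg hp]
          refine (mul_le_mul_of_nonneg_left (mul_le_mul_of_nonneg_right b2 (norm_nonneg _))
            (norm_nonneg _)).trans_eq ?_
          ring
      _ = _ := by rw [integral_const_mul]; ring
  have hsum : Summable fun n => ∫ x in Ioi (0 : ℝ), ‖F n x‖ :=
    Summable.of_nonneg_of_le (fun n => integral_nonneg fun x => norm_nonneg _) hle hs
  have hint : ∀ n, ∫ x in Ioi (0 : ℝ), F n x = d n * (rieszWeight ν ρ X (L * n) : ℂ) := by
    intro n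
    rcases Nat.eq_zero_or_pos n with rfl | hn
    · simp [F, H.right_zero]
    have hn0 : (0 : ℝ) < n := by exact_mod_cast hn
    simp only [F]
    rw [integral_const_mul, integral_complex_ofReal,
      integral_max_sub_mul_rieszWeightDeriv2 ν hρ hX (mul_pos hL hn0)]
  have hS := hasSum_integral_of_summable_integral_norm hFi hsum
  simp only [hint] at hS
  convert! hS using 2
  ext x
  rw [← tsum_mul_right]
  refine tsum_congr fun n => ?_
  simp only [F]
  push_cast
  ring

theorem tsum_rieszWeight (hρ : 1 < ρ) (hX : 0 < X) :
    ∑' n : ℕ, d n * (rieszWeight ν ρ X (L * n) : ℂ) =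
      C * ∑' n : ℕ, c n * (rieszTransform ν ρ X n : ℂ) := by
  rw [(H.hasSum_right_rieszWeight hρ hX).tsum_eq, (H.hasSum_left_rieszTransform hρ hX).2.tsum_eq,
    ← integral_const_mul]
  refine setIntegral_congr_fun measurableSet_Ioi fun x hx => ?_
  rw [H.tsum_max_sub hx, mul_assoc]

end FrickePair

/-! ### The test functions `ψ_s` and the continuation of `L_f(ψ_s)`. -/

section Psi

variable {k : ℕ} {s : ℂ}

theorem integrable_psi (hs : 0 < s.re) (hsk : s.re < k) : Integrable (psi k s) := by
  have h := betaIntegral_convergent (u := (k : ℂ) - s) (v := s) (by simpa using hsk) hs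
  rw [intervalIntegrable_iff_integrableOn_Ioo_of_le zero_le_one] at h
  refine (integrable_indicator_iff measurableSet_Ioo).mpr ((h.div_const (Complex.Gamma s)).congr ?_)
  exact ae_of_all _ fun x => by simp only; ring

theorem norm_psi {x : ℝ} (hx : x ∈ Ioo (0 : ℝ) 1) :
    ‖psi k s x‖ = (1 - x) ^ (s.re - 1) * x ^ ((k : ℝ) - s.re - 1) / ‖Complex.Gamma s‖ := by
  have h1 : (0 : ℝ) < 1 - x := by linarith [hx.2]
  rw [psi, indicator_of_mem hx, norm_div, norm_mul,
    show (1 - (x : ℂ)) = ((1 - x : ℝ) : ℂ) by push_cast; rfl,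
    norm_cpow_eq_rpow_re_of_pos h1, norm_cpow_eq_rpow_re_of_pos hx.1]
  simp

theorem psi_of_notMem {x : ℝ} (hx : x ∉ Ioo (0 : ℝ) 1) : psi k s x = 0 :=
  indicator_of_notMem hx _

theorem integrable_norm_psi_mul_rpow {τ : ℝ} (hs : 0 < s.re) (hsk : τ < k - s.re) :
    Integrable fun x => ‖psi k s x‖ * x ^ (-τ) := by
  have h := betaIntegral_convergent (u := ((k - s.re - τ : ℝ) : ℂ)) (v := s)
    (by rw [ofReal_re]; linarith) hs
  rw [intervalIntegrable_iff_integrableOn_Ioo_of_le zero_le_one] at h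
  have h2 := (integrable_indicator_iff measurableSet_Ioo).mpr (h.norm.div_const ‖Complex.Gamma s‖)
  refine h2.congr (ae_of_all _ fun x => ?_)
  by_cases hx : x ∈ Ioo (0 : ℝ) 1
  · have h1 : (0 : ℝ) < 1 - x := by linarith [hx.2]
    simp only [indicator_of_mem hx, norm_psi hx]
    rw [norm_mul, show (1 - (x : ℂ)) = ((1 - x : ℝ) : ℂ) by push_cast; rfl,
      norm_cpow_eq_rpow_re_of_pos h1, norm_cpow_eq_rpow_re_of_pos hx.1]
    have : x ^ ((((k - s.re - τ : ℝ) : ℂ) - 1).re) = x ^ ((k : ℝ) - s.re - 1) * x ^ (-τ) := by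
      rw [← Real.rpow_add hx.1]
      simp only [sub_re, ofReal_re, one_re]
      ring_nf
    rw [this]
    simp only [sub_re, one_re]
    ring
  · simp [indicator_of_notMem hx, psi_of_notMem hx]

theorem integrableOn_psi_mul_cexp (hs : 0 < s.re) (hsk : s.re < k) {z : ℂ} (hz : 0 ≤ z.re) :
    IntegrableOn (fun x : ℝ => psi k s x * Complex.exp (-(z * (x : ℂ)))) (Ioi (0 : ℝ)) := by
  have h := (integrable_psi hs hsk).integrableOn (s := Ioi 0)
  refine h.norm.mono' (h.aestronglyMeasurable.mul (by fun_prop)) ?_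
  filter_upwards [ae_restrict_mem measurableSet_Ioi] with x hx
  have hx0 : (0 : ℝ) < x := hx
  rw [norm_mul]
  refine mul_le_of_le_one_right (norm_nonneg _) ?_
  rw [Complex.norm_exp]
  refine Real.exp_le_one_iff.mpr ?_
  simp only [neg_re, mul_re, ofReal_re, ofReal_im, mul_zero, sub_zero]
  have := mul_nonneg hz hx0.le
  linarith

theorem integral_Ioo_eq_integral_Ioi (g : ℝ → ℂ) :
    ∫ t in Ioo (0 : ℝ) 1, g t = ∫ u in Ioi (0 : ℝ), ((((1 + u) ^ 2)⁻¹ : ℝ) : ℂ) * g (1 + u)⁻¹ := by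
  have himg : (fun u : ℝ => (1 + u)⁻¹) '' Ioi 0 = Ioo 0 1 := by
    ext t
    constructor
    · rintro ⟨u, hu, rfl⟩
      have hu0 : (0 : ℝ) < u := hu
      exact ⟨by positivity, inv_lt_one_of_one_lt₀ (by linarith)⟩
    · rintro ⟨h0, h1⟩
      refine ⟨t⁻¹ - 1, ?_, by simp⟩
      have := (one_lt_inv₀ h0).mpr h1
      simpa using this
  have hder : ∀ u ∈ Ioi (0 : ℝ), HasDerivWithinAt (fun u : ℝ => (1 + u)⁻¹) (-((1 + u) ^ 2)⁻¹) (Ioi 0) u := by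
    intro u hu
    have hu0 : (0 : ℝ) < u := hu
    have := ((hasDerivAt_id u).const_add 1).inv (by simp; linarith)
    refine (this.congr_deriv ?_).hasDerivWithinAt
    simp [neg_div]
  have hinj : InjOn (fun u : ℝ => (1 + u)⁻¹) (Ioi 0) := by
    intro a _ b _ hab
    have := inv_injective hab
    linarith
  rw [← himg, integral_image_eq_integral_abs_deriv_smul measurableSet_Ioi hder hinj]
  refine integral_congr_ae (ae_of_all _ fun u => ?_)
  simp only [abs_neg, abs_of_nonneg (inv_nonneg.mpr (sq_nonneg (1 + u))), real_smul]

/-- At `t = 1/(1+u)` one has `1 - t = ut`, so all powers of `t`, with the Jacobian `t²`, combine to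
`t^k`. This is the automorphy factor at `p = 1 + u`, and `u^{s-1}/Γ(s)` remains. -/
theorem mul_psi_inv_one_add {u : ℝ} (hu : 0 < u) :
    ((((1 + u) ^ 2)⁻¹ : ℝ) : ℂ) * psi k s (1 + u)⁻¹ =
      (u : ℂ) ^ (s - 1) * (((1 + u : ℝ) : ℂ) ^ k)⁻¹ / Complex.Gamma s := by
  set t : ℝ := (1 + u)⁻¹ with ht
  have ht0 : 0 < t := by positivity
  have ht0' : (t : ℂ) ≠ 0 := by exact_mod_cast ht0.ne'
  have hmem : t ∈ Ioo (0 : ℝ) 1 := ⟨ht0, inv_lt_one_of_one_lt₀ (by linarith)⟩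
  have h1 : (1 - (t : ℂ)) = (u : ℂ) * (t : ℂ) := by
    have : 1 - t = u * t := by rw [ht]; field_simp; ring
    exact_mod_cast this
  have h2 : (t : ℂ) ^ (s - 1) * (t : ℂ) ^ ((k : ℂ) - s - 1) * (t : ℂ) ^ 2 = (t : ℂ) ^ k := by
    rw [← cpow_add _ _ ht0', ← cpow_natCast, ← cpow_natCast, ← cpow_add _ _ ht0']
    congr 1
    push_cast
    ring
  rw [psi, indicator_of_mem hmem, h1, mul_cpow_ofReal_nonneg hu.le ht0.le,
    show ((((1 + u) ^ 2)⁻¹ : ℝ) : ℂ) = (t : ℂ) ^ 2 by rw [ht]; push_cast; rw [inv_pow],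
    show (((1 + u : ℝ) : ℂ) ^ k)⁻¹ = (t : ℂ) ^ k by rw [ht]; push_cast; rw [inv_pow], ← h2]
  ring

end Psi

namespace FrickePair

variable {ν : ℕ} {L : ℝ} {C : ℂ} {c d : ℕ → ℂ} (H : FrickePair ν L C c d) {s : ℂ}
include H

/-- Bound `e^{-v}` by a multiple of `v^{-τ}`. Summation over `n` needs `τ > (ν+2)/2`, integrability
of `ψ_s` against `x^{-τ}` needs `τ < ν + 1 - Re s`, and such a `τ` exists because `Re s < ν/2`. -/
theorem summable_left_mul_integral_psi (hs : 0 < s.re) (hsν : s.re < (ν : ℝ) / 2) :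
    Summable fun n : ℕ =>
      ‖c n‖ * ∫ x in Ioi (0 : ℝ), ‖psi (ν + 1) s x‖ * Real.exp (-(2 * Real.pi * n * x)) := by
  set τ : ℝ := (((ν : ℝ) + 2) / 2 + (ν + 1 - s.re)) / 2 with hτ
  have hτ1 : ((ν : ℝ) + 2) / 2 < τ := by rw [hτ]; linarith
  have hτ2 : τ < ((ν + 1 : ℕ) : ℝ) - s.re := by rw [hτ]; push_cast; linarith
  have hτ0 : 0 < τ := lt_trans (by positivity) hτ1
  have hI := (integrable_norm_psi_mul_rpow hs hτ2).integrableOn (s := Ioi 0)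
  set J := ∫ x in Ioi (0 : ℝ), ‖psi (ν + 1) s x‖ * x ^ (-τ)
  refine Summable.of_nonneg_of_le
    (fun n => mul_nonneg (norm_nonneg _) (integral_nonneg fun x => by positivity)) (fun n => ?_)
    ((H.summable_left τ hτ1).mul_left ((2 * τ) ^ τ * (2 * Real.pi) ^ (-τ) * J))
  rcases Nat.eq_zero_or_pos n with rfl | hn
  · simp [H.left_zero]
  have hn0 : (0 : ℝ) < n := by exact_mod_cast hn
  have hle : ∫ x in Ioi (0 : ℝ), ‖psi (ν + 1) s x‖ * Real.exp (-(2 * Real.pi * n * x)) ≤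
      (2 * τ) ^ τ * (2 * Real.pi) ^ (-τ) * (n : ℝ) ^ (-τ) * J := by
    rw [← integral_const_mul]
    refine integral_mono_of_nonneg (ae_of_all _ fun x => by positivity) (hI.const_mul _) ?_
    filter_upwards [ae_restrict_mem measurableSet_Ioi] with x hx
    have hx0 : (0 : ℝ) < x := hx
    set v := 2 * Real.pi * n * x with hv
    have hv0 : 0 < v := by positivity
    have h1 := rpow_le_mul_exp_half hτ0 hv0.le
    have h2 : Real.exp (v / 2) ≤ Real.exp v := Real.exp_le_exp.mpr (by linarith)
    have h3 : Real.exp (-v) ≤ (2 * τ) ^ τ * v ^ (-τ) := by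
      rw [Real.exp_neg, Real.rpow_neg hv0.le, ← div_eq_mul_inv, le_div_iff₀ (by positivity),
        inv_mul_le_iff₀ (by positivity), mul_comm (Real.exp _)]
      exact h1.trans (mul_le_mul_of_nonneg_left h2 (by positivity))
    refine (mul_le_mul_of_nonneg_left h3 (norm_nonneg _)).trans_eq ?_
    rw [hv, Real.mul_rpow (by positivity) hx0.le, Real.mul_rpow (by positivity) hn0.le]
    ring
  refine (mul_le_mul_of_nonneg_left hle (norm_nonneg (c n))).trans_eq ?_
  ring

theorem isTestFunction_psi (hs : 0 < s.re) (hsν : s.re < (ν : ℝ) / 2) :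
    IsTestFunction c (psi (ν + 1) s) where
  integrable z hz := integrableOn_psi_mul_cexp hs
    (by push_cast; linarith [(Nat.cast_nonneg ν : (0 : ℝ) ≤ ν)]) hz
  summable := H.summable_left_mul_integral_psi hs hsν

theorem LSer_psi_eq_integral (hs : 0 < s.re) (hsν : s.re < (ν : ℝ) / 2) :
    LSer c (psi (ν + 1) s) = ∫ x in Ioo (0 : ℝ) 1, psi (ν + 1) s x *
      ∑' n : ℕ, c n * Complex.exp (-(2 * Real.pi * n * x)) := by
  let F : ℕ → ℝ → ℂ := fun n x => c n * (psi (ν + 1) s x * Complex.exp (-(2 * Real.pi * n * x)))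
  have hFi : ∀ n, IntegrableOn (F n) (Ioi 0) := fun n =>
    ((H.isTestFunction_psi hs hsν).integrable (2 * Real.pi * n) (by
      rw [show (2 * Real.pi * n : ℂ) = ((2 * Real.pi * n : ℝ) : ℂ) by push_cast; rfl, ofReal_re]
      positivity)).const_mul _
  have hn : ∀ n, ∫ x in Ioi (0 : ℝ), ‖F n x‖ =
      ‖c n‖ * ∫ x in Ioi (0 : ℝ), ‖psi (ν + 1) s x‖ * Real.exp (-(2 * Real.pi * n * x)) := by
    intro n
    rw [← integral_const_mul]
    refine integral_congr_ae (ae_of_all _ fun x => ?_)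
    simp only [F, norm_mul, Complex.norm_exp]
    congr 4
    simp
  have hS := hasSum_integral_of_summable_integral_norm hFi (by
    simp only [hn]; exact H.summable_left_mul_integral_psi hs hsν)
  have h1 : LSer c (psi (ν + 1) s) = ∫ x in Ioi (0 : ℝ), ∑' n, F n x := by
    rw [← hS.tsum_eq, LSer]
    refine tsum_congr fun n => ?_
    simp only [F, laplace]
    rw [integral_const_mul]
  rw [h1]
  have h2 : ∫ x in Ioi (0 : ℝ), ∑' n, F n x = ∫ x in Ioo (0 : ℝ) 1, ∑' n, F n x := by
    refine setIntegral_eq_of_subset_of_forall_sdiff_eq_zero measurableSet_Ioi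
      (fun x hx => hx.1) fun x hx => ?_
    simp [F, psi_of_notMem hx.2]
  rw [h2]
  refine integral_congr_ae (ae_of_all _ fun x => ?_)
  simp only [F]
  rw [← tsum_mul_left]
  exact tsum_congr fun n => by ring

/-- After the substitution `t = 1/(1+u)` the modular relation at `p = 1 + u` replaces the `c` series
by `∑ d(n) e^{-Ln} e^{-Lnu}`, and the integral over `u` is a Gamma integral cancelling `1/Γ(s)`. -/
theorem LSer_psi (hC : C ≠ 0) (hs : 0 < s.re) (hsν : s.re < (ν : ℝ) / 2) :
    LSer c (psi (ν + 1) s) =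
      C⁻¹ * ∑' n : ℕ, d n * Complex.exp (-(L * n)) * ((L * n : ℝ) : ℂ) ^ (-s) := by
  have hL := H.pos
  have hΓ : Complex.Gamma s ≠ 0 := Complex.Gamma_ne_zero_of_re_pos hs
  rw [H.LSer_psi_eq_integral hs hsν, integral_Ioo_eq_integral_Ioi]
  let F : ℕ → ℝ → ℂ := fun n u => d n * Complex.exp (-(L * n)) *
    ((u : ℂ) ^ (s - 1) * Complex.exp (-((L * n : ℝ) * u)))
  have hpt : ∀ u ∈ Ioi (0 : ℝ), ((((1 + u) ^ 2)⁻¹ : ℝ) : ℂ) * (psi (ν + 1) s (1 + u)⁻¹ *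
      ∑' n : ℕ, c n * Complex.exp (-(2 * Real.pi * n * ((1 + u)⁻¹ : ℝ)))) =
      C⁻¹ * (Complex.Gamma s)⁻¹ * ∑' n, F n u := by
    intro u hu
    have hu0 : (0 : ℝ) < u := hu
    have ht := H.transform ((1 + u : ℝ) : ℂ) (by rw [ofReal_re]; linarith)
    have hp : ((1 + u : ℝ) : ℂ) ≠ 0 := by exact_mod_cast (by linarith : (0 : ℝ) < 1 + u).ne'
    have e1 : ∑' n, F n u = (u : ℂ) ^ (s - 1) *
        ∑' n : ℕ, d n * Complex.exp (-(L * n * ((1 + u : ℝ) : ℂ))) := by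
      rw [← tsum_mul_left]
      refine tsum_congr fun n => ?_
      have : Complex.exp (-(L * n * ((1 + u : ℝ) : ℂ))) =
          Complex.exp (-(L * n)) * Complex.exp (-((L * n : ℝ) * u)) := by
        rw [← Complex.exp_add]; congr 1; push_cast; ring
      simp only [F, this]
      ring
    have e2 : ∑' n : ℕ, c n * Complex.exp (-(2 * Real.pi * n * ((1 + u)⁻¹ : ℝ))) =
        ∑' n : ℕ, c n * Complex.exp (-(2 * Real.pi * n / ((1 + u : ℝ) : ℂ))) := by
      refine tsum_congr fun n => ?_
      rw [ofReal_inv, ← div_eq_mul_inv]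
    rw [← mul_assoc, mul_psi_inv_one_add hu0, e1, ht, e2]
    field_simp
  rw [setIntegral_congr_fun measurableSet_Ioi hpt, integral_const_mul]
  have hFi : ∀ n, IntegrableOn (F n) (Ioi 0) := by
    intro n
    rcases Nat.eq_zero_or_pos n with rfl | hn
    · simp [F, H.right_zero]
    have hn0 : (0 : ℝ) < n := by exact_mod_cast hn
    refine Integrable.const_mul ?_ _
    refine (integrableOn_rpow_mul_exp_neg_mul (s := s.re - 1) (by linarith)
      (mul_pos hL hn0)).mono' ?_ ?_
    · exact Measurable.aestronglyMeasurable (by fun_prop)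
    · filter_upwards [ae_restrict_mem measurableSet_Ioi] with u hu
      have hu0 : (0 : ℝ) < u := hu
      rw [norm_mul, norm_cpow_eq_rpow_re_of_pos hu0, Complex.norm_exp, sub_re, one_re,
        ← ofReal_mul, neg_re, ofReal_re]
  have hFn : ∀ n, ∫ u in Ioi (0 : ℝ), ‖F n u‖ ≤
      L ^ (-s.re) * Real.Gamma s.re * (‖d n‖ * Real.exp (-(n * L))) := by
    intro n
    rcases Nat.eq_zero_or_pos n with rfl | hn
    · simp [F, H.right_zero]
    have hn1 : (1 : ℝ) ≤ n := by exact_mod_cast hn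
    have hy : 0 < L * n := by positivity
    have hG : 0 < Real.Gamma s.re := Real.Gamma_pos_of_pos hs
    calc ∫ u in Ioi (0 : ℝ), ‖F n u‖ = ∫ u in Ioi (0 : ℝ), ‖d n‖ * Real.exp (-(n * L)) *
          (u ^ (s.re - 1) * Real.exp (-(L * n * u))) := by
          refine setIntegral_congr_fun measurableSet_Ioi fun u hu => ?_
          have hu0 : (0 : ℝ) < u := hu
          simp only [F]
          rw [norm_mul, norm_mul, norm_mul, norm_cpow_eq_rpow_re_of_pos hu0, Complex.norm_exp,
            Complex.norm_exp, sub_re, one_re, ← ofReal_mul, neg_re, neg_re, ofReal_re]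
          congr 4
          simp [mul_comm]
      _ = (‖d n‖ * Real.exp (-(n * L))) * ((L * n) ^ (-s.re) * Real.Gamma s.re) := by
          rw [integral_const_mul, Real.integral_rpow_mul_exp_neg_mul_Ioi hs hy, one_div,
            Real.inv_rpow hy.le, Real.rpow_neg hy.le]
      _ ≤ (‖d n‖ * Real.exp (-(n * L))) * (L ^ (-s.re) * Real.Gamma s.re) := by
          refine mul_le_mul_of_nonneg_left (mul_le_mul_of_nonneg_right ?_ hG.le) (by positivity)
          exact Real.rpow_le_rpow_of_nonpos hL (by nlinarith) (by linarith)
      _ = _ := by ring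
  have hFe : ∀ n, ∫ u in Ioi (0 : ℝ), F n u =
      Complex.Gamma s * (d n * Complex.exp (-(L * n)) * ((L * n : ℝ) : ℂ) ^ (-s)) := by
    intro n
    rcases Nat.eq_zero_or_pos n with rfl | hn
    · simp [F, H.right_zero]
    have hn0 : (0 : ℝ) < n := by exact_mod_cast hn
    have hy : 0 < L * n := by positivity
    simp only [F]
    rw [integral_const_mul, Complex.integral_cpow_mul_exp_neg_mul_Ioi hs hy, one_div,
      inv_cpow _ _ (by rw [arg_ofReal_of_nonneg hy.le]; exact Real.pi_pos.ne), cpow_neg]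
    ring
  have hS := hasSum_integral_of_summable_integral_norm hFi
    (Summable.of_nonneg_of_le (fun n => integral_nonneg fun x => norm_nonneg _) hFn
      ((H.summable_right L hL).mul_left _))
  rw [← hS.tsum_eq]
  simp only [hFe, tsum_mul_left]
  field_simp

/-- Half of the exponential decay absorbs `(Ln)^R`; if `Ln < 1`, the bound `Ln ≥ L` limits the
negative power. Uniformity in `|Re s| ≤ R` makes the series entire in `s`. -/
theorem norm_right_mul_cpow_le {R : ℝ} (hR : 0 < R) (hs : |s.re| ≤ R) (n : ℕ) :
    ‖d n * Complex.exp (-(L * n)) * ((L * n : ℝ) : ℂ) ^ (-s)‖ ≤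
      ((2 * R) ^ R + L ^ (-R) + 1) * (‖d n‖ * Real.exp (-(n * (L / 2)))) := by
  have hL := H.pos
  rcases Nat.eq_zero_or_pos n with rfl | hn
  · simp [H.right_zero]
  have hn1 : (1 : ℝ) ≤ n := by exact_mod_cast hn
  set y : ℝ := L * n with hy
  have hy0 : 0 < y := by positivity
  have hyL : L ≤ y := by rw [hy]; nlinarith
  have e1 : Real.exp (-y) * Real.exp (y / 2) = Real.exp (-(n * (L / 2))) := by
    rw [← Real.exp_add]; congr 1; rw [hy]; ring
  have hex : 1 ≤ Real.exp (y / 2) := Real.one_le_exp (by positivity)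
  have h0 : y ^ (-s.re) ≤ y ^ R + L ^ (-R) := by
    rcases le_total 1 y with h | h
    · have : y ^ (-s.re) ≤ y ^ R := Real.rpow_le_rpow_of_exponent_le h (by linarith [neg_abs_le s.re])
      have : 0 ≤ L ^ (-R) := by positivity
      linarith
    · have h1 : y ^ (-s.re) ≤ y ^ (-R) := Real.rpow_le_rpow_of_exponent_ge hy0 h (by linarith [le_abs_self s.re])
      have h2 : y ^ (-R) ≤ L ^ (-R) := Real.rpow_le_rpow_of_nonpos hL hyL (by linarith)
      have : 0 ≤ y ^ R := by positivity
      linarith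
  have h1 : y ^ (-s.re) ≤ ((2 * R) ^ R + L ^ (-R) + 1) * Real.exp (y / 2) := by
    have b1 := rpow_le_mul_exp_half hR hy0.le
    have b2 : L ^ (-R) * 1 ≤ L ^ (-R) * Real.exp (y / 2) :=
      mul_le_mul_of_nonneg_left hex (by positivity)
    linarith
  have h2 : ‖Complex.exp (-(L * n))‖ = Real.exp (-y) := by
    rw [Complex.norm_exp, hy]; simp
  rw [norm_mul, norm_mul, h2, norm_cpow_eq_rpow_re_of_pos hy0, neg_re, ← e1]
  refine (mul_le_mul_of_nonneg_left h1 (by positivity)).trans_eq ?_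
  ring

theorem summable_right_mul_cpow (s : ℂ) :
    Summable fun n : ℕ => d n * Complex.exp (-(L * n)) * ((L * n : ℝ) : ℂ) ^ (-s) :=
  Summable.of_norm_bounded ((H.summable_right (L / 2) (half_pos H.pos)).mul_left _)
    (H.norm_right_mul_cpow_le (R := |s.re| + 1) (by positivity) (by linarith))

theorem differentiable_tsum_right_mul_cpow :
    Differentiable ℂ fun s : ℂ =>
      ∑' n : ℕ, d n * Complex.exp (-(L * n)) * ((L * n : ℝ) : ℂ) ^ (-s) := by
  intro s
  set U : Set ℂ := {w | |w.re| < |s.re| + 1}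
  have hU : IsOpen U := isOpen_lt (by fun_prop) continuous_const
  have hd : DifferentiableOn ℂ (fun s : ℂ =>
      ∑' n : ℕ, d n * Complex.exp (-(L * n)) * ((L * n : ℝ) : ℂ) ^ (-s)) U := by
    refine differentiableOn_tsum_of_summable_norm
      ((H.summable_right (L / 2) (half_pos H.pos)).mul_left _) (fun n => ?_) hU
      (fun n w hw => H.norm_right_mul_cpow_le (R := |s.re| + 1) (by positivity) (le_of_lt hw) n)
    rcases Nat.eq_zero_or_pos n with rfl | hn
    · simp [H.right_zero]
    have hn0 : (0 : ℝ) < n := by exact_mod_cast hn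
    have hy : ((L * n : ℝ) : ℂ) ≠ 0 := by exact_mod_cast (mul_pos H.pos hn0).ne'
    exact (((differentiable_id.neg).const_cpow (Or.inl hy)).const_mul _).differentiableOn
  exact hd.differentiableAt (hU.mem_nhds (show |s.re| < |s.re| + 1 by linarith))

theorem isContinuation (hC : C ≠ 0) : IsContinuation (ν + 1) c fun s =>
    C⁻¹ * ∑' n : ℕ, d n * Complex.exp (-(L * n)) * ((L * n : ℝ) : ℂ) ^ (-s) where
  entire := H.differentiable_tsum_right_mul_cpow.const_mul _
  admissible s hs hs' := H.isTestFunction_psi hs (by push_cast at hs'; linarith)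
  eq_LSer s hs hs' := (H.LSer_psi hC hs (by push_cast at hs'; linarith)).symm

end FrickePair

/-! ### Assembly of the summation formula for cusp forms. -/

theorem frickePair {N ν : ℕ} [NeZero N]
    (f : CuspForm ((CongruenceSubgroup.Gamma1 N : Subgroup SL(2, ℤ)) : Subgroup (GL (Fin 2) ℝ))
      ((ν + 1 : ℕ) : ℤ)) :
    FrickePair ν (2 * Real.pi / N)
      (Complex.I ^ (-((ν + 1 : ℕ) : ℤ)) * (((N : ℝ) ^ (((ν + 1 : ℕ) : ℝ) / 2) : ℝ) : ℂ))
      (fourierCoefficient f) (fourierCoefficient (frickeSlash N ((ν + 1 : ℕ) : ℤ) f)) where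
  pos := by
    have hN : (0 : ℝ) < N := by exact_mod_cast Nat.pos_of_ne_zero (NeZero.ne N)
    positivity
  left_zero := fourierCoefficient_zero f
  right_zero := fourierCoefficient_frickeSlash_zero f
  summable_left τ hτ := summable_norm_fourierCoefficient_mul_rpow f (by push_cast; linarith)
  summable_right y hy := by
    have ht : 0 < ((y / (2 * Real.pi) : ℝ) * Complex.I).im := by
      rw [Complex.im_ofReal_mul, Complex.I_im]; positivity
    have h := (hasSum_fourierCoefficient_frickeSlash f
      ⟨(y / (2 * Real.pi) : ℝ) * Complex.I, ht⟩).summable.norm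
    refine h.congr fun n => ?_
    rw [norm_mul, Complex.norm_exp]
    have : (2 * Real.pi * Complex.I * n * ((y / (2 * Real.pi) : ℝ) * Complex.I) : ℂ) =
        ((-(n * y) : ℝ) : ℂ) := by
      push_cast
      field_simp
      linear_combination (n * y : ℂ) * Complex.I_sq
    simp only [this, ofReal_re]
  transform p hp := by
    have hp0 : p ≠ 0 := fun h => by simp [h] at hp
    have hpi : 0 < (p⁻¹).re := by
      rw [Complex.inv_re]; exact div_pos hp (Complex.normSq_pos.mpr hp0)
    have h1 := (hasSum_fourierCoefficient_of_re_pos f hpi).summable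
    have h2 := (hasSum_fricke_transform f hp (by simpa only [← div_eq_mul_inv] using h1.hasSum)).tsum_eq
    rw [zpow_neg p, zpow_natCast p] at h2
    have h3 : ∀ n : ℕ, 2 * Real.pi * (n : ℂ) / N * p = ((2 * Real.pi / N : ℝ) : ℂ) * n * p := by
      intro n
      push_cast
      ring
    simp only [h3] at h2
    simp only [div_eq_mul_inv _ p, div_eq_mul_inv _ (p ^ (ν + 1))] at h2 ⊢
    exact h2

/-- The splitting `(1-v)_+^ρ = 1 + cutoff`: past `NX/(2π)` the two summands cancel, so the infinite
series is the finite Riesz sum. The ceiling in `rieszSum` encodes the strict inequality `n <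
NX/(2π)`. -/
theorem rieszSum_eq_tsum {N ν : ℕ} [NeZero N] {d : ℕ → ℂ} (hd : d 0 = 0) {ρ X : ℝ} (hρ : 1 < ρ)
    (hX : 0 < X) :
    rieszSum N (ν + 1) d ρ X = ∑' n : ℕ, (d n * Complex.exp (-((2 * Real.pi / N : ℝ) * n)) *
      ((2 * Real.pi / N * n : ℝ) : ℂ) ^ (-((((ν + 1 : ℕ) : ℂ) - 1) / 2)) +
        d n * (rieszWeight ν ρ X (2 * Real.pi / N * n) : ℂ)) := by
  have hN : (0 : ℝ) < N := by exact_mod_cast Nat.pos_of_ne_zero (NeZero.ne N)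
  have hterm : ∀ n : ℕ, 1 ≤ n → d n * Complex.exp (-((2 * Real.pi / N : ℝ) * n)) *
      ((2 * Real.pi / N * n : ℝ) : ℂ) ^ (-((((ν + 1 : ℕ) : ℂ) - 1) / 2)) +
        d n * (rieszWeight ν ρ X (2 * Real.pi / N * n) : ℂ) =
      d n * ((Real.exp (-(2 * Real.pi / N * n)) * (2 * Real.pi / N * n) ^ (-((ν : ℝ) / 2)) *
        (max (1 - 2 * Real.pi / N * n / X) 0) ^ ρ : ℝ) : ℂ) := by
    intro n hn
    have hn0 : (0 : ℝ) < n := by exact_mod_cast hn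
    have hy : 0 < 2 * Real.pi / N * n := by positivity
    have h1 : ((2 * Real.pi / N * n : ℝ) : ℂ) ^ (-((((ν + 1 : ℕ) : ℂ) - 1) / 2)) =
        (((2 * Real.pi / N * n) ^ (-((ν : ℝ) / 2)) : ℝ) : ℂ) := by
      rw [ofReal_cpow hy.le]
      congr 1
      push_cast
      ring
    have h2 : Complex.exp (-((2 * Real.pi / N : ℝ) * n)) =
        ((Real.exp (-(2 * Real.pi / N * n)) : ℝ) : ℂ) := by
      push_cast; rfl
    rw [h1, h2, rieszWeight, cutoff]
    push_cast
    ring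
  rw [tsum_eq_sum (s := Finset.Ico 1 ⌈N * X / (2 * Real.pi)⌉₊), rieszSum]
  · refine Finset.sum_congr rfl fun n hn => ?_
    obtain ⟨hn1, hn2⟩ := Finset.mem_Ico.mp hn
    have hn0 : (0 : ℝ) < n := by exact_mod_cast hn1
    have hlt : 2 * Real.pi / N * n < X := by
      have := Nat.lt_ceil.mp hn2
      rw [lt_div_iff₀ (by positivity)] at this
      rw [div_mul_eq_mul_div, div_lt_iff₀ hN]
      linarith
    have hpos : 0 ≤ 1 - 2 * Real.pi / N * n / X := by
      rw [sub_nonneg, div_le_one hX]; exact hlt.le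
    rw [hterm n hn1, max_eq_left hpos, Real.rpow_neg (by positivity)]
    have e1 : 2 * Real.pi * n / N = 2 * Real.pi / N * n := by ring
    have e2 : 2 * Real.pi * n / (N * X) = 2 * Real.pi / N * n / X := by field_simp
    have e3 : (((ν + 1 : ℕ) : ℝ) - 1) / 2 = (ν : ℝ) / 2 := by push_cast; ring
    rw [e1, e2, e3, div_eq_mul_inv (Real.exp _)]
  · intro n hn
    rcases Nat.eq_zero_or_pos n with rfl | hn1
    · simp [hd]
    have hle : X ≤ 2 * Real.pi / N * n := by
      have : ⌈N * X / (2 * Real.pi)⌉₊ ≤ n := by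
        by_contra hlt
        exact hn (Finset.mem_Ico.mpr ⟨hn1, not_le.mp hlt⟩)
      have := Nat.ceil_le.mp this
      rw [div_le_iff₀ (by positivity)] at this
      rw [div_mul_eq_mul_div, le_div_iff₀ hN]
      linarith
    have hneg : 1 - 2 * Real.pi / N * n / X ≤ 0 := by
      rw [sub_nonpos, one_le_div hX]; exact hle
    rw [hterm n hn1, max_eq_right hneg, Real.zero_rpow (by linarith)]
    simp

theorem div_exp_mul_lineIntegral_kernel (ν : ℕ) {ρ X ε : ℝ} (hρ : 1 < ρ) (hX : 0 < X) (hε : 0 < ε)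
    (hε1 : ε < 1) (c : ℂ) {n : ℕ} (hn : 1 ≤ n) :
    c / (Real.exp (2 * Real.pi * (n : ℝ)) : ℂ) * lineIntegral (-ε) (kernel (ν + 1) ρ X n) =
      2 * Real.pi * Complex.I * ν.factorial / Complex.Gamma (ρ + 1) *
        (c * (rieszTransform ν ρ X n : ℂ)) := by
  have h := lineIntegral_kernel ν hρ hX hε hε1 hn
  have he : (Real.exp (2 * Real.pi * (n : ℝ)) : ℂ) ≠ 0 := by exact_mod_cast (Real.exp_pos _).ne'
  rw [h, rieszTransform]
  field_simp

end RieszSum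

end

theorem mainTheorem2 (N k : ℕ) [NeZero N] (hk : Even k) (hk0 : 0 < k)
    (χ : DirichletCharacter ℂ N)
    (f : CuspForm ((CongruenceSubgroup.Gamma1 N : Subgroup SL(2, ℤ)) : Subgroup (GL (Fin 2) ℝ)) k)
    (hf : RieszSum.HasNebentypus χ f)
    (c d : ℕ → ℂ)
    (hc : c = RieszSum.fourierCoefficient f)
    (hd : d = RieszSum.fourierCoefficient (RieszSum.frickeSlash N k f)) :
    ∃ Λ : ℂ → ℂ, RieszSum.IsContinuation k c Λ ∧
      ∀ ρ X ε : ℝ, 1 < ρ → 0 < X → 0 < ε → ε < 1 →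
        (∀ n : ℕ, 1 ≤ n →
          Integrable fun t : ℝ => RieszSum.kernel k ρ X n (((-ε : ℝ) : ℂ) + t * Complex.I)) ∧
        (Summable fun n : ℕ =>
          c (n + 1) / (Real.exp (2 * Real.pi * ((n + 1 : ℕ) : ℝ)) : ℂ) *
            RieszSum.lineIntegral (-ε) (RieszSum.kernel k ρ X (n + 1))) ∧
        RieszSum.rieszSum N k d ρ X =
          Complex.I ^ (-(k : ℤ)) * (((N : ℝ) ^ ((k : ℝ) / 2) : ℝ) : ℂ) * Λ (((k : ℂ) - 1) / 2) +
          Complex.Gamma ((ρ : ℂ) + 1) * (((N : ℝ) ^ ((k : ℝ) / 2) : ℝ) : ℂ) /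
              (2 * Real.pi * Complex.I ^ (k + 1) * Complex.Gamma k) *
            ∑' n : ℕ, c (n + 1) / (Real.exp (2 * Real.pi * ((n + 1 : ℕ) : ℝ)) : ℂ) *
              RieszSum.lineIntegral (-ε) (RieszSum.kernel k ρ X (n + 1)) := by
  obtain ⟨ν, rfl⟩ : ∃ ν, k = ν + 1 := ⟨k - 1, by omega⟩
  have H := RieszSum.frickePair f
  rw [← hc, ← hd] at H
  have hN : (0 : ℝ) < N := by exact_mod_cast Nat.pos_of_ne_zero (NeZero.ne N)
  set A : ℂ := (((N : ℝ) ^ (((ν + 1 : ℕ) : ℝ) / 2) : ℝ) : ℂ) with hA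
  have hA0 : A ≠ 0 := by
    rw [hA]; exact_mod_cast (Real.rpow_pos_of_pos hN _).ne'
  have hC : Complex.I ^ (-((ν + 1 : ℕ) : ℤ)) * A ≠ 0 :=
    mul_ne_zero (zpow_ne_zero _ Complex.I_ne_zero) hA0
  refine ⟨_, H.isContinuation hC, fun ρ X ε hρ hX hε hε1 => ?_⟩
  have hterm := fun n : ℕ => RieszSum.div_exp_mul_lineIntegral_kernel ν hρ hX hε hε1 (c (n + 1))
    (Nat.le_add_left 1 n)
  have hT := H.hasSum_left_rieszTransform hρ hX
  refine ⟨fun n hn => RieszSum.integrable_kernel_line ν hρ hX hε hε1 hn, ?_, ?_⟩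
  · simp only [hterm]
    exact ((summable_nat_add_iff 1).mpr hT.2.summable).mul_left _
  · have hΓ : Complex.Gamma ((ρ : ℂ) + 1) ≠ 0 :=
      Complex.Gamma_ne_zero_of_re_pos (by simp; linarith)
    have hI : Complex.I ^ (-((ν + 1 : ℕ) : ℤ)) = (Complex.I ^ (ν + 1))⁻¹ := by
      rw [zpow_neg, zpow_natCast]
    -- The theorem sums over `n ≥ 1`; the term `n = 0` is zero because `f` is a cusp form.
    have hshift : ∑' n : ℕ, c (n + 1) * (RieszSum.rieszTransform ν ρ X (n + 1) : ℂ) =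
        ∑' n : ℕ, c n * (RieszSum.rieszTransform ν ρ X n : ℂ) := by
      rw [hT.2.summable.tsum_eq_zero_add, H.left_zero, zero_mul, zero_add]
    -- The first series is `C` times the continuation at `s = (k-1)/2`; the second is evaluated by
    -- Voronoi summation.
    rw [RieszSum.rieszSum_eq_tsum H.right_zero hρ hX,
      (H.summable_right_mul_cpow _).tsum_add (H.hasSum_right_rieszWeight hρ hX).summable,
      H.tsum_rieszWeight hρ hX]
    simp only [hterm, tsum_mul_left]
    rw [hshift, mul_inv_cancel_left₀ hC, show ((ν + 1 : ℕ) : ℂ) = (ν : ℂ) + 1 by push_cast; rfl,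
      Complex.Gamma_nat_eq_factorial, hI]
    have hf0 : (ν.factorial : ℂ) ≠ 0 := by exact_mod_cast ν.factorial_ne_zero
    have hπ : (Real.pi : ℂ) ≠ 0 := by exact_mod_cast Real.pi_pos.ne'
    have hI0 := Complex.I_ne_zero
    congr 1
    -- The factor `2πi ν!/Γ(ρ+1)` carried by each line integral cancels the constant of the theorem
    -- down to `i^{-k} N^{k/2}`.
    rw [pow_succ Complex.I (ν + 1)]
    field_simp
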